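/- **Setting.** Let $\Lambda\subset(0,\infty)$ be a finite or countable set. Let $\mathbb U_\Lambda$ be the ultrametric Urysohn space with spectrum $\Lambda$: its points are the functions $\omega:\Lambda\to\mathbb Z$ such that for every $\varepsilon>0$ only finitely many $\lambda\geqslant\varepsilon$ satisfy $\omega(\lambda)\ne0$, and $d(\omega,\omega')$ is the largest $\lambda\in\Lambda$ with $\omega(\lambda)\neq\omega'(\lambda)$ (and $0$ if $\omega=\omega'$). Let $\mathbb I_\Lambda$ be the group of all isometries of $\mathbb U_\Lambda$ onto itself, with the topology of pointwise convergence. A unitary representation of $\mathbb I_\Lambda$ is a homomorphism to the unitary group of a separable complex Hilbert space that is continuous in the strong operator topology. *The tree.* The points of the $\mathbb R$-tree $T=T(\mathbb U_\Lambda)$ are the symbols $\beta(x,r)$ with $x\in\mathbb U_\Lambda$, $0\leqslant r\leqslant\infty$, where $\beta(x,r)=\beta(y,s)$ iff $r=s$ and $d(x,y)\leqslant r$; in particular $\beta(x,\infty)$ is one point $\infty$. The height of $\beta(x,r)$ is $r$. The ascending path of $\xi=\beta(x,r)$ is $L_\xi=\{\beta(x,s):s\geqslant r\}$ ($\infty$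 included); the elements of $L_\xi\setminus\{\xi\}$ are said to be over $\xi$. The vertices are the points whose height is in $\Lambda$. The descending germs at a vertex $v=\beta(x,\lambda)$ correspond to the open balls $\{z:d(y,z)<\lambda\}$ with $d(x,y)\leqslant\lambda$; such a germ is directed to $\beta(z,s)$ if $s<\lambda$ and $z$ is in this open ball. Let $\widetilde T$ be the disjoint union of the set of all points $\xi\in T$ that have positive height or have the form $\beta(x,0)$ with $x$ an isolated point of $\mathbb U_\Lambda$, and of the set of all descending germs at all vertices. If $\xi$ is over $\eta$, the segment $[\xi,\eta]$ is naked if no point strictly between $\xi$ and $\eta$ is a vertex, and it is maximal naked if it is not properly contained in another naked segment. *Woolly subtrees.* A non-empty subset $S\subset\widetilde T$ is a woolly subtree if: 1. if a point $\xi$ is in $S$, then $L_\xi\subset S$ and all descending germs directed to $\xi$ are in $S$; 2. if a descending germ at $v$ is in $S$, then $v\in S$; 3. for each maximal naked segment $[\xi,\eta]$, with $\xi$ over $\eta$, one has $\eta\in S$ whenever $S$ contains an interior point of $[\xi,\eta]$, or $\xi$ is a vertex and the germ at $\xi$ directed to $\eta$ is in $S$, or $\xi$ is not a vertex and $\xi\in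 S$. *The semigroup.* The elements of $\Gamma_\Lambda$ are the partial bijections $\pi$ of $\widetilde T$ that map a woolly subtree isomorphically and with preservation of heights onto a woolly subtree. That is, $\pi$ sends points to points and germs to germs, preserves heights (the height of a germ is the height of its vertex), and preserves in both directions the relation 'lies under', where a germ lies under its vertex and over the points to which it is directed. The product is the product of partial bijections, $\pi^*$ is the inverse partial bijection, and the topology is generated by the sets $\{\pi:\pi(a)=b\}$ and their complements, $a,b\in\widetilde T$. The group $\mathbb I_\Lambda$ acts on $\widetilde T$ and so is embedded in $\Gamma_\Lambda$. **Theorem.** The semigroup $\Gamma_\Lambda$ is compact. For every unitary representation $\rho$ of $\mathbb I_\Lambda$ in a separable complex Hilbert space $H$ there is a unique $*$-representation $\overline\rho$ of $\Gamma_\Lambda$ in $H$ (that is, a map to bounded operators with $\overline\rho(1)=1$, $\overline\rho(\pi\psi)=\overline\rho(\pi)\overline\rho(\psi)$ and $\overline\rho(\pi^*)=\overline\rho(\pi)^*$) that is continuous in the weak operator topology and coincides with $\rho$ on $\mathbb I_\Lambda$. Moreover, the closure of $\rho(\mathbb I_\Lambda)$ in the weak operator topology coincides with $\overline\rho(\Gamma_\Lambda)$.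 -/

import Mathlib

open scoped ENNReal

/-! ### The ultrametric Urysohn space -/

/-- The points of the ultrametric Urysohn space with spectrum `Λ ⊆ (0, ∞)`: functions `Λ → ℤ` whose
support is finite or is a sequence converging to `0`, i.e. has finitely many elements above every
`ε > 0`. -/
@[ext]
structure UrysohnSpace (Λ : Set (Set.Ioi (0 : ℝ))) where
  toFun : Λ → ℤ
  finite_support : ∀ ε : ℝ, 0 < ε → {l : Λ | ε ≤ l.1.1 ∧ toFun l ≠ 0}.Finite

namespace UrysohnSpace

variable {Λ : Set (Set.Ioi (0 : ℝ))}

/-- The set of all `λ ∈ Λ` at which two functions differ. -/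
def diffSet (a b : UrysohnSpace Λ) : Set ℝ := {t | ∃ l : Λ, l.1.1 = t ∧ a.toFun l ≠ b.toFun l}

/-- The distance is the largest `λ ∈ Λ` at which the two functions differ (`0` if there is none);
the supremum below is attained. -/
noncomputable def distance (a b : UrysohnSpace Λ) : ℝ := sSup (diffSet a b)

theorem finite_diff (a b : UrysohnSpace Λ) (ε : ℝ) (hε : 0 < ε) :
    {l : Λ | ε ≤ l.1.1 ∧ a.toFun l ≠ b.toFun l}.Finite := by
  refine ((a.finite_support ε hε).union (b.finite_support ε hε)).subset ?_
  rintro l ⟨h1, h2⟩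
  by_cases h : a.toFun l = 0
  · exact Or.inr ⟨h1, fun h' => h2 (h.trans h'.symm)⟩
  · exact Or.inl ⟨h1, h⟩

theorem bddAbove_diffSet (a b : UrysohnSpace Λ) : BddAbove (diffSet a b) := by
  have h := ((finite_diff a b 1 one_pos).image (fun l : Λ => l.1.1)).bddAbove
  obtain ⟨M, hM⟩ := h
  refine ⟨max M 1, ?_⟩
  rintro t ⟨l, rfl, hl⟩
  by_cases h1 : 1 ≤ l.1.1
  · exact le_max_of_le_left (hM ⟨l, ⟨h1, hl⟩, rfl⟩)
  · exact le_max_of_le_right (le_of_not_ge h1)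

theorem distance_le_iff (a b : UrysohnSpace Λ) {r : ℝ} (hr : 0 ≤ r) :
    distance a b ≤ r ↔ ∀ l : Λ, a.toFun l ≠ b.toFun l → l.1.1 ≤ r := by
  constructor
  · intro h l hl
    exact (le_csSup (bddAbove_diffSet a b) ⟨l, rfl, hl⟩).trans h
  · intro h
    refine Real.sSup_le ?_ hr
    rintro t ⟨l, rfl, hl⟩
    exact h l hl

theorem distance_nonneg (a b : UrysohnSpace Λ) : 0 ≤ distance a b := by
  refine Real.sSup_nonneg ?_
  rintro t ⟨l, rfl, -⟩
  exact (Set.mem_Ioi.1 l.1.2).le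

theorem distance_self (a : UrysohnSpace Λ) : distance a a = 0 :=
  le_antisymm ((distance_le_iff a a le_rfl).2 fun _ h => absurd rfl h) (distance_nonneg a a)

theorem distance_comm (a b : UrysohnSpace Λ) : distance a b = distance b a := by
  unfold distance diffSet
  simp only [ne_comm]

theorem distance_le_max (a b c : UrysohnSpace Λ) :
    distance a c ≤ max (distance a b) (distance b c) := by
  refine (distance_le_iff a c (le_max_of_le_left (distance_nonneg a b))).2 fun l hl => ?_
  by_cases h : a.toFun l = b.toFun l
  · exact le_max_of_le_right
      ((distance_le_iff b c (distance_nonneg b c)).1 le_rfl l fun h' => hl (h.trans h'))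
  · exact le_max_of_le_left ((distance_le_iff a b (distance_nonneg a b)).1 le_rfl l h)

noncomputable instance instMetricSpace : MetricSpace (UrysohnSpace Λ) where
  dist := distance
  dist_self := distance_self
  dist_comm := distance_comm
  dist_triangle a b c := (distance_le_max a b c).trans
    (max_le_add_of_nonneg (distance_nonneg a b) (distance_nonneg b c))
  eq_of_dist_eq_zero := by
    intro a b h
    ext l
    by_contra hl
    have h1 : l.1.1 ≤ 0 := (distance_le_iff a b le_rfl).1 (le_of_eq h) l hl
    exact absurd (Set.mem_Ioi.1 l.1.2) (not_lt.2 h1)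

instance instIsUltrametricDist : IsUltrametricDist (UrysohnSpace Λ) where
  dist_triangle_max := distance_le_max

instance instNonempty : Nonempty (UrysohnSpace Λ) :=
  ⟨⟨fun _ => 0, fun _ _ => by simp⟩⟩

end UrysohnSpace

/-! ### The tree of an ultrametric space -/

section Tree

theorem edist_le_max_of_ultra {X : Type*} [MetricSpace X] [IsUltrametricDist X] (x y z : X) :
    edist x z ≤ max (edist x y) (edist y z) := by
  rw [edist_dist, edist_dist, edist_dist, ← ENNReal.ofReal_max]
  exact ENNReal.ofReal_le_ofReal (dist_triangle_max x y z)

/-- Two symbols `β(x, r)` and `β(y, s)` denote the same ideal closed ball iff `r = s` and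
`d(x, y) ≤ r`. -/
def idealBallSetoid (X : Type*) [MetricSpace X] [IsUltrametricDist X] : Setoid (X × ℝ≥0∞) where
  r p q := p.2 = q.2 ∧ edist p.1 q.1 ≤ p.2
  iseqv :=
    { refl := fun p => ⟨rfl, by simp⟩
      symm := fun {p q} h => ⟨h.1.symm, by rw [edist_comm, ← h.1]; exact h.2⟩
      trans := fun {p q s} h k => ⟨h.1.trans k.1, (edist_le_max_of_ultra p.1 q.1 s.1).trans
        (max_le h.2 (by rw [h.1]; exact k.2))⟩ }

/-- The points of the `ℝ`-tree `T(X)`: ideal closed balls `β(x, r)`, `0 ≤ r < ∞`, together with the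
point `∞` at infinite height (the ideal ball `β(x, ∞)`, which does not depend on `x`). -/
def TreePoint (X : Type*) [MetricSpace X] [IsUltrametricDist X] : Type _ :=
  Quotient (idealBallSetoid X)

/-- Two symbols of open balls `B°(x, λ)`, `B°(y, μ)` with radii in `Λ` denote the same germ iff
`λ = μ` and `d(x, y) < λ`. -/
def germSetoid (Λ : Set (Set.Ioi (0 : ℝ))) (X : Type*) [MetricSpace X] [IsUltrametricDist X] :
    Setoid (X × Λ) where
  r p q := p.2 = q.2 ∧ dist p.1 q.1 < p.2.1.1
  iseqv :=
    { refl := fun p => ⟨rfl, by rw [dist_self]; exact p.2.1.2⟩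
      symm := fun {p q} h => ⟨h.1.symm, by rw [dist_comm, ← h.1]; exact h.2⟩
      trans := fun {p q s} h k => ⟨h.1.trans k.1, (dist_triangle_max p.1 q.1 s.1).trans_lt
        (max_lt h.2 (by rw [h.1]; exact k.2))⟩ }

/-- The descending germs at the vertices of `T(X)`. All points of `T(X)` of height `λ ∈ Λ` are
vertices, and the descending germs at the vertex `β(x, λ)` are the germs of the geodesics from it
to the points `y` under it; the germs towards `y` and `z` agree iff `d(y, z) < λ`. -/
def DownGerm (Λ : Set (Set.Ioi (0 : ℝ))) (X : Type*) [MetricSpace X] [IsUltrametricDist X] :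
    Type _ :=
  Quotient (germSetoid Λ X)

variable {Λ : Set (Set.Ioi (0 : ℝ))} {X : Type*} [MetricSpace X] [IsUltrametricDist X]

namespace TreePoint

/-- The ideal closed ball `β(x, r)`. -/
def mk (x : X) (r : ℝ≥0∞) : TreePoint X := Quotient.mk (idealBallSetoid X) (x, r)

theorem mk_eq_mk {x y : X} {r s : ℝ≥0∞} : mk x r = mk y s ↔ r = s ∧ edist x y ≤ r :=
  Quotient.eq (r := idealBallSetoid X)

theorem exists_rep (p : TreePoint X) : ∃ x r, p = mk x r := by
  obtain ⟨⟨x, r⟩, rfl⟩ := Quotient.exists_rep p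
  exact ⟨x, r, rfl⟩

/-- The height `𝔥(β(x, r)) = r`. -/
def height (p : TreePoint X) : ℝ≥0∞ := Quotient.lift (fun q : X × ℝ≥0∞ => q.2) (fun _ _ h => And.left h) p

@[simp] theorem height_mk (x : X) (r : ℝ≥0∞) : height (mk x r) = r := rfl

/-- The ascending path `L_p` from `p = β(x, r)`: all the points `β(x, s)` with `s ≥ r`,
including `∞`. The points of `L_p` other than `p` are those which are over `p`. -/
def ascendingPath (p : TreePoint X) : Set (TreePoint X) :=
  {q | ∃ x r s, r ≤ s ∧ p = mk x r ∧ q = mk x s}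

theorem mem_ascendingPath_mk {x y : X} {r s : ℝ≥0∞} :
    mk y s ∈ ascendingPath (mk x r) ↔ r ≤ s ∧ edist x y ≤ s := by
  constructor
  · rintro ⟨z, r', s', h, h1, h2⟩
    obtain ⟨rfl, k1⟩ := mk_eq_mk.1 h1
    obtain ⟨rfl, k2⟩ := mk_eq_mk.1 h2
    refine ⟨h, (edist_le_max_of_ultra x z y).trans (max_le (k1.trans h) ?_)⟩
    rwa [edist_comm]
  · rintro ⟨h, h1⟩
    exact ⟨x, r, s, h, rfl, mk_eq_mk.2 ⟨rfl, by rwa [edist_comm]⟩⟩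

end TreePoint

namespace DownGerm

/-- The germ at the vertex `β(x, λ)` directed towards `x`; it corresponds to the open ball
`B°(x, λ)`. -/
def mk (x : X) (l : Λ) : DownGerm Λ X := Quotient.mk (germSetoid Λ X) (x, l)

theorem mk_eq_mk {x y : X} {l m : Λ} : mk x l = mk y m ↔ l = m ∧ dist x y < l.1.1 :=
  Quotient.eq (r := germSetoid Λ X)

theorem exists_rep (g : DownGerm Λ X) : ∃ x l, g = mk x l := by
  obtain ⟨⟨x, r⟩, rfl⟩ := Quotient.exists_rep g
  exact ⟨x, r, rfl⟩

/-- The vertex at which a germ is attached. -/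
noncomputable def vertex (g : DownGerm Λ X) : TreePoint X :=
  Quotient.lift (fun q : X × Λ => TreePoint.mk q.1 (ENNReal.ofReal q.2.1.1))
    (fun p q h => TreePoint.mk_eq_mk.2 ⟨by rw [h.1], by
      rw [edist_dist]; exact ENNReal.ofReal_le_ofReal h.2.le⟩) g

@[simp] theorem vertex_mk (x : X) (l : Λ) :
    vertex (mk x l) = TreePoint.mk x (ENNReal.ofReal l.1.1) := rfl

/-- The germ `g` is directed to the point `p`, which lies strictly under the vertex of `g`. -/
def DirectedTo (g : DownGerm Λ X) (p : TreePoint X) : Prop :=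
  ∃ (x : X) (l : Λ) (r : ℝ≥0∞), r < ENNReal.ofReal l.1.1 ∧ g = mk x l ∧ p = TreePoint.mk x r

theorem directedTo_mk {x y : X} {l : Λ} {r : ℝ≥0∞} :
    DirectedTo (mk x l) (TreePoint.mk y r) ↔ r < ENNReal.ofReal l.1.1 ∧ dist x y < l.1.1 := by
  constructor
  · rintro ⟨z, m, s, h, h1, h2⟩
    obtain ⟨rfl, k1⟩ := mk_eq_mk.1 h1
    obtain ⟨rfl, k2⟩ := TreePoint.mk_eq_mk.1 h2
    refine ⟨h, (dist_triangle_max x z y).trans_lt (max_lt k1 ?_)⟩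
    have h3 := k2.trans_lt h
    rw [edist_dist, ENNReal.ofReal_lt_ofReal_iff l.1.2] at h3
    rwa [dist_comm]
  · rintro ⟨h, h1⟩
    exact ⟨y, l, r, h, mk_eq_mk.2 ⟨rfl, h1⟩, rfl⟩

end DownGerm

/-! ### Naked segments -/

/-- An actual vertex of `T(X)`: at least two germs go down from it (its valence is at least `3`,
as one more germ goes up). -/
def IsActualVertex (Λ : Set (Set.Ioi (0 : ℝ))) (p : TreePoint X) : Prop :=
  ∃ g₁ g₂ : DownGerm Λ X, g₁ ≠ g₂ ∧ g₁.vertex = p ∧ g₂.vertex = p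

/-- The segment `[p, q]`, with `p` over `q`, is naked: no interior point is an actual vertex. -/
def IsNaked (Λ : Set (Set.Ioi (0 : ℝ))) (p q : TreePoint X) : Prop :=
  p ∈ q.ascendingPath ∧ p ≠ q ∧
    ∀ z ∈ q.ascendingPath, p ∈ z.ascendingPath → z ≠ p → z ≠ q → ¬ IsActualVertex Λ z

/-- The segment `[p, q]`, with `p` over `q`, is a maximal naked segment. -/
def IsMaximalNaked (Λ : Set (Set.Ioi (0 : ℝ))) (p q : TreePoint X) : Prop :=
  IsNaked Λ p q ∧ ∀ p' ∈ p.ascendingPath, ∀ q', q ∈ q'.ascendingPath →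
    IsNaked Λ p' q' → p' = p ∧ q' = q

/-! ### Woolly subtrees -/

/-- The points of `T(X)` of positive height and the isolated points of `X`. -/
def CorePoint (X : Type*) [MetricSpace X] [IsUltrametricDist X] : Type _ :=
  {p : TreePoint X // 0 < p.height ∨ ∃ x : X, IsOpen ({x} : Set X) ∧ p = TreePoint.mk x 0}

/-- The set `T̃(X)`: the disjoint union of the set of points of `T(X)` that have positive height or
are isolated points of `X`, and of the set of all descending germs at vertices. -/
abbrev TildeTree (Λ : Set (Set.Ioi (0 : ℝ))) (X : Type*) [MetricSpace X] [IsUltrametricDist X] :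
    Type _ :=
  CorePoint X ⊕ DownGerm Λ X

/-- Woolly subtrees of `T(X)`. -/
structure IsWoolly (S : Set (TildeTree Λ X)) : Prop where
  nonempty : S.Nonempty
  path : ∀ p q : CorePoint X, q.1 ∈ p.1.ascendingPath → Sum.inl p ∈ S → Sum.inl q ∈ S
  germ : ∀ (p : CorePoint X) (g : DownGerm Λ X), g.DirectedTo p.1 → Sum.inl p ∈ S → Sum.inr g ∈ S
  vertex : ∀ (g : DownGerm Λ X) (v : CorePoint X), g.vertex = v.1 → Sum.inr g ∈ S → Sum.inl v ∈ S
  /-- If an interior point of a maximal naked segment is in `S`, so is its lower end. -/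
  naked_interior : ∀ p q z : CorePoint X, IsMaximalNaked Λ p.1 q.1 →
    z.1 ∈ q.1.ascendingPath → p.1 ∈ z.1.ascendingPath → z ≠ p → z ≠ q →
    Sum.inl z ∈ S → Sum.inl q ∈ S
  /-- If the upper end of a maximal naked segment is a vertex, and its germ along the segment is in
  `S`, so is the lower end. -/
  naked_germ : ∀ (p q : CorePoint X) (g : DownGerm Λ X), IsMaximalNaked Λ p.1 q.1 →
    g.vertex = p.1 → g.DirectedTo q.1 → Sum.inr g ∈ S → Sum.inl q ∈ S
  /-- If the upper end of a maximal naked segment is not a vertex and is in `S`, so is the lower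
  end. -/
  naked_upper : ∀ p q : CorePoint X, IsMaximalNaked Λ p.1 q.1 →
    (¬ ∃ l : Λ, p.1.height = ENNReal.ofReal l.1.1) → Sum.inl p ∈ S → Sum.inl q ∈ S

namespace TildeTree

/-- The height of a point, or of the vertex of a germ. -/
noncomputable def height : TildeTree Λ X → ℝ≥0∞
  | Sum.inl p => p.1.height
  | Sum.inr g => g.vertex.height

/-- `a.Under b`: the element `a` of `T̃(X)` is equal to `b` or lies under `b`. A germ lies under its
vertex, and over all the points to which it is directed. -/
def Under : TildeTree Λ X → TildeTree Λ X → Prop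
  | Sum.inl p, Sum.inl q => q.1 ∈ p.1.ascendingPath
  | Sum.inr g, Sum.inl q => q.1 ∈ g.vertex.ascendingPath
  | Sum.inl p, Sum.inr g => g.DirectedTo p.1
  | Sum.inr g, Sum.inr g' => g = g' ∨ g'.DirectedTo g.vertex

end TildeTree

end Tree

/-! ### Partial bijections -/

/-- Partial bijections of a set to itself. -/
def PartialBijection (Ω : Type*) : Type _ := Ω ≃. Ω

namespace PartialBijection

variable {Ω : Type*}

/-- `φ.Sends a b`: the element `a` is in the domain of `φ`, and `φ(a) = b`. -/
def Sends (φ : PartialBijection Ω) (a b : Ω) : Prop := b ∈ PEquiv.toFun φ a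

/-- The domain of definition. -/
def dom (φ : PartialBijection Ω) : Set Ω := {a | ∃ b, φ.Sends a b}

/-- The image. -/
def im (φ : PartialBijection Ω) : Set Ω := {b | ∃ a, φ.Sends a b}

/-- The product `ψ * φ` is the partial bijection `a ↦ ψ(φ(a))` with its natural domain. -/
instance instMonoid : Monoid (PartialBijection Ω) where
  mul ψ φ := PEquiv.trans φ ψ
  one := PEquiv.refl Ω
  mul_assoc ψ φ χ := (PEquiv.trans_assoc χ φ ψ).symm
  one_mul φ := PEquiv.trans_refl φ
  mul_one φ := PEquiv.refl_trans φ

/-- The involution sends a partial bijection to its inverse. -/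
instance instStarMul : StarMul (PartialBijection Ω) where
  star φ := PEquiv.symm φ
  star_involutive φ := PEquiv.symm_symm φ
  star_mul ψ φ := PEquiv.symm_trans_rev φ ψ

/-- The topology whose base consists of the finite intersections of the sets of all `φ` with
`φ(a) = b` and the sets of all `φ` for which `b` is not the `φ`-image of `a`. -/
instance instTopologicalSpace : TopologicalSpace (PartialBijection Ω) :=
  TopologicalSpace.generateFrom
    {s | ∃ a b : Ω, s = {φ | φ.Sends a b} ∨ s = {φ | ¬ φ.Sends a b}}

theorem sends_one {a b : Ω} : (1 : PartialBijection Ω).Sends a b ↔ a = b := by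
  change b ∈ (PEquiv.refl Ω) a ↔ a = b
  simp

theorem sends_star {φ : PartialBijection Ω} {a b : Ω} : (star φ).Sends a b ↔ φ.Sends b a :=
  PEquiv.mem_iff_mem φ

theorem sends_mul {ψ φ : PartialBijection Ω} {a c : Ω} :
    (ψ * φ).Sends a c ↔ ∃ b, φ.Sends a b ∧ ψ.Sends b c :=
  PEquiv.mem_trans φ ψ a c

theorem Sends.unique {φ : PartialBijection Ω} {a b c : Ω} (h : φ.Sends a b) (k : φ.Sends a c) :
    b = c :=
  Option.mem_unique h k

theorem dom_star (φ : PartialBijection Ω) : (star φ).dom = φ.im := by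
  ext a; simp only [dom, im, Set.mem_ofPred_eq, sends_star]

theorem im_star (φ : PartialBijection Ω) : (star φ).im = φ.dom := by
  ext a; simp only [dom, im, Set.mem_ofPred_eq, sends_star]

end PartialBijection

/-! ### Partial isomorphisms of woolly subtrees -/

/-- The partial bijection `π` of `T̃(X)` is a height-preserving isomorphism of a woolly subtree to a
woolly subtree: it sends points to points and germs to germs, and preserves heights and the relation
"lies under". (Heights and this relation determine the distances in the tree:
`d(p, q) = 𝔥(p ∨ q) - (𝔥(p) + 𝔥(q)) / 2`, where `p ∨ q` is the highest point of `[p, q]`.) -/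
structure IsWoollyIso {Λ : Set (Set.Ioi (0 : ℝ))} {X : Type*} [MetricSpace X] [IsUltrametricDist X]
    (π : PartialBijection (TildeTree Λ X)) : Prop where
  dom_woolly : IsWoolly π.dom
  im_woolly : IsWoolly π.im
  isLeft : ∀ a b, π.Sends a b → a.isLeft = b.isLeft
  height : ∀ a b, π.Sends a b → TildeTree.height a = TildeTree.height b
  under : ∀ a a' b b', π.Sends a b → π.Sends a' b' →
    (TildeTree.Under a a' ↔ TildeTree.Under b b')

section Closure

variable {Λ : Set (Set.Ioi (0 : ℝ))}

namespace UrysohnSpace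

/-- All the points of `T(𝕌_Λ)` of height `λ ∈ Λ` are actual vertices, and there are no others. -/
theorem isActualVertex_iff (p : TreePoint (UrysohnSpace Λ)) :
    IsActualVertex Λ p ↔ ∃ l : Λ, p.height = ENNReal.ofReal l.1.1 := by
  classical
  constructor
  · rintro ⟨g, -, -, rfl, -⟩
    obtain ⟨x, l, rfl⟩ := g.exists_rep
    exact ⟨l, rfl⟩
  · rintro ⟨l, hl⟩
    obtain ⟨x, r, rfl⟩ := p.exists_rep
    rw [TreePoint.height_mk] at hl
    subst hl
    let y : UrysohnSpace Λ := ⟨Function.update x.toFun l (x.toFun l + 1), fun ε hε => by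
      refine ((x.finite_support ε hε).union (Set.finite_singleton l)).subset ?_
      rintro m ⟨h1, h2⟩
      by_cases h : m = l
      · exact Or.inr h
      · exact Or.inl ⟨h1, by rwa [Function.update_of_ne h] at h2⟩⟩
    have hy : ∀ m : Λ, x.toFun m ≠ y.toFun m ↔ m = l := by
      intro m
      by_cases h : m = l
      · subst h; simp [y]
      · simp [y, h]
    have hd : dist x y ≤ l.1.1 :=
      (distance_le_iff x y (Set.mem_Ioi.1 l.1.2).le).2 fun m hm => by rw [(hy m).1 hm]
    have hd' : l.1.1 ≤ dist x y :=
      (distance_le_iff x y (distance_nonneg x y)).1 le_rfl l ((hy l).2 rfl)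
    refine ⟨DownGerm.mk x l, DownGerm.mk y l, fun h => ?_, rfl, ?_⟩
    · exact absurd (DownGerm.mk_eq_mk.1 h).2 (not_lt.2 hd')
    · rw [DownGerm.vertex_mk, TreePoint.mk_eq_mk, edist_comm, edist_dist]
      exact ⟨rfl, ENNReal.ofReal_le_ofReal hd⟩

end UrysohnSpace

/-- There are no elements of `Λ` strictly between `r` and `s`. -/
def IsGap (Λ : Set (Set.Ioi (0 : ℝ))) (s r : ℝ≥0∞) : Prop :=
  r < s ∧ ∀ l : Λ, r < ENNReal.ofReal l.1.1 → ¬ ENNReal.ofReal l.1.1 < s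

theorem isNaked_mk_iff (x : UrysohnSpace Λ) (r s : ℝ≥0∞) (hrs : r ≤ s) :
    IsNaked Λ (TreePoint.mk x s) (TreePoint.mk x r) ↔ IsGap Λ s r := by
  constructor
  · rintro ⟨-, h2, h3⟩
    have hlt : r < s := lt_of_le_of_ne hrs (fun h => h2 (by rw [h]))
    refine ⟨hlt, fun l h h' => h3 (TreePoint.mk x (ENNReal.ofReal l.1.1)) ?_ ?_ ?_ ?_ ?_⟩
    · exact ⟨x, _, _, h.le, rfl, rfl⟩
    · exact ⟨x, _, _, h'.le, rfl, rfl⟩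
    · exact fun e => h'.ne (TreePoint.mk_eq_mk.1 e).1
    · exact fun e => h.ne' (TreePoint.mk_eq_mk.1 e).1
    · exact (UrysohnSpace.isActualVertex_iff _).2 ⟨l, rfl⟩
  · rintro ⟨h1, h2⟩
    refine ⟨⟨x, r, s, hrs, rfl, rfl⟩, fun e => h1.ne' (TreePoint.mk_eq_mk.1 e).1, ?_⟩
    intro z hz hz' hs hr hv
    obtain ⟨l, hl⟩ := (UrysohnSpace.isActualVertex_iff _).1 hv
    obtain ⟨y, t, rfl⟩ := z.exists_rep
    rw [TreePoint.height_mk] at hl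
    rw [TreePoint.mem_ascendingPath_mk] at hz hz'
    have ht : r ≠ t := fun e => hr (TreePoint.mk_eq_mk.2 ⟨e.symm, by
      rw [edist_comm]; exact hz.2⟩)
    have ht' : t ≠ s := fun e => hs (TreePoint.mk_eq_mk.2 ⟨e, by
      rw [edist_comm]; exact hz.2⟩)
    exact h2 l (hl ▸ lt_of_le_of_ne hz.1 ht) (hl ▸ lt_of_le_of_ne hz'.1 ht')

theorem exists_rep_of_mem {p q : TreePoint (UrysohnSpace Λ)} (h : p ∈ q.ascendingPath) :
    ∃ x, p = TreePoint.mk x p.height ∧ q = TreePoint.mk x q.height ∧ q.height ≤ p.height := by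
  obtain ⟨x, r, s, h, rfl, rfl⟩ := h
  exact ⟨x, rfl, rfl, h⟩

/-- Maximality of a naked segment depends only on the heights of its ends. -/
theorem isMaximalNaked_iff (p q : TreePoint (UrysohnSpace Λ)) (h : p ∈ q.ascendingPath) :
    IsMaximalNaked Λ p q ↔ IsGap Λ p.height q.height ∧
      ∀ s r, p.height ≤ s → r ≤ q.height → IsGap Λ s r → s = p.height ∧ r = q.height := by
  obtain ⟨x, r, s, hrs, rfl, rfl⟩ := h
  simp only [TreePoint.height_mk]
  unfold IsMaximalNaked
  rw [isNaked_mk_iff x r s hrs]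
  refine and_congr_right fun _ => ⟨fun H s' r' hs hr hg => ?_, fun H p' hp q' hq hn => ?_⟩
  · have := H (TreePoint.mk x s') ⟨x, _, _, hs, rfl, rfl⟩ (TreePoint.mk x r')
      ⟨x, _, _, hr, rfl, rfl⟩ ((isNaked_mk_iff x r' s' (hr.trans (hrs.trans hs))).2 hg)
    exact ⟨(TreePoint.mk_eq_mk.1 this.1).1, (TreePoint.mk_eq_mk.1 this.2).1⟩
  · obtain ⟨y, r', rfl⟩ := q'.exists_rep
    obtain ⟨z, s', rfl⟩ := p'.exists_rep
    rw [TreePoint.mem_ascendingPath_mk] at hp hq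
    have e1 : TreePoint.mk x r = TreePoint.mk y r :=
      TreePoint.mk_eq_mk.2 ⟨rfl, by rw [edist_comm]; exact hq.2⟩
    have e2 : TreePoint.mk z s' = TreePoint.mk y s' := by
      refine TreePoint.mk_eq_mk.2 ⟨rfl, (edist_le_max_of_ultra z x y).trans (max_le ?_ ?_)⟩
      · rw [edist_comm]; exact hp.2
      · rw [edist_comm]; exact hq.2.trans (hrs.trans hp.1)
    rw [e2] at hn
    have := H s' r' hp.1 hq.1
      ((isNaked_mk_iff y r' s' (hq.1.trans (hrs.trans hp.1))).1 hn)
    obtain ⟨rfl, rfl⟩ := this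
    exact ⟨TreePoint.mk_eq_mk.2 ⟨rfl, by rw [edist_comm]; exact hp.2⟩, e1.symm⟩

/-- The point `∞` of `T(𝕌_Λ)`. -/
noncomputable def corePointTop (Λ : Set (Set.Ioi (0 : ℝ))) : CorePoint (UrysohnSpace Λ) :=
  ⟨TreePoint.mk (Classical.arbitrary _) ⊤, Or.inl ENNReal.zero_lt_top⟩

theorem eq_corePointTop (p : CorePoint (UrysohnSpace Λ)) (h : p.1.height = ⊤) :
    p = corePointTop Λ := by
  obtain ⟨p, hp⟩ := p
  obtain ⟨x, r, rfl⟩ := p.exists_rep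
  exact Subtype.ext (TreePoint.mk_eq_mk.2 ⟨h, by rw [TreePoint.height_mk] at h; simp [h]⟩)

theorem ofReal_level_pos (l : Λ) : 0 < ENNReal.ofReal l.1.1 :=
  ENNReal.ofReal_pos.2 l.1.2

/-- The vertex of a germ as an element of `T̃`. -/
noncomputable def DownGerm.coreVertex (g : DownGerm Λ (UrysohnSpace Λ)) :
    CorePoint (UrysohnSpace Λ) :=
  ⟨g.vertex, Or.inl (by
    obtain ⟨x, l, rfl⟩ := g.exists_rep
    exact ofReal_level_pos l)⟩

theorem IsWoolly.top_mem {S : Set (TildeTree Λ (UrysohnSpace Λ))} (h : IsWoolly S) :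
    Sum.inl (corePointTop Λ) ∈ S := by
  have key : ∀ p : CorePoint (UrysohnSpace Λ), Sum.inl p ∈ S → Sum.inl (corePointTop Λ) ∈ S := by
    intro p hp
    refine h.path p _ ?_ hp
    obtain ⟨x, r, hx⟩ := p.1.exists_rep
    rw [hx]
    exact TreePoint.mem_ascendingPath_mk.2 ⟨le_top, le_top⟩
  obtain ⟨a | g, ha⟩ := h.nonempty
  · exact key a ha
  · exact key g.coreVertex (h.vertex g _ rfl ha)

namespace IsWoollyIso

open PartialBijection

variable {π ψ : PartialBijection (TildeTree Λ (UrysohnSpace Λ))}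

theorem sends_inl (h : IsWoollyIso π) {p : CorePoint (UrysohnSpace Λ)}
    (hp : (Sum.inl p : TildeTree Λ (UrysohnSpace Λ)) ∈ π.dom) :
    ∃ p', π.Sends (Sum.inl p) (Sum.inl p') ∧ p.1.height = p'.1.height := by
  obtain ⟨b | b, hb⟩ := hp
  · exact ⟨b, hb, h.height _ _ hb⟩
  · exact absurd (h.isLeft _ _ hb) (by simp)

theorem sends_inr (h : IsWoollyIso π) {g : DownGerm Λ (UrysohnSpace Λ)}
    (hg : (Sum.inr g : TildeTree Λ (UrysohnSpace Λ)) ∈ π.dom) :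
    ∃ g', π.Sends (Sum.inr g) (Sum.inr g') ∧ g.vertex.height = g'.vertex.height := by
  obtain ⟨b | b, hb⟩ := hg
  · exact absurd (h.isLeft _ _ hb) (by simp)
  · exact ⟨b, hb, h.height _ _ hb⟩

theorem top_sends (h : IsWoollyIso π) :
    π.Sends (Sum.inl (corePointTop Λ)) (Sum.inl (corePointTop Λ)) := by
  obtain ⟨p, hp, he⟩ := h.sends_inl h.dom_woolly.top_mem
  rwa [eq_corePointTop p he.symm] at hp

/-- Maximal naked segments go to maximal naked segments. -/
theorem maximalNaked (h : IsWoollyIso π) {p q p' q' : CorePoint (UrysohnSpace Λ)}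
    (hp : π.Sends (Sum.inl p) (Sum.inl p')) (hq : π.Sends (Sum.inl q) (Sum.inl q'))
    (hn : IsMaximalNaked Λ p.1 q.1) : IsMaximalNaked Λ p'.1 q'.1 := by
  have h1 : p.1.height = p'.1.height := h.height _ _ hp
  have h2 : q.1.height = q'.1.height := h.height _ _ hq
  have h3 : p'.1 ∈ q'.1.ascendingPath := (h.under _ _ _ _ hq hp).1 hn.1.1
  rw [isMaximalNaked_iff _ _ hn.1.1, h1, h2] at hn
  rwa [isMaximalNaked_iff _ _ h3]

theorem mem_dom_mul {a b : TildeTree Λ (UrysohnSpace Λ)} (hab : π.Sends a b) :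
    a ∈ (ψ * π).dom ↔ b ∈ ψ.dom := by
  constructor
  · rintro ⟨c, hc⟩
    obtain ⟨b', h1, h2⟩ := sends_mul.1 hc
    rw [hab.unique h1]
    exact ⟨c, h2⟩
  · rintro ⟨c, hc⟩
    exact ⟨c, sends_mul.2 ⟨b, hab, hc⟩⟩

theorem dom_mul_subset {a : TildeTree Λ (UrysohnSpace Λ)} (h : a ∈ (ψ * π).dom) : a ∈ π.dom := by
  obtain ⟨c, hc⟩ := h
  obtain ⟨b, h1, -⟩ := sends_mul.1 hc
  exact ⟨b, h1⟩

theorem dom_mul_woolly (hψ : IsWoollyIso ψ) (h : IsWoollyIso π) : IsWoolly (ψ * π).dom where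
  nonempty := ⟨_, (mem_dom_mul h.top_sends).2 hψ.dom_woolly.top_mem⟩
  path p q hpq hp := by
    have hp1 := dom_mul_subset hp
    obtain ⟨p', hp', -⟩ := h.sends_inl hp1
    obtain ⟨q', hq', -⟩ := h.sends_inl (h.dom_woolly.path p q hpq hp1)
    rw [mem_dom_mul hp'] at hp
    rw [mem_dom_mul hq']
    exact hψ.dom_woolly.path p' q' ((h.under _ _ _ _ hp' hq').1 hpq) hp
  germ p g hpq hp := by
    have hp1 := dom_mul_subset hp
    obtain ⟨p', hp', -⟩ := h.sends_inl hp1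
    obtain ⟨q', hq', -⟩ := h.sends_inr (h.dom_woolly.germ p g hpq hp1)
    rw [mem_dom_mul hp'] at hp
    rw [mem_dom_mul hq']
    exact hψ.dom_woolly.germ p' q' ((h.under _ _ _ _ hp' hq').1 hpq) hp
  vertex g v hv hg := by
    have hg1 := dom_mul_subset hg
    obtain ⟨g', hg', e1⟩ := h.sends_inr hg1
    obtain ⟨v', hv', e2⟩ := h.sends_inl (h.dom_woolly.vertex g v hv hg1)
    rw [mem_dom_mul hg'] at hg
    rw [mem_dom_mul hv']
    refine hψ.dom_woolly.vertex g' v' ?_ hg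
    have hu : TildeTree.Under (Sum.inr g) (Sum.inl v) := by
      change v.1 ∈ g.vertex.ascendingPath
      rw [hv]
      obtain ⟨x, r, hx⟩ := v.1.exists_rep
      exact ⟨x, r, r, le_rfl, hx, hx⟩
    have hu' : v'.1 ∈ g'.vertex.ascendingPath := (h.under _ _ _ _ hg' hv').1 hu
    obtain ⟨x, k1, k2, -⟩ := exists_rep_of_mem hu'
    rw [k1, k2, ← e1, ← e2, hv]
  naked_interior p q z hn hzq hpz hzp' hzq' hz := by
    have hz1 := dom_mul_subset hz
    obtain ⟨p', hp', -⟩ := h.sends_inl (h.dom_woolly.path z p hpz hz1)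
    obtain ⟨q', hq', -⟩ := h.sends_inl
      (h.dom_woolly.naked_interior p q z hn hzq hpz hzp' hzq' hz1)
    obtain ⟨z', hz', -⟩ := h.sends_inl hz1
    rw [mem_dom_mul hz'] at hz
    rw [mem_dom_mul hq']
    refine hψ.dom_woolly.naked_interior p' q' z' (h.maximalNaked hp' hq' hn)
      ((h.under _ _ _ _ hq' hz').1 hzq) ((h.under _ _ _ _ hz' hp').1 hpz) ?_ ?_ hz
    · rintro rfl
      exact hzp' (Sum.inl_injective ((sends_star.2 hz').unique (sends_star.2 hp')))
    · rintro rfl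
      exact hzq' (Sum.inl_injective ((sends_star.2 hz').unique (sends_star.2 hq')))
  naked_germ p q g hn hgp hgq hg := by
    have hg1 := dom_mul_subset hg
    obtain ⟨p', hp', e1⟩ := h.sends_inl (h.dom_woolly.vertex g p hgp hg1)
    obtain ⟨q', hq', -⟩ := h.sends_inl (h.dom_woolly.naked_germ p q g hn hgp hgq hg1)
    obtain ⟨g', hg', e2⟩ := h.sends_inr hg1
    rw [mem_dom_mul hg'] at hg
    rw [mem_dom_mul hq']
    refine hψ.dom_woolly.naked_germ p' q' g' (h.maximalNaked hp' hq' hn) ?_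
      ((h.under _ _ _ _ hq' hg').1 hgq) hg
    have hu : TildeTree.Under (Sum.inr g) (Sum.inl p) := by
      change p.1 ∈ g.vertex.ascendingPath
      rw [hgp]
      obtain ⟨x, r, hx⟩ := p.1.exists_rep
      exact ⟨x, r, r, le_rfl, hx, hx⟩
    have hu' : p'.1 ∈ g'.vertex.ascendingPath := (h.under _ _ _ _ hg' hp').1 hu
    obtain ⟨x, k1, k2, -⟩ := exists_rep_of_mem hu'
    rw [k1, k2, ← e1, ← e2, hgp]
  naked_upper p q hn hl hp := by
    have hp1 := dom_mul_subset hp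
    obtain ⟨p', hp', e1⟩ := h.sends_inl hp1
    obtain ⟨q', hq', -⟩ := h.sends_inl (h.dom_woolly.naked_upper p q hn hl hp1)
    rw [mem_dom_mul hp'] at hp
    rw [mem_dom_mul hq']
    exact hψ.dom_woolly.naked_upper p' q' (h.maximalNaked hp' hq' hn) (e1 ▸ hl) hp

protected theorem star (h : IsWoollyIso π) : IsWoollyIso (star π) where
  dom_woolly := by rw [dom_star]; exact h.im_woolly
  im_woolly := by rw [im_star]; exact h.dom_woolly
  isLeft a b hab := (h.isLeft b a (sends_star.1 hab)).symm
  height a b hab := (h.height b a (sends_star.1 hab)).symm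
  under a a' b b' hab hab' := (h.under b b' a a' (sends_star.1 hab) (sends_star.1 hab')).symm

protected theorem mul (hψ : IsWoollyIso ψ) (h : IsWoollyIso π) : IsWoollyIso (ψ * π) where
  dom_woolly := dom_mul_woolly hψ h
  im_woolly := by rw [← dom_star, star_mul]; exact dom_mul_woolly h.star hψ.star
  isLeft a c hac := by
    obtain ⟨b, h1, h2⟩ := sends_mul.1 hac
    exact (h.isLeft _ _ h1).trans (hψ.isLeft _ _ h2)
  height a c hac := by
    obtain ⟨b, h1, h2⟩ := sends_mul.1 hac
    exact (h.height _ _ h1).trans (hψ.height _ _ h2)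
  under a a' c c' hac hac' := by
    obtain ⟨b, h1, h2⟩ := sends_mul.1 hac
    obtain ⟨b', h1', h2'⟩ := sends_mul.1 hac'
    exact (h.under _ _ _ _ h1 h1').trans (hψ.under _ _ _ _ h2 h2')

end IsWoollyIso

end Closure

/-! ### The action of isometries on the tree -/

section Action

variable {Λ : Set (Set.Ioi (0 : ℝ))} {X : Type*} [MetricSpace X] [IsUltrametricDist X]

/-- An isometry `g` sends `β(x, r)` to `β(g x, r)`. -/
def TreePoint.map (g : X ≃ᵢ X) (p : TreePoint X) : TreePoint X :=
  Quotient.map (sa := idealBallSetoid X) (sb := idealBallSetoid X)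
    (fun q : X × ℝ≥0∞ => (g q.1, q.2))
    (fun _ _ h => ⟨And.left h, (g.edist_eq _ _).trans_le (And.right h)⟩) p

/-- An isometry `g` sends the germ of `B°(x, λ)` to the germ of `B°(g x, λ)`. -/
def DownGerm.map (g : X ≃ᵢ X) (p : DownGerm Λ X) : DownGerm Λ X :=
  Quotient.map (sa := germSetoid Λ X) (sb := germSetoid Λ X)
    (fun q : X × Λ => (g q.1, q.2))
    (fun _ _ h => ⟨And.left h, (g.dist_eq _ _).trans_lt (And.right h)⟩) p

@[simp] theorem TreePoint.map_mk (g : X ≃ᵢ X) (x : X) (r : ℝ≥0∞) :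
    TreePoint.map g (TreePoint.mk x r) = TreePoint.mk (g x) r := rfl

@[simp] theorem DownGerm.map_mk (g : X ≃ᵢ X) (x : X) (l : Λ) :
    DownGerm.map g (DownGerm.mk x l) = DownGerm.mk (g x) l := rfl

theorem TreePoint.map_symm_map (g : X ≃ᵢ X) (p : TreePoint X) : (p.map g).map g.symm = p := by
  obtain ⟨x, r, rfl⟩ := p.exists_rep
  simp

theorem DownGerm.map_symm_map (g : X ≃ᵢ X) (p : DownGerm Λ X) : (p.map g).map g.symm = p := by
  obtain ⟨x, r, rfl⟩ := p.exists_rep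
  simp

theorem TreePoint.height_map (g : X ≃ᵢ X) (p : TreePoint X) : (p.map g).height = p.height := by
  obtain ⟨x, r, rfl⟩ := p.exists_rep
  simp

theorem DownGerm.vertex_map (g : X ≃ᵢ X) (p : DownGerm Λ X) :
    (p.map g).vertex = p.vertex.map g := by
  obtain ⟨x, r, rfl⟩ := p.exists_rep
  simp

theorem TreePoint.map_mem_ascendingPath (g : X ≃ᵢ X) (p q : TreePoint X) :
    q.map g ∈ (p.map g).ascendingPath ↔ q ∈ p.ascendingPath := by
  obtain ⟨x, r, rfl⟩ := p.exists_rep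
  obtain ⟨y, s, rfl⟩ := q.exists_rep
  simp only [TreePoint.map_mk, TreePoint.mem_ascendingPath_mk, g.edist_eq]

theorem DownGerm.directedTo_map (g : X ≃ᵢ X) (p : DownGerm Λ X) (q : TreePoint X) :
    (p.map g).DirectedTo (q.map g) ↔ p.DirectedTo q := by
  obtain ⟨x, r, rfl⟩ := p.exists_rep
  obtain ⟨y, s, rfl⟩ := q.exists_rep
  simp only [DownGerm.map_mk, TreePoint.map_mk, DownGerm.directedTo_mk, g.dist_eq]

/-- The action of isometries on `T̃(X)`. -/
def TildeTree.map (g : X ≃ᵢ X) : TildeTree Λ X → TildeTree Λ X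
  | Sum.inl p => Sum.inl ⟨p.1.map g, p.2.imp (fun h => by rwa [TreePoint.height_map]) (by
      rintro ⟨x, hx, h⟩
      refine ⟨g x, ?_, by rw [h, TreePoint.map_mk]⟩
      have := g.toHomeomorph.isOpenMap _ hx
      rwa [Set.image_singleton] at this)⟩
  | Sum.inr p => Sum.inr (p.map g)

theorem TildeTree.map_symm_map (g : X ≃ᵢ X) (a : TildeTree Λ X) :
    TildeTree.map g.symm (TildeTree.map g a) = a := by
  rcases a with p | p
  · exact congrArg Sum.inl (Subtype.ext (TreePoint.map_symm_map g p.1))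
  · exact congrArg Sum.inr (DownGerm.map_symm_map g p)

/-- The bijection of `T̃(X)` determined by an isometry, as a (total) partial bijection. -/
def TildeTree.ofIsometry (g : X ≃ᵢ X) : PartialBijection (TildeTree Λ X) :=
  Equiv.toPEquiv
    { toFun := TildeTree.map g
      invFun := TildeTree.map g.symm
      left_inv := TildeTree.map_symm_map g
      right_inv := TildeTree.map_symm_map g.symm }

theorem TildeTree.ofIsometry_sends (g : X ≃ᵢ X) (a b : TildeTree Λ X) :
    (TildeTree.ofIsometry g).Sends a b ↔ TildeTree.map g a = b := by
  change b ∈ some (TildeTree.map g a) ↔ _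
  exact Option.mem_some_iff

theorem TildeTree.ofIsometry_refl :
    (TildeTree.ofIsometry (IsometryEquiv.refl X) : PartialBijection (TildeTree Λ X)) = 1 := by
  refine PEquiv.ext fun a => ?_
  change some (TildeTree.map (IsometryEquiv.refl X) a) = some a
  rcases a with p | p
  · obtain ⟨⟨x, r⟩, h⟩ := Quotient.exists_rep p.1
    refine congrArg (fun q => some (Sum.inl q)) (Subtype.ext ?_)
    change p.1.map (IsometryEquiv.refl X) = p.1
    rw [← h]; rfl
  · obtain ⟨x, l, rfl⟩ := p.exists_rep
    rfl

theorem TildeTree.under_map (g : X ≃ᵢ X) (a b : TildeTree Λ X) :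
    (TildeTree.map g a).Under (TildeTree.map g b) ↔ a.Under b := by
  rcases a with p | p <;> rcases b with q | q
  · exact TreePoint.map_mem_ascendingPath g p.1 q.1
  · exact DownGerm.directedTo_map g q p.1
  · change q.1.map g ∈ (p.map g).vertex.ascendingPath ↔ _
    rw [DownGerm.vertex_map]
    exact TreePoint.map_mem_ascendingPath g p.vertex q.1
  · change p.map g = q.map g ∨ (q.map g).DirectedTo (p.map g).vertex ↔ _
    rw [DownGerm.vertex_map, DownGerm.directedTo_map]
    refine or_congr_left ⟨fun h => ?_, fun h => by rw [h]⟩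
    rw [← DownGerm.map_symm_map g p, h, DownGerm.map_symm_map]

theorem isWoolly_univ [Nonempty X] : IsWoolly (Set.univ : Set (TildeTree Λ X)) where
  nonempty := ⟨Sum.inl ⟨TreePoint.mk (Classical.arbitrary X) ⊤, Or.inl ENNReal.zero_lt_top⟩, trivial⟩
  path _ _ _ _ := trivial
  germ _ _ _ _ := trivial
  vertex _ _ _ _ := trivial
  naked_interior _ _ _ _ _ _ _ _ _ := trivial
  naked_germ _ _ _ _ _ _ _ := trivial
  naked_upper _ _ _ _ _ := trivial

theorem TildeTree.isWoollyIso_ofIsometry [Nonempty X] (g : X ≃ᵢ X) :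
    IsWoollyIso (TildeTree.ofIsometry g : PartialBijection (TildeTree Λ X)) where
  dom_woolly := by
    have : (TildeTree.ofIsometry g : PartialBijection (TildeTree Λ X)).dom = Set.univ :=
      Set.eq_univ_of_forall fun a => ⟨_, (TildeTree.ofIsometry_sends g a _).2 rfl⟩
    rw [this]; exact isWoolly_univ
  im_woolly := by
    have : (TildeTree.ofIsometry g : PartialBijection (TildeTree Λ X)).im = Set.univ :=
      Set.eq_univ_of_forall fun a =>
        ⟨_, (TildeTree.ofIsometry_sends g _ _).2 (TildeTree.map_symm_map g.symm a)⟩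
    rw [this]; exact isWoolly_univ
  isLeft a b h := by
    rw [TildeTree.ofIsometry_sends] at h
    subst h
    rcases a with p | p <;> rfl
  height a b h := by
    rw [TildeTree.ofIsometry_sends] at h
    subst h
    rcases a with p | p
    · exact (TreePoint.height_map g p.1).symm
    · change p.vertex.height = (p.map g).vertex.height
      rw [DownGerm.vertex_map, TreePoint.height_map]
  under a a' b b' h h' := by
    rw [TildeTree.ofIsometry_sends] at h h'
    subst h h'
    exact (TildeTree.under_map g a a').symm

end Action

/-! ### The group `𝕀_Λ` and the semigroup `Γ_Λ` -/

/-- The group of all isometries of the ultrametric Urysohn space. -/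
noncomputable abbrev UrysohnIsometryGroup (Λ : Set (Set.Ioi (0 : ℝ))) : Type :=
  UrysohnSpace Λ ≃ᵢ UrysohnSpace Λ

/-- The topology of pointwise convergence on the group of isometries. -/
noncomputable instance UrysohnIsometryGroup.instTopologicalSpace (Λ : Set (Set.Ioi (0 : ℝ))) :
    TopologicalSpace (UrysohnIsometryGroup Λ) :=
  TopologicalSpace.induced (fun g => (g : UrysohnSpace Λ → UrysohnSpace Λ)) inferInstance

/-- The semigroup `Γ_Λ` of all height-preserving partial isomorphisms between woolly subtrees of
`T(𝕌_Λ)`, with the product and the topology of partial bijections of `T̃(𝕌_Λ)`. -/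
noncomputable def woollySubmonoid (Λ : Set (Set.Ioi (0 : ℝ))) :
    Submonoid (PartialBijection (TildeTree Λ (UrysohnSpace Λ))) where
  carrier := {π | IsWoollyIso π}
  mul_mem' h k := IsWoollyIso.mul h k
  one_mem' := by
    have h := TildeTree.isWoollyIso_ofIsometry (Λ := Λ) (IsometryEquiv.refl (UrysohnSpace Λ))
    rwa [TildeTree.ofIsometry_refl] at h

/-- The semigroup `Γ_Λ`. -/
abbrev WoollySemigroup (Λ : Set (Set.Ioi (0 : ℝ))) : Type := woollySubmonoid Λ

/-- The involution of `Γ_Λ` sends a partial isomorphism to its inverse. -/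
noncomputable instance WoollySemigroup.instStarMul (Λ : Set (Set.Ioi (0 : ℝ))) :
    StarMul (WoollySemigroup Λ) where
  star π := ⟨star π.1, IsWoollyIso.star π.2⟩
  star_involutive π := Subtype.ext (star_star π.1)
  star_mul π ψ := Subtype.ext (star_mul π.1 ψ.1)

/-- The embedding of `𝕀_Λ` in `Γ_Λ`. -/
noncomputable def WoollySemigroup.ofIsometry {Λ : Set (Set.Ioi (0 : ℝ))} (g : UrysohnIsometryGroup Λ) :
    WoollySemigroup Λ :=
  ⟨TildeTree.ofIsometry g, TildeTree.isWoollyIso_ofIsometry g⟩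

/-! An element of `T̃` is a ball, determined by its kind, its height and any center. Everything
rests on two supplies of isometries: `ballSwap` exchanges two open balls of radius `l` at distance
at most `l`, and `perm` permutes arbitrarily the open balls of radius `l` (the branches, told apart
by the coordinate at `l`) inside a closed ball of radius `l`.

Compactness: along an ultrafilter the relations `φ(a) = b` converge to a partial bijection. Each
woolliness axiom leads from an element `a` to an element whose image is forced by the image of `a`
(`sends_eq_of_determines`), so the limit has a woolly domain; heights and order pass to the limit
trivially.

Density: on a finite part of its domain a partial isomorphism is matched by an isometry, built by
successive ball exchanges. An element outside the domain lies under a germ that leads to none of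
finitely many given elements of the domain (`IsWoolly.exists_germ_avoiding`, where all the naked
segment axioms are spent), so its branch can be sent to a fresh one without disturbing them.

Extension: unitary operators have weak limits along ultrafilters, so by density it is enough that a
limit `T` of `ρ(g)` along `g → π` depends only on `π` (`eq_of_tendsto_ofIsometry`). Vectors fixed by
stabilizers of finite sets `F` (`levelSpace`) are dense in `H`. If `F` is in the domain of `π`, then
`g` is eventually constant on `F`, hence `T` is determined on the closed span `supportSpace` of such
vectors. It remains to show that `T` kills the orthogonal complement, that is, that the adjoint of
`T` takes values in `supportSpace`.

The adjoint sends `w` to the weak limit of `ρ(g⁻¹)w`. If `w` has level `K`, then `ρ(g⁻¹)w` has level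
`g⁻¹K`. By the independence property `inner_starProjection_prune`, the part of `F` under a germ that
leads to nothing in `g⁻¹K` may be cut off and replaced by the vertex of the germ. An element of `F`
outside the domain can thus be traded, in the limit, for elements of the domain, and induction on
the number of bad elements finishes (`starProjection_levelSpace_mem_supportSpace`). Products and
adjoints carry over by density and separate continuity. -/

/-! ### Distances and isometries of the Urysohn space -/

section UltrametricSwap

variable {X : Type*} [MetricSpace X] [IsUltrametricDist X]

/-- A bijection which, together with its inverse, does not increase distances is an isometry. -/
def IsometryEquiv.ofDistLe (f f' : X → X) (h1 : ∀ x, f' (f x) = x) (h2 : ∀ x, f (f' x) = x)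
    (hf : ∀ x y, dist (f x) (f y) ≤ dist x y) (hf' : ∀ x y, dist (f' x) (f' y) ≤ dist x y) :
    X ≃ᵢ X :=
  IsometryEquiv.mk' f f' h2 (Isometry.of_dist_eq fun x y => le_antisymm (hf x y) (by
    have := hf' (f x) (f y)
    rwa [h1, h1] at this))

open Classical in
/-- The map that exchanges the open balls of radius `r` around `a` and `g a` by means of `g`, and
is the identity outside of them. -/
noncomputable def ballSwapFun (g : X ≃ᵢ X) (a : X) (r : ℝ) (x : X) : X :=
  if dist x a < r then g x else if dist x (g a) < r then g.symm x else x

/-- The inverse is the exchange by `g⁻¹` based at `g a`. The two balls are equal or disjoint; if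
they are equal, the first branch is taken in both directions, so the order of the tests matters. -/
theorem ballSwapFun_left_inv (g : X ≃ᵢ X) (a : X) (r : ℝ) (x : X) :
    ballSwapFun g.symm (g a) r (ballSwapFun g a r x) = x := by
  unfold ballSwapFun
  by_cases h1 : dist x a < r
  · simp [h1, g.dist_eq]
  by_cases h2 : dist x (g a) < r
  · have h3 : dist (g.symm x) a < r := by
      rw [← g.dist_eq, g.apply_symm_apply]; exact h2
    -- Otherwise the two balls would meet, hence coincide, and `x` would fall under the first test.
    have h4 : ¬ dist (g.symm x) (g a) < r := fun h => h1 <| by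
      refine (dist_triangle_max x (g a) a).trans_lt (max_lt h2 ?_)
      refine (dist_triangle_max (g a) (g.symm x) a).trans_lt (max_lt ?_ h3)
      rwa [dist_comm]
    simp [h1, h2, h3, h4]
  · simp [h1, h2]

theorem dist_ballSwapFun_le {g : X ≃ᵢ X} {a : X} {r : ℝ} (hr : 0 ≤ r) (h : dist a (g a) ≤ r)
    (x : X) : dist (ballSwapFun g a r x) x ≤ r := by
  unfold ballSwapFun
  split_ifs with h1 h2
  · refine (dist_triangle_max _ (g a) _).trans (max_le (by rw [g.dist_eq]; exact h1.le) ?_)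
    refine (dist_triangle_max _ a _).trans (max_le (by rwa [dist_comm]) (by
      rw [dist_comm]; exact h1.le))
  · have h3 : dist (g.symm x) a < r := by
      rw [← g.dist_eq, g.apply_symm_apply]; exact h2
    refine (dist_triangle_max _ a _).trans (max_le h3.le ?_)
    exact (dist_triangle_max _ (g a) _).trans (max_le h (by rw [dist_comm]; exact h2.le))
  · rwa [dist_self]

/-- Points closer than `r` are in the same one of the pieces, where a single isometry acts; for
points at distance at least `r`, displacements of at most `r` are harmless by the ultrametric
inequality. -/
theorem dist_ballSwapFun_ballSwapFun_le {g : X ≃ᵢ X} {a : X} {r : ℝ} (hr : 0 ≤ r)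
    (h : dist a (g a) ≤ r) (x y : X) :
    dist (ballSwapFun g a r x) (ballSwapFun g a r y) ≤ dist x y := by
  by_cases hxy : dist x y < r
  · have key : ∀ b, dist x b < r ↔ dist y b < r := fun b =>
      ⟨fun hb => (dist_triangle_max y x b).trans_lt (max_lt (by rwa [dist_comm]) hb),
        fun hb => (dist_triangle_max x y b).trans_lt (max_lt hxy hb)⟩
    unfold ballSwapFun
    rw [if_congr (key a) rfl rfl, if_congr (key (g a)) rfl rfl]
    split_ifs
    · rw [g.dist_eq]
    · rw [g.symm.dist_eq]
    · exact le_rfl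
  · have hxy := not_lt.1 hxy
    refine (dist_triangle_max _ x _).trans (max_le ((dist_ballSwapFun_le hr h x).trans hxy) ?_)
    refine (dist_triangle_max _ y _).trans (max_le le_rfl ?_)
    rw [dist_comm]
    exact (dist_ballSwapFun_le hr h y).trans hxy

/-- The isometry that exchanges the open balls of radius `r` around `a` and `g a` by means of `g`,
and is the identity outside of them. -/
noncomputable def ballSwap (g : X ≃ᵢ X) (a : X) (r : ℝ) (hr : 0 ≤ r) (h : dist a (g a) ≤ r) :
    X ≃ᵢ X :=
  IsometryEquiv.ofDistLe (ballSwapFun g a r) (ballSwapFun g.symm (g a) r)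
    (ballSwapFun_left_inv g a r)
    (fun x => by simpa using ballSwapFun_left_inv g.symm (g a) r x)
    (dist_ballSwapFun_ballSwapFun_le hr h)
    (dist_ballSwapFun_ballSwapFun_le hr (by rw [g.symm_apply_apply, dist_comm]; exact h))

theorem dist_ballSwap_le (g : X ≃ᵢ X) (a : X) (r : ℝ) (hr : 0 ≤ r) (h : dist a (g a) ≤ r) (x : X) :
    dist (ballSwap g a r hr h x) x ≤ r :=
  dist_ballSwapFun_le hr h x

theorem ballSwap_of_lt (g : X ≃ᵢ X) (a : X) (r : ℝ) (hr : 0 ≤ r) (h : dist a (g a) ≤ r) {x : X}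
    (hx : dist x a < r) : ballSwap g a r hr h x = g x := by
  change ballSwapFun g a r x = _
  simp [ballSwapFun, hx]

theorem ballSwap_of_not_lt (g : X ≃ᵢ X) (a : X) (r : ℝ) (hr : 0 ≤ r) (h : dist a (g a) ≤ r) {x : X}
    (hx : ¬ dist x a < r) (hx' : ¬ dist x (g a) < r) : ballSwap g a r hr h x = x := by
  change ballSwapFun g a r x = _
  simp [ballSwapFun, hx, hx']

end UltrametricSwap

/-! ### Translations and permutations of branches. -/

namespace UrysohnSpace

variable {Λ : Set (Set.Ioi (0 : ℝ))}

theorem level_pos (l : Λ) : 0 < l.1.1 := l.1.2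

theorem dist_le_iff {x y : UrysohnSpace Λ} {r : ℝ} (hr : 0 ≤ r) :
    dist x y ≤ r ↔ ∀ l : Λ, x.toFun l ≠ y.toFun l → l.1.1 ≤ r :=
  distance_le_iff x y hr

theorem apply_eq_of_dist_lt {x y : UrysohnSpace Λ} {l : Λ} (h : dist x y < l.1.1) :
    x.toFun l = y.toFun l := by
  by_contra hl
  exact absurd ((dist_le_iff dist_nonneg).1 le_rfl l hl) (not_le.2 h)

theorem exists_level_eq_dist {x y : UrysohnSpace Λ} (h : x ≠ y) :
    ∃ l : Λ, l.1.1 = dist x y ∧ x.toFun l ≠ y.toFun l := by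
  obtain ⟨l₀, h₀⟩ : ∃ l, x.toFun l ≠ y.toFun l := by
    by_contra! H
    exact h (UrysohnSpace.ext (funext H))
  obtain ⟨l, ⟨hl, hl'⟩, hmax⟩ := Set.exists_max_image _ (fun l : Λ => l.1.1)
    (finite_diff x y l₀.1.1 (level_pos l₀)) ⟨l₀, le_rfl, h₀⟩
  refine ⟨l, le_antisymm ((dist_le_iff dist_nonneg).1 le_rfl l hl') ?_, hl'⟩
  refine (dist_le_iff (level_pos l).le).2 fun m hm => ?_
  by_cases h : l₀.1.1 ≤ m.1.1
  · exact hmax m ⟨h, hm⟩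
  · exact (not_le.1 h).le.trans hl

/-- Within a closed ball of radius `l`, the coordinate at `l` distinguishes the open balls. -/
theorem dist_lt_iff_apply_eq {x y : UrysohnSpace Λ} {l : Λ} (h : dist x y ≤ l.1.1) :
    dist x y < l.1.1 ↔ x.toFun l = y.toFun l := by
  refine ⟨apply_eq_of_dist_lt, fun he => lt_of_le_of_ne h fun hd => ?_⟩
  have hne : x ≠ y := by
    rintro rfl
    rw [dist_self] at hd
    exact (level_pos l).ne hd
  obtain ⟨m, hm, hm'⟩ := exists_level_eq_dist hne
  have : m = l := Subtype.ext (Subtype.ext (hm.trans hd))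
  exact hm' (this ▸ he)

/-- The translation that sends `x` to `y`. -/
noncomputable def translateFun (x y z : UrysohnSpace Λ) : UrysohnSpace Λ where
  toFun l := z.toFun l + (y.toFun l - x.toFun l)
  finite_support ε hε := by
    refine ((z.finite_support ε hε).union (finite_diff x y ε hε)).subset ?_
    rintro l ⟨h1, h2⟩
    by_cases h : z.toFun l = 0
    · exact Or.inr ⟨h1, fun e => h2 (by simp [h, e])⟩
    · exact Or.inl ⟨h1, h⟩

/-- The translation that sends `x` to `y`. -/
noncomputable def translate (x y : UrysohnSpace Λ) : UrysohnIsometryGroup Λ :=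
  IsometryEquiv.ofDistLe (translateFun x y) (translateFun y x)
    (fun z => by ext l; change _ + _ + _ = _; ring)
    (fun z => by ext l; change _ + _ + _ = _; ring)
    (fun z w => (dist_le_iff dist_nonneg).2 fun l hl =>
      (dist_le_iff dist_nonneg).1 le_rfl l fun h => hl (by simp [translateFun, h]))
    (fun z w => (dist_le_iff dist_nonneg).2 fun l hl =>
      (dist_le_iff dist_nonneg).1 le_rfl l fun h => hl (by simp [translateFun, h]))

@[simp] theorem translate_apply_self (x y : UrysohnSpace Λ) : translate x y x = y := by
  change translateFun x y x = y
  ext l; simp [translateFun]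

open Classical in
/-- Permutes by `σ` the open balls of radius `l` inside of the closed ball of radius `l`
around `c`. -/
noncomputable def permFun (c : UrysohnSpace Λ) (l : Λ) (σ : Equiv.Perm ℤ) (x : UrysohnSpace Λ) :
    UrysohnSpace Λ where
  toFun m := if m = l ∧ dist x c ≤ l.1.1 then σ (x.toFun m) else x.toFun m
  finite_support ε hε := by
    refine ((x.finite_support ε hε).union (Set.finite_singleton l)).subset ?_
    rintro m ⟨h1, h2⟩
    by_cases h : m = l
    · exact Or.inr h
    · rw [if_neg (fun h' => h h'.1)] at h2
      exact Or.inl ⟨h1, h2⟩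

theorem dist_permFun_le (c : UrysohnSpace Λ) (l : Λ) (σ : Equiv.Perm ℤ) (x : UrysohnSpace Λ) :
    dist (permFun c l σ x) x ≤ l.1.1 := by
  refine (dist_le_iff (level_pos l).le).2 fun m hm => ?_
  by_cases h : m = l
  · rw [h]
  · exact absurd (if_neg fun h' => h h'.1) hm

theorem permFun_of_not_le {c : UrysohnSpace Λ} {l : Λ} (σ : Equiv.Perm ℤ) {x : UrysohnSpace Λ}
    (h : ¬ dist x c ≤ l.1.1) : permFun c l σ x = x := by
  ext m
  exact if_neg fun h' => h h'.2

theorem permFun_apply_level {c : UrysohnSpace Λ} {l : Λ} (σ : Equiv.Perm ℤ) {x : UrysohnSpace Λ}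
    (h : dist x c ≤ l.1.1) : (permFun c l σ x).toFun l = σ (x.toFun l) :=
  if_pos ⟨rfl, h⟩

theorem permFun_of_fixed {c : UrysohnSpace Λ} {l : Λ} {σ : Equiv.Perm ℤ} {x : UrysohnSpace Λ}
    (h : σ (x.toFun l) = x.toFun l) : permFun c l σ x = x := by
  ext m
  by_cases hm : m = l
  · subst hm
    by_cases h' : dist x c ≤ m.1.1
    · rw [permFun_apply_level σ h', h]
    · rw [permFun_of_not_le σ h']
  · exact if_neg fun h' => hm h'.1

/-- If the images differed at a level `m` exceeding `dist x y`, then `x` and `y` would agree at `m`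
and, when `m = l`, be both inside or both outside of the ball, so the same rule would apply to both.
-/
theorem dist_permFun_permFun_le (c : UrysohnSpace Λ) (l : Λ) (σ : Equiv.Perm ℤ)
    (x y : UrysohnSpace Λ) : dist (permFun c l σ x) (permFun c l σ y) ≤ dist x y := by
  refine (dist_le_iff dist_nonneg).2 fun m hm => ?_
  by_contra! hlt
  have hxy := apply_eq_of_dist_lt hlt
  by_cases h : m = l
  · subst h
    have key : dist x c ≤ m.1.1 ↔ dist y c ≤ m.1.1 :=
      ⟨fun hb => (dist_triangle_max y x c).trans (max_le (by rw [dist_comm]; exact hlt.le) hb),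
        fun hb => (dist_triangle_max x y c).trans (max_le hlt.le hb)⟩
    by_cases h' : dist x c ≤ m.1.1
    · rw [permFun_apply_level σ h', permFun_apply_level σ (key.1 h'), hxy] at hm
      exact hm rfl
    · rw [permFun_of_not_le σ h', permFun_of_not_le σ (fun k => h' (key.2 k))] at hm
      exact hm hxy
  · have e : ∀ z : UrysohnSpace Λ, (permFun c l σ z).toFun m = z.toFun m := fun z =>
      if_neg fun h' => h h'.1
    rw [e, e] at hm
    exact hm hxy

theorem permFun_left_inv (c : UrysohnSpace Λ) (l : Λ) (σ : Equiv.Perm ℤ) (x : UrysohnSpace Λ) :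
    permFun c l σ.symm (permFun c l σ x) = x := by
  ext m
  by_cases h : m = l
  · subst h
    by_cases h' : dist x c ≤ m.1.1
    · have h2 : dist (permFun c m σ x) c ≤ m.1.1 :=
        (dist_triangle_max _ x c).trans (max_le (dist_permFun_le c m σ x) h')
      rw [permFun_apply_level _ h2, permFun_apply_level _ h', Equiv.symm_apply_apply]
    · rw [permFun_of_not_le σ h', permFun_of_not_le _ h']
  · have e : ∀ (τ : Equiv.Perm ℤ) (z : UrysohnSpace Λ), (permFun c l τ z).toFun m = z.toFun m :=
      fun τ z => if_neg fun h' => h h'.1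
    rw [e, e]

/-- The isometry that permutes by `σ` the open balls of radius `l` inside of the closed ball of
radius `l` around `c`. -/
noncomputable def perm (c : UrysohnSpace Λ) (l : Λ) (σ : Equiv.Perm ℤ) : UrysohnIsometryGroup Λ :=
  IsometryEquiv.ofDistLe (permFun c l σ) (permFun c l σ.symm) (permFun_left_inv c l σ)
    (permFun_left_inv c l σ.symm) (dist_permFun_permFun_le c l σ)
    (dist_permFun_permFun_le c l σ.symm)

end UrysohnSpace

/-! ### Elements of the tree and their centers -/

namespace TildeTree

section General

variable {Λ : Set (Set.Ioi (0 : ℝ))} {X : Type*} [MetricSpace X] [IsUltrametricDist X]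

/-- The element `a` of `T̃` corresponds to a ball with center `x`. -/
def HasCenter : TildeTree Λ X → X → Prop
  | Sum.inl p, x => p.1 = TreePoint.mk x p.1.height
  | Sum.inr g, x => ∃ l, g = DownGerm.mk x l

/-- The element `a` of `T̃` lies under a germ of height `m`. -/
def Below : TildeTree Λ X → Λ → Prop
  | Sum.inl p, m => p.1.height < ENNReal.ofReal m.1.1
  | Sum.inr g, m => g.vertex.height ≤ ENNReal.ofReal m.1.1

theorem exists_hasCenter (a : TildeTree Λ X) : ∃ x, a.HasCenter x := by
  rcases a with p | g
  · obtain ⟨x, r, h⟩ := p.1.exists_rep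
    exact ⟨x, by rw [HasCenter, h, TreePoint.height_mk]⟩
  · obtain ⟨x, l, h⟩ := g.exists_rep
    exact ⟨x, l, h⟩

theorem HasCenter.map {a : TildeTree Λ X} {x : X} (h : a.HasCenter x) (g : X ≃ᵢ X) :
    (map g a).HasCenter (g x) := by
  rcases a with p | q
  · change p.1.map g = TreePoint.mk (g x) (p.1.map g).height
    rw [TreePoint.height_map, ← TreePoint.map_mk]
    exact congrArg _ h
  · obtain ⟨l, rfl⟩ := h
    exact ⟨l, rfl⟩

theorem isLeft_map (g : X ≃ᵢ X) (a : TildeTree Λ X) : (map g a).isLeft = a.isLeft := by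
  rcases a with p | q <;> rfl

theorem height_map (g : X ≃ᵢ X) (a : TildeTree Λ X) : (map g a).height = a.height := by
  rcases a with p | q
  · exact TreePoint.height_map g p.1
  · change (q.map g).vertex.height = q.vertex.height
    rw [DownGerm.vertex_map, TreePoint.height_map]

theorem below_congr {a b : TildeTree Λ X} (h : a.isLeft = b.isLeft) (h' : a.height = b.height)
    (m : Λ) : a.Below m ↔ b.Below m := by
  rcases a with p | p <;> rcases b with q | q
  · change p.1.height < _ ↔ q.1.height < _
    rw [show p.1.height = q.1.height from h']
  · simp at h
  · simp at h
  · change p.vertex.height ≤ _ ↔ q.vertex.height ≤ _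
    rw [show p.vertex.height = q.vertex.height from h']

theorem below_map (g : X ≃ᵢ X) (a : TildeTree Λ X) (m : Λ) : (map g a).Below m ↔ a.Below m :=
  below_congr (isLeft_map g a) (height_map g a) m

theorem Below.mono {a : TildeTree Λ X} {m n : Λ} (h : a.Below m) (hmn : m.1.1 ≤ n.1.1) :
    a.Below n := by
  rcases a with p | q
  · exact lt_of_lt_of_le h (ENNReal.ofReal_le_ofReal hmn)
  · exact le_trans h (ENNReal.ofReal_le_ofReal hmn)

/-- The germ of height `m` directed towards `z`. -/
def germ (z : X) (m : Λ) : TildeTree Λ X := Sum.inr (DownGerm.mk z m)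

/-- The vertex of height `m` over `z`. -/
noncomputable def vertexOver (z : X) (m : Λ) : TildeTree Λ X :=
  Sum.inl ⟨TreePoint.mk z (ENNReal.ofReal m.1.1), Or.inl (ENNReal.ofReal_pos.2 m.1.2)⟩

theorem hasCenter_germ (z : X) (m : Λ) : (germ z m).HasCenter z := ⟨m, rfl⟩

theorem ofReal_level_inj {l m : Λ} (h : ENNReal.ofReal l.1.1 = ENNReal.ofReal m.1.1) : l = m := by
  have h1 : (0 : ℝ) ≤ l.1.1 := (Set.mem_Ioi.1 l.1.2).le
  have h2 : (0 : ℝ) ≤ m.1.1 := (Set.mem_Ioi.1 m.1.2).le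
  exact Subtype.ext (Subtype.ext ((ENNReal.ofReal_eq_ofReal_iff h1 h2).1 h))

theorem under_germ_iff {a : TildeTree Λ X} {x : X} (h : a.HasCenter x) (z : X) (m : Λ) :
    a.Under (germ z m) ↔ a.Below m ∧ dist x z < m.1.1 := by
  have hpos : (0 : ℝ) < m.1.1 := m.1.2
  rcases a with p | q
  · change DownGerm.DirectedTo _ p.1 ↔ p.1.height < _ ∧ _
    rw [show p.1 = TreePoint.mk x p.1.height from h, DownGerm.directedTo_mk, dist_comm,
      TreePoint.height_mk]
  · obtain ⟨l, rfl⟩ := h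
    change DownGerm.mk x l = DownGerm.mk z m ∨ DownGerm.DirectedTo _ (TreePoint.mk x _) ↔
      ENNReal.ofReal l.1.1 ≤ _ ∧ _
    rw [DownGerm.mk_eq_mk, DownGerm.directedTo_mk]
    constructor
    · rintro (⟨rfl, h⟩ | ⟨h, h'⟩)
      · exact ⟨le_rfl, h⟩
      · exact ⟨h.le, by rwa [dist_comm]⟩
    · rintro ⟨h, h'⟩
      rcases h.lt_or_eq with h | h
      · exact Or.inr ⟨h, by rwa [dist_comm]⟩
      · obtain rfl := ofReal_level_inj h
        exact Or.inl ⟨rfl, h'⟩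

/-- Equalities in `T̃`, including the action laws below, are reduced to this: compare kind, height
and one common center. -/
theorem eq_of_hasCenter {a b : TildeTree Λ X} {x : X} (ha : a.HasCenter x) (hb : b.HasCenter x)
    (h : a.isLeft = b.isLeft) (h' : a.height = b.height) : a = b := by
  rcases a with p | p <;> rcases b with q | q
  · refine congrArg Sum.inl (Subtype.ext ?_)
    rw [show p.1 = _ from ha, show q.1 = _ from hb, show p.1.height = q.1.height from h']
  · simp at h
  · simp at h
  · obtain ⟨l, rfl⟩ := ha
    obtain ⟨m, rfl⟩ := hb
    rw [ofReal_level_inj (l := l) (m := m) h']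

theorem HasCenter.of_under {a b : TildeTree Λ X} {x : X} (ha : a.HasCenter x) (h : a.Under b) :
    b.HasCenter x := by
  rcases b with q | q
  · have key : ∀ p : TreePoint X, ∀ r, p = TreePoint.mk x r → q.1 ∈ p.ascendingPath →
        q.1 = TreePoint.mk x q.1.height := by
      rintro _ r rfl hq
      obtain ⟨y, s, hy⟩ := q.1.exists_rep
      rw [hy, TreePoint.mem_ascendingPath_mk] at hq
      rw [hy, TreePoint.height_mk]
      exact TreePoint.mk_eq_mk.2 ⟨rfl, by rw [edist_comm]; exact hq.2⟩
    rcases a with p | p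
    · exact key p.1 _ ha h
    · obtain ⟨l, rfl⟩ := ha
      exact key _ _ rfl h
  · obtain ⟨z, m, rfl⟩ := q.exists_rep
    have := ((under_germ_iff ha z m).1 h).2
    exact ⟨m, DownGerm.mk_eq_mk.2 ⟨rfl, by rwa [dist_comm]⟩⟩

theorem map_refl (a : TildeTree Λ X) : map (1 : X ≃ᵢ X) a = a := by
  obtain ⟨x, hx⟩ := a.exists_hasCenter
  exact eq_of_hasCenter (hx.map 1) hx (isLeft_map 1 a) (height_map 1 a)

theorem map_mul (g h : X ≃ᵢ X) (a : TildeTree Λ X) : map (g * h) a = map g (map h a) := by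
  obtain ⟨x, hx⟩ := a.exists_hasCenter
  refine eq_of_hasCenter (hx.map (g * h)) ((hx.map h).map g) ?_ ?_
  · simp only [isLeft_map]
  · simp only [height_map]

theorem map_inv_eq_iff (g : X ≃ᵢ X) (a b : TildeTree Λ X) : map g⁻¹ a = b ↔ a = map g b := by
  constructor
  · rintro rfl
    rw [← map_mul, mul_inv_cancel, map_refl]
  · rintro rfl
    rw [← map_mul, inv_mul_cancel, map_refl]

theorem map_vertexOver (g : X ≃ᵢ X) (z : X) (m : Λ) :
    map g (vertexOver z m) = vertexOver (g z) m := rfl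

theorem ofIsometry_mul (g h : X ≃ᵢ X) :
    (ofIsometry (g * h) : PartialBijection (TildeTree Λ X)) = ofIsometry g * ofIsometry h :=
  PEquiv.ext fun a => congrArg some (map_mul g h a)

/-- The pointwise stabilizer of a set of elements of `T̃`. -/
def stabilizer (A : Set (TildeTree Λ X)) : Subgroup (X ≃ᵢ X) where
  carrier := {g | ∀ a ∈ A, map g a = a}
  mul_mem' {g h} hg hh a ha := by rw [map_mul, hh a ha, hg a ha]
  one_mem' a _ := map_refl a
  inv_mem' {g} hg a ha := (map_inv_eq_iff g a a).2 (hg a ha).symm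

theorem stabilizer_anti {A B : Set (TildeTree Λ X)} (h : A ⊆ B) : stabilizer B ≤ stabilizer A :=
  fun _ hg a ha => hg a (h ha)

end General

variable {Λ : Set (Set.Ioi (0 : ℝ))}

/-- Two elements of the same kind and height coincide unless the distance of their centers is an
element of `Λ` that exceeds their height. -/
theorem eq_or_exists_level {a b : TildeTree Λ (UrysohnSpace Λ)} {x y : UrysohnSpace Λ}
    (ha : a.HasCenter x) (hb : b.HasCenter y) (h : a.isLeft = b.isLeft)
    (h' : a.height = b.height) : a = b ∨ ∃ m : Λ, m.1.1 = dist x y ∧ a.Below m := by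
  by_cases hxy : x = y
  · subst hxy
    exact Or.inl (eq_of_hasCenter ha hb h h')
  obtain ⟨m, hm, -⟩ := UrysohnSpace.exists_level_eq_dist hxy
  rcases a with p | p <;> rcases b with q | q
  · by_cases he : edist x y ≤ p.1.height
    · refine Or.inl (congrArg Sum.inl (Subtype.ext ?_))
      rw [show p.1 = _ from ha, show q.1 = _ from hb]
      exact TreePoint.mk_eq_mk.2 ⟨h', he⟩
    · refine Or.inr ⟨m, hm, ?_⟩
      change p.1.height < _
      rw [hm, ← edist_dist]
      exact not_le.1 he
  · simp at h
  · simp at h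
  · obtain ⟨l, rfl⟩ := ha
    obtain ⟨l', rfl⟩ := hb
    obtain rfl := ofReal_level_inj h'
    by_cases he : dist x y < l.1.1
    · exact Or.inl (congrArg Sum.inr (DownGerm.mk_eq_mk.2 ⟨rfl, he⟩))
    · refine Or.inr ⟨m, hm, ENNReal.ofReal_le_ofReal ?_⟩
      rw [hm]
      exact not_lt.1 he

theorem map_eq_iff_hasCenter {a b : TildeTree Λ (UrysohnSpace Λ)} {x : UrysohnSpace Λ}
    (g : UrysohnIsometryGroup Λ) (ha : a.HasCenter x) (h : a.isLeft = b.isLeft)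
    (h' : a.height = b.height) : map g a = b ↔ b.HasCenter (g x) := by
  constructor
  · rintro rfl
    exact ha.map g
  · intro hb
    exact eq_of_hasCenter (ha.map g) hb ((isLeft_map g a).trans h) ((height_map g a).trans h')

/-- A displacement of size at most `l` can only be seen by elements under some germ of height at
most `l`. -/
theorem map_eq_self_of_dist_le {a : TildeTree Λ (UrysohnSpace Λ)} {x : UrysohnSpace Λ}
    (ha : a.HasCenter x) {l : Λ} (hl : ¬ a.Below l) {g : UrysohnIsometryGroup Λ}
    (hg : dist (g x) x ≤ l.1.1) : map g a = a := by
  rcases eq_or_exists_level (ha.map g) ha (isLeft_map g a) (height_map g a) with h | ⟨m, hm, hb⟩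
  · exact h
  · rw [below_map] at hb
    exact absurd (hb.mono (hm.trans_le hg)) hl

theorem map_eq_self_of_apply_eq {a : TildeTree Λ (UrysohnSpace Λ)} {x : UrysohnSpace Λ}
    (ha : a.HasCenter x) {g : UrysohnIsometryGroup Λ} (hg : g x = x) : map g a = a :=
  eq_of_hasCenter (by simpa [hg] using ha.map g) ha (isLeft_map g a) (height_map g a)

theorem dist_lt_of_map_eq_self {a : TildeTree Λ (UrysohnSpace Λ)} {x : UrysohnSpace Λ}
    (ha : a.HasCenter x) {l : Λ} (hl : a.Below l) {g : UrysohnIsometryGroup Λ}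
    (hg : map g a = a) : dist (g x) x < l.1.1 := by
  have h : a.Under (germ x l) := (under_germ_iff ha x l).2 ⟨hl, by
    rw [dist_self]; exact l.1.2⟩
  have h2 := ha.map g
  rw [hg] at h2
  exact ((under_germ_iff h2 x l).1 h).2

/-- A ball exchange fixes all the elements that are not under one of the two germs. -/
theorem map_ballSwap_eq_self {a : TildeTree Λ (UrysohnSpace Λ)} (g : UrysohnIsometryGroup Λ)
    (c : UrysohnSpace Λ) (l : Λ) (h : dist c (g c) ≤ l.1.1) (h1 : ¬ a.Under (germ c l))
    (h2 : ¬ a.Under (germ (g c) l)) :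
    map (ballSwap g c l.1.1 (UrysohnSpace.level_pos l).le h) a = a := by
  obtain ⟨x, hx⟩ := a.exists_hasCenter
  by_cases hl : a.Below l
  · rw [under_germ_iff hx] at h1 h2
    exact map_eq_self_of_apply_eq hx (ballSwap_of_not_lt g c _ _ h (fun h => h1 ⟨hl, h⟩)
      (fun h => h2 ⟨hl, h⟩))
  · exact map_eq_self_of_dist_le hx hl (dist_ballSwap_le g c _ _ h x)

/-- A ball exchange acts by `g` on the elements under the first germ. -/
theorem map_ballSwap_of_under {a : TildeTree Λ (UrysohnSpace Λ)} (g : UrysohnIsometryGroup Λ)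
    (c : UrysohnSpace Λ) (l : Λ) (h : dist c (g c) ≤ l.1.1) (h1 : a.Under (germ c l)) :
    map (ballSwap g c l.1.1 (UrysohnSpace.level_pos l).le h) a = map g a := by
  obtain ⟨x, hx⟩ := a.exists_hasCenter
  rw [under_germ_iff hx] at h1
  rw [map_eq_iff_hasCenter _ hx (isLeft_map g a).symm (height_map g a).symm,
    ballSwap_of_lt g c _ _ h h1.2]
  exact hx.map g

theorem under_map_germ_iff (g : UrysohnIsometryGroup Λ) (a : TildeTree Λ (UrysohnSpace Λ))
    (x : UrysohnSpace Λ) (m : Λ) : (map g a).Under (germ (g x) m) ↔ a.Under (germ x m) :=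
  under_map g a (germ x m)

end TildeTree

/-! ### Compactness of the semigroup -/

section Compactness

open Filter Topology PartialBijection

variable {Λ : Set (Set.Ioi (0 : ℝ))}

theorem TreePoint.mem_ascendingPath_self {X : Type*} [MetricSpace X] [IsUltrametricDist X]
    (p : TreePoint X) : p ∈ p.ascendingPath := by
  obtain ⟨x, r, rfl⟩ := p.exists_rep
  exact ⟨x, r, r, le_rfl, rfl, rfl⟩

theorem TreePoint.eq_of_mem_of_height_le {X : Type*} [MetricSpace X] [IsUltrametricDist X]
    {p q : TreePoint X} (h : q ∈ p.ascendingPath) (h' : q.height ≤ p.height) : p = q := by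
  obtain ⟨x, r, s, hrs, rfl, rfl⟩ := h
  rw [TreePoint.height_mk, TreePoint.height_mk] at h'
  rw [le_antisymm hrs h']

namespace IsMaximalNaked

variable {p q : TreePoint (UrysohnSpace Λ)}

theorem le_level (h : IsMaximalNaked Λ p q) {m : Λ} (hm : q.height < ENNReal.ofReal m.1.1) :
    p.height ≤ ENNReal.ofReal m.1.1 :=
  not_lt.1 (((isMaximalNaked_iff p q h.1.1).1 h).1.2 m hm)

end IsMaximalNaked

namespace IsWoollyIso

variable {φ ψ : PartialBijection (TildeTree Λ (UrysohnSpace Λ))}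

/-- An element `c` is determined by `a` if it is over `a`, or under `a` without any branching
between them. -/
def _root_.TildeTree.Determines (a c : TildeTree Λ (UrysohnSpace Λ)) : Prop :=
  a.Under c ∨ (c.Under a ∧ ∀ m, c.Below m → a.Below m)

/-- Over `a`, the image inherits a center from `b`. Under `a`, two different images would have
centers at a distance `m` in `Λ` with both images below level `m`; then `b` is below `m` as well and
has both centers, so the germ of height `m` over `b` contains both and their distance is less than
`m`. -/
theorem sends_eq_of_determines (hφ : IsWoollyIso φ) (hψ : IsWoollyIso ψ)
    {a b c d d' : TildeTree Λ (UrysohnSpace Λ)} (h : a.Determines c)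
    (ha : φ.Sends a b) (ha' : ψ.Sends a b) (hc : φ.Sends c d) (hc' : ψ.Sends c d') : d = d' := by
  have e1 : d.isLeft = d'.isLeft := (hφ.isLeft _ _ hc).symm.trans (hψ.isLeft _ _ hc')
  have e2 : d.height = d'.height := (hφ.height _ _ hc).symm.trans (hψ.height _ _ hc')
  rcases h with h | ⟨h, hm⟩
  · obtain ⟨x, hx⟩ := b.exists_hasCenter
    exact TildeTree.eq_of_hasCenter (hx.of_under ((hφ.under _ _ _ _ ha hc).1 h))
      (hx.of_under ((hψ.under _ _ _ _ ha' hc').1 h)) e1 e2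
  · obtain ⟨x, hx⟩ := d.exists_hasCenter
    obtain ⟨y, hy⟩ := d'.exists_hasCenter
    refine (TildeTree.eq_or_exists_level hx hy e1 e2).resolve_right ?_
    rintro ⟨m, hd, hb⟩
    have hbm : b.Below m := (TildeTree.below_congr (hφ.isLeft _ _ ha) (hφ.height _ _ ha) m).1
      (hm m ((TildeTree.below_congr (hφ.isLeft _ _ hc) (hφ.height _ _ hc) m).2 hb))
    have h1 := hx.of_under ((hφ.under _ _ _ _ hc ha).1 h)
    have h2 := hy.of_under ((hψ.under _ _ _ _ hc' ha').1 h)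
    have h3 := (TildeTree.under_germ_iff h2 y m).2 ⟨hbm, by rw [dist_self]; exact m.1.2⟩
    exact ((TildeTree.under_germ_iff h1 y m).1 h3).2.ne hd.symm

end IsWoollyIso

/-! ### Ultrafilter limits in the semigroup. -/

namespace WoollySemigroup

theorem tendsto_nhds_iff {ι : Type*} {f : ι → WoollySemigroup Λ} {l : Filter ι}
    {π : WoollySemigroup Λ} :
    Tendsto f l (𝓝 π) ↔ ∀ a b, ∀ᶠ i in l, (f i).1.Sends a b ↔ π.1.Sends a b := by
  rw [tendsto_subtype_rng, TopologicalSpace.tendsto_nhds_generateFrom_iff]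
  constructor
  · intro h a b
    by_cases hab : π.1.Sends a b
    · filter_upwards [h _ ⟨a, b, Or.inl rfl⟩ hab] with i hi
      exact ⟨fun _ => hab, fun _ => hi⟩
    · filter_upwards [h _ ⟨a, b, Or.inr rfl⟩ hab] with i hi
      exact ⟨fun k => absurd k hi, fun k => absurd k hab⟩
  · rintro h s ⟨a, b, rfl | rfl⟩ hs
    · filter_upwards [h a b] with i hi
      exact hi.2 hs
    · filter_upwards [h a b] with i hi
      exact fun k => hs (hi.1 k)

theorem tendsto_nhds_iff_ultrafilter {ι : Type*} {f : ι → WoollySemigroup Λ} {l : Ultrafilter ι}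
    {π : WoollySemigroup Λ} :
    Tendsto f l (𝓝 π) ↔ ∀ a b, π.1.Sends a b ↔ ∀ᶠ i in l, (f i).1.Sends a b := by
  rw [tendsto_nhds_iff]
  refine forall₂_congr fun a b => ⟨fun h => ⟨fun hab => ?_, fun hab => ?_⟩, fun h => ?_⟩
  · exact h.mono fun i hi => hi.2 hab
  · obtain ⟨i, h1, h2⟩ := (h.and hab).exists
    exact h1.1 h2
  · by_cases hab : π.1.Sends a b
    · exact (h.1 hab).mono fun i hi => ⟨fun _ => hab, fun _ => hi⟩
    · have := Ultrafilter.eventually_not.2 (fun k => hab (h.2 k))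
      exact this.mono fun i hi => ⟨fun k => absurd k hi, fun k => absurd k hab⟩

/-- Each axiom has the form "`a` in the domain implies `c` in the domain" with `c` determined by
`a`. If `φ(a) = b` for most `φ`, then `φ(c)` is defined and is the same for all of these `φ`, so the
limit is defined at `c`. -/
theorem dom_isWoolly_of_ultrafilter {𝒰 : Ultrafilter (WoollySemigroup Λ)}
    {π : PartialBijection (TildeTree Λ (UrysohnSpace Λ))}
    (h : ∀ a b, π.Sends a b ↔ ∀ᶠ φ : WoollySemigroup Λ in 𝒰, φ.1.Sends a b) :
    IsWoolly π.dom := by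
  have key : ∀ a c : TildeTree Λ (UrysohnSpace Λ), a.Determines c →
      (∀ φ : WoollySemigroup Λ, a ∈ φ.1.dom → c ∈ φ.1.dom) → a ∈ π.dom → c ∈ π.dom := by
    rintro a c hac hd ⟨b, hb⟩
    have hb := (h a b).1 hb
    obtain ⟨φ, hφ⟩ := hb.exists
    obtain ⟨d, hφd⟩ := hd φ ⟨b, hφ⟩
    refine ⟨d, (h c d).2 (hb.mono fun ψ hψ => ?_)⟩
    obtain ⟨d', hψd⟩ := hd ψ ⟨b, hψ⟩
    rwa [φ.2.sends_eq_of_determines ψ.2 hac hφ hψ hφd hψd]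
  refine ⟨⟨Sum.inl (corePointTop Λ), _, (h _ _).2 (Eventually.of_forall fun φ => φ.2.top_sends)⟩,
    ?_, ?_, ?_, ?_, ?_, ?_⟩
  · intro p q hpq
    exact key _ _ (Or.inl hpq) fun φ => φ.2.dom_woolly.path p q hpq
  · intro p g hpg
    exact key _ _ (Or.inl hpg) fun φ => φ.2.dom_woolly.germ p g hpg
  · intro g v hv
    refine key _ _ (Or.inl ?_) fun φ => φ.2.dom_woolly.vertex g v hv
    change v.1 ∈ g.vertex.ascendingPath
    rw [hv]
    exact v.1.mem_ascendingPath_self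
  · intro p q z hn hzq hpz hzp hzq'
    refine key _ _ (Or.inr ⟨hzq, fun m hm => ?_⟩) fun φ =>
      φ.2.dom_woolly.naked_interior p q z hn hzq hpz hzp hzq'
    refine lt_of_lt_of_le (lt_of_not_ge fun hle => hzp (Subtype.ext ?_)) (hn.le_level hm)
    exact TreePoint.eq_of_mem_of_height_le hpz hle
  · intro p q g hn hv hg
    refine key _ _ (Or.inr ⟨hg, fun m hm => ?_⟩) fun φ =>
      φ.2.dom_woolly.naked_germ p q g hn hv hg
    change g.vertex.height ≤ _
    rw [hv]
    exact hn.le_level hm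
  · intro p q hn hv
    refine key _ _ (Or.inr ⟨hn.1.1, fun m hm => ?_⟩) fun φ =>
      φ.2.dom_woolly.naked_upper p q hn hv
    exact lt_of_le_of_ne (hn.le_level hm) fun e => hv ⟨m, e⟩

/-- Any two relations that hold for most `φ` hold for a common `φ`, so the limit relation is
single-valued in both directions. -/
theorem exists_partialBijection_of_ultrafilter (𝒰 : Ultrafilter (WoollySemigroup Λ)) :
    ∃ π : PartialBijection (TildeTree Λ (UrysohnSpace Λ)),
      ∀ a b, π.Sends a b ↔ ∀ᶠ φ : WoollySemigroup Λ in 𝒰, φ.1.Sends a b := by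
  classical
  let R : TildeTree Λ (UrysohnSpace Λ) → TildeTree Λ (UrysohnSpace Λ) → Prop :=
    fun a b => ∀ᶠ φ : WoollySemigroup Λ in 𝒰, φ.1.Sends a b
  have hR : ∀ a b c, R a b → R a c → b = c := fun a b c h h' => by
    obtain ⟨φ, h1, h2⟩ := (h.and h').exists
    exact h1.unique h2
  have hR' : ∀ a b c, R b a → R c a → b = c := fun a b c h h' => by
    obtain ⟨φ, h1, h2⟩ := (h.and h').exists
    exact (sends_star.2 h1).unique (sends_star.2 h2)
  have key : ∀ (Q : TildeTree Λ (UrysohnSpace Λ) → Prop) (_ : ∀ b c, Q b → Q c → b = c)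
      (b : TildeTree Λ (UrysohnSpace Λ)),
      b ∈ (if h : ∃ b, Q b then some h.choose else none) ↔ Q b := by
    intro Q hQ b
    split_ifs with h
    · rw [Option.mem_some_iff]
      exact ⟨fun e => e ▸ h.choose_spec, fun hb => hQ _ _ h.choose_spec hb⟩
    · exact ⟨fun hb => by simp at hb, fun hb => absurd ⟨b, hb⟩ h⟩
  refine ⟨⟨fun a => if h : ∃ b, R a b then some h.choose else none,
    fun a => if h : ∃ b, R b a then some h.choose else none, fun a b => ?_⟩, fun a b => ?_⟩
  · exact (key (fun c => R c b) (hR' b) a).trans (key (R a) (hR a) b).symm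
  · exact key (R a) (hR a) b

theorem continuous_star : Continuous fun π : WoollySemigroup Λ => star π := by
  refine continuous_iff_continuousAt.2 fun π => tendsto_nhds_iff.2 fun a b => ?_
  filter_upwards [tendsto_nhds_iff.1 (tendsto_id (α := WoollySemigroup Λ) (x := 𝓝 π)) b a]
    with φ hφ
  exact sends_star.trans (hφ.trans sends_star.symm)

/-- For fixed `ψ`, the relation `(πψ)(a) = c` is either the single relation `π(ψ(a)) = c` or never
true. -/
theorem continuous_mul_right (ψ : WoollySemigroup Λ) :
    Continuous fun π : WoollySemigroup Λ => π * ψ := by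
  refine continuous_iff_continuousAt.2 fun π => tendsto_nhds_iff.2 fun a c => ?_
  by_cases ha : a ∈ ψ.1.dom
  · obtain ⟨b, hb⟩ := ha
    have key : ∀ φ : WoollySemigroup Λ, (φ * ψ).1.Sends a c ↔ φ.1.Sends b c := fun φ =>
      sends_mul.trans ⟨fun ⟨b', h1, h2⟩ => by rwa [hb.unique h1], fun h => ⟨b, hb, h⟩⟩
    filter_upwards [tendsto_nhds_iff.1 (tendsto_id (α := WoollySemigroup Λ) (x := 𝓝 π)) b c]
      with φ hφ
    exact (key φ).trans (hφ.trans (key π).symm)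
  · have key : ∀ φ : WoollySemigroup Λ, ¬ (φ * ψ).1.Sends a c := fun φ h => by
      obtain ⟨b, h1, -⟩ := sends_mul.1 h
      exact ha ⟨b, h1⟩
    exact Eventually.of_forall fun φ => iff_of_false (key φ) (key π)

theorem continuous_mul_left (ψ : WoollySemigroup Λ) :
    Continuous fun π : WoollySemigroup Λ => ψ * π := by
  have : (fun π : WoollySemigroup Λ => ψ * π) = fun π => star (star π * star ψ) := by
    funext π
    rw [star_mul, star_star, star_star]
  rw [this]
  exact continuous_star.comp ((continuous_mul_right (star ψ)).comp continuous_star)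

instance instCompactSpace : CompactSpace (WoollySemigroup Λ) := by
  refine ⟨isCompact_iff_ultrafilter_le_nhds.2 fun 𝒰 _ => ?_⟩
  obtain ⟨π, hπ⟩ := exists_partialBijection_of_ultrafilter 𝒰
  -- The image of the limit is the domain of the limit of the inverses, so the result on domains is
  -- applied to the ultrafilter pushed forward by the involution.
  have hstar : ∀ a b, (star π).Sends a b ↔
      ∀ᶠ φ : WoollySemigroup Λ in 𝒰.map star, φ.1.Sends a b := fun a b => by
    rw [sends_star, hπ]
    exact eventually_congr (Eventually.of_forall fun φ => sends_star.symm)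
  refine ⟨⟨π, ?_⟩, trivial, ?_⟩
  · refine ⟨dom_isWoolly_of_ultrafilter hπ, ?_, fun a b h => ?_, fun a b h => ?_,
      fun a a' b b' h h' => ?_⟩
    · rw [← dom_star]
      exact dom_isWoolly_of_ultrafilter hstar
    · obtain ⟨φ, hφ⟩ := ((hπ _ _).1 h).exists
      exact φ.2.isLeft _ _ hφ
    · obtain ⟨φ, hφ⟩ := ((hπ _ _).1 h).exists
      exact φ.2.height _ _ hφ
    · obtain ⟨φ, hφ, hφ'⟩ := (((hπ _ _).1 h).and ((hπ _ _).1 h')).exists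
      exact φ.2.under _ _ _ _ hφ hφ'
  · exact (tendsto_nhds_iff_ultrafilter (f := id)).2 hπ

end WoollySemigroup

end Compactness

/-! ### Density of the isometries in the semigroup -/

section Density

open Filter Topology PartialBijection TildeTree

variable {Λ : Set (Set.Ioi (0 : ℝ))}

namespace TildeTree

/-- A center of the ball that corresponds to an element of `T̃`. -/
noncomputable def center (a : TildeTree Λ (UrysohnSpace Λ)) : UrysohnSpace Λ :=
  a.exists_hasCenter.choose

theorem hasCenter_center (a : TildeTree Λ (UrysohnSpace Λ)) : a.HasCenter a.center :=
  a.exists_hasCenter.choose_spec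

theorem hasCenter_top (x : UrysohnSpace Λ) :
    HasCenter (Sum.inl (corePointTop Λ) : TildeTree Λ (UrysohnSpace Λ)) x :=
  TreePoint.mk_eq_mk.2 ⟨rfl, le_top⟩

theorem under_germ_of_below {a : TildeTree Λ (UrysohnSpace Λ)} {x : UrysohnSpace Λ}
    (h : a.HasCenter x) {m : Λ} (hm : a.Below m) : a.Under (germ x m) :=
  (under_germ_iff h x m).2 ⟨hm, by rw [dist_self]; exact m.1.2⟩

/-- If all the germs over `c` are directed to points of a ball around `y`, then `y` is a center
of `c`. -/
theorem HasCenter.of_forall_dist_lt {c : TildeTree Λ (UrysohnSpace Λ)} {x y : UrysohnSpace Λ}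
    (h : c.HasCenter x) (hy : ∀ m, c.Below m → dist y x < m.1.1) : c.HasCenter y := by
  have h2 := h.map (UrysohnSpace.translate x y)
  rw [UrysohnSpace.translate_apply_self] at h2
  rcases eq_or_exists_level h h2 (isLeft_map _ c).symm (height_map _ c).symm with e | ⟨m, hm, hb⟩
  · rwa [← e] at h2
  · exact absurd (hy m hb) (by rw [hm, dist_comm]; exact lt_irrefl _)

end TildeTree

/-! ### Descent without branching in woolly subtrees. -/

namespace IsWoolly

variable {S : Set (TildeTree Λ (UrysohnSpace Λ))}

theorem mem_of_under (hS : IsWoolly S) {a c : TildeTree Λ (UrysohnSpace Λ)} (ha : a ∈ S)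
    (h : a.Under c) : c ∈ S := by
  rcases a with p | g <;> rcases c with q | k
  · exact hS.path p q h ha
  · exact hS.germ p k h ha
  · exact hS.path g.coreVertex q h (hS.vertex g _ rfl ha)
  · rcases h with rfl | h
    · exact ha
    · exact hS.germ g.coreVertex k h (hS.vertex g _ rfl ha)

/-- A gap `(r, s)` of `Λ` extends to a maximal naked segment. -/
theorem exists_maximalNaked (q : CorePoint (UrysohnSpace Λ)) {y : UrysohnSpace Λ}
    (hq : q.1 = TreePoint.mk y q.1.height) {s : ℝ≥0∞} (hs : q.1.height < s)
    (hgap : ∀ m : Λ, q.1.height < ENNReal.ofReal m.1.1 → s ≤ ENNReal.ofReal m.1.1) :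
    ∃ p₀ q₀ : CorePoint (UrysohnSpace Λ), IsMaximalNaked Λ p₀.1 q₀.1 ∧
      p₀.1 = TreePoint.mk y p₀.1.height ∧ q₀.1 = TreePoint.mk y q₀.1.height ∧
      q₀.1.height ≤ q.1.height ∧ s ≤ p₀.1.height ∧
      ∀ m : Λ, q.1.height < ENNReal.ofReal m.1.1 → p₀.1.height ≤ ENNReal.ofReal m.1.1 := by
  set r := q.1.height with hr
  -- The ends of the maximal gap around `r`. If there are no levels at all on one side, the
  -- conventions give `0` and `∞`, which are the right ends.
  set r₀ : ℝ≥0∞ := sSup {t | ∃ m : Λ, ENNReal.ofReal m.1.1 = t ∧ t ≤ r} with hr₀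
  set s₀ : ℝ≥0∞ := sInf {t | ∃ m : Λ, ENNReal.ofReal m.1.1 = t ∧ r < t} with hs₀
  have h1 : r₀ ≤ r := sSup_le fun t ⟨m, _, ht⟩ => ht
  have h2 : s ≤ s₀ := le_sInf fun t ⟨m, hm, ht⟩ => hm ▸ hgap m (hm ▸ ht)
  have h3 : ∀ m : Λ, r < ENNReal.ofReal m.1.1 → s₀ ≤ ENNReal.ofReal m.1.1 := fun m hm =>
    sInf_le ⟨m, rfl, hm⟩
  have h4 : ∀ m : Λ, ENNReal.ofReal m.1.1 ≤ r → ENNReal.ofReal m.1.1 ≤ r₀ := fun m hm =>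
    le_sSup ⟨m, rfl, hm⟩
  have h5 : r₀ < s₀ := h1.trans_lt (hs.trans_le h2)
  -- A lower end of height `0` must be isolated: either `r = 0` and it is `q` itself, or there are
  -- no levels up to `r` and the ball of radius `r` around `y` is a single point.
  have hcore : 0 < r₀ ∨ ∃ x : UrysohnSpace Λ, IsOpen ({x} : Set (UrysohnSpace Λ)) ∧
      TreePoint.mk y r₀ = TreePoint.mk x 0 := by
    rcases eq_or_ne r₀ 0 with h0 | h0
    · refine Or.inr ⟨y, ?_, by rw [h0]⟩
      rcases eq_or_ne r 0 with hr0 | hr0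
      · rcases q.2 with h | ⟨x, hx, hx'⟩
        · exact absurd h (by rw [← hr, hr0]; exact lt_irrefl _)
        · rw [hx', TreePoint.mk_eq_mk] at hq
          rwa [← edist_le_zero.1 hq.2]
      · have hrt : r ≠ ⊤ := (hs.trans_le le_top).ne
        have hpos : 0 < r.toReal := ENNReal.toReal_pos hr0 hrt
        have : ({y} : Set (UrysohnSpace Λ)) = Metric.ball y r.toReal := by
          ext z
          rw [Set.mem_singleton_iff, Metric.mem_ball]
          refine ⟨fun h => by rw [h, dist_self]; exact hpos, fun h => ?_⟩
          by_contra hne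
          obtain ⟨m, hm, -⟩ := UrysohnSpace.exists_level_eq_dist hne
          have h6 := h4 m (by rw [hm]; exact ENNReal.ofReal_le_of_le_toReal h.le)
          rw [h0, nonpos_iff_eq_zero] at h6
          exact (ofReal_level_pos m).ne' h6
        rw [this]
        exact Metric.isOpen_ball
    · exact Or.inl (pos_iff_ne_zero.2 h0)
  refine ⟨⟨TreePoint.mk y s₀, Or.inl (hs.bot_lt.trans_le h2)⟩, ⟨TreePoint.mk y r₀, hcore⟩,
    (isMaximalNaked_iff _ _ ⟨y, r₀, s₀, h5.le, rfl, rfl⟩).2 ⟨⟨h5, fun m hm hm' => ?_⟩,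
      fun s' r' hs' hr' hg => ⟨?_, ?_⟩⟩, rfl, rfl, h1, h2, h3⟩
  · rcases le_or_gt (ENNReal.ofReal m.1.1) r with h | h
    · exact absurd (h4 m h) (not_le.2 hm)
    · exact absurd (h3 m h) (not_le.2 hm')
  · refine le_antisymm (not_lt.1 fun hlt => ?_) hs'
    obtain ⟨t, ⟨m, rfl, hm⟩, ht⟩ := sInf_lt_iff.1 hlt
    exact hg.2 m (hr'.trans_lt (h1.trans_lt hm)) ht
  · refine le_antisymm hr' (not_lt.1 fun hlt => ?_)
    obtain ⟨t, ⟨m, rfl, hm⟩, ht⟩ := lt_sSup_iff.1 hlt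
    exact hg.2 m ht (hm.trans_lt (hs.trans_le (h2.trans hs')))

/-- A woolly subtree is closed under descent without branching. -/
theorem mem_of_below (hS : IsWoolly S) {a c : TildeTree Λ (UrysohnSpace Λ)} {y : UrysohnSpace Λ}
    (ha : a ∈ S) (hay : a.HasCenter y) (hcy : c.HasCenter y)
    (h : ∀ m, c.Below m → a.Below m) : c ∈ S := by
  rcases c with q | k
  · by_cases hau : a.Under (Sum.inl q)
    · exact hS.mem_of_under ha hau
    have path : ∀ q₀ : CorePoint (UrysohnSpace Λ), q₀.1 = TreePoint.mk y q₀.1.height →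
        q₀.1.height ≤ q.1.height → Sum.inl q₀ ∈ S → Sum.inl q ∈ S := fun q₀ e hle hq₀ =>
      hS.path q₀ q ⟨y, _, _, hle, e, hcy⟩ hq₀
    rcases a with p | g
    · have hlt : q.1.height < p.1.height := lt_of_not_ge fun hle =>
        hau ⟨y, _, _, hle, hay, hcy⟩
      obtain ⟨p₀, q₀, hn, e1, e2, h1, h2, h3⟩ := exists_maximalNaked q hcy hlt
        fun m hm => (h m hm).le
      refine path q₀ e2 h1 ?_
      -- If `p` is not the upper end, it is interior to the segment. If it is, it cannot be a
      -- vertex: `q` would be below that level, hence so would `p`, strictly.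
      rcases h2.lt_or_eq with h2 | h2
      · refine hS.naked_interior p₀ q₀ p hn ⟨y, _, _, h1.trans hlt.le, e2, hay⟩
          ⟨y, _, _, h2.le, hay, e1⟩ ?_ ?_ ha
        · rintro rfl; exact lt_irrefl _ h2
        · rintro rfl; exact absurd h1 (not_le.2 hlt)
      · have e : p = p₀ := Subtype.ext (by rw [show p.1 = _ from hay, e1, h2])
        subst e
        refine hS.naked_upper p q₀ hn ?_ ha
        rintro ⟨m, hm⟩
        exact (h m (hlt.trans_eq hm)).ne hm
    · obtain ⟨l, rfl⟩ := hay
      have hlt : q.1.height < ENNReal.ofReal l.1.1 := lt_of_not_ge fun hle =>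
        hau ⟨y, _, _, hle, rfl, hcy⟩
      obtain ⟨p₀, q₀, hn, e1, e2, h1, h2, h3⟩ := exists_maximalNaked q hcy hlt fun m hm => h m hm
      refine path q₀ e2 h1 (hS.naked_germ p₀ q₀ (DownGerm.mk y l) hn ?_ ?_ ha)
      · rw [e1, ← le_antisymm h2 (h3 l hlt)]; rfl
      · rw [e2, DownGerm.directedTo_mk, dist_self]
        exact ⟨h1.trans_lt hlt, l.1.2⟩
  · obtain ⟨l, rfl⟩ := hcy
    exact hS.mem_of_under ha (under_germ_of_below hay (h l le_rfl))

/-- An element outside of a woolly subtree lies under a germ that does not lead to a given finite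
subset of the subtree. -/
theorem exists_germ_avoiding (hS : IsWoolly S) {c : TildeTree Λ (UrysohnSpace Λ)}
    {x : UrysohnSpace Λ} (hc : c ∉ S) (hx : c.HasCenter x)
    (A : Finset (TildeTree Λ (UrysohnSpace Λ))) (hA : ∀ a ∈ A, a ∈ S) :
    ∃ l, c.Below l ∧ ∀ a ∈ A, ¬ a.Under (TildeTree.germ x l) := by
  by_contra! H
  by_cases hne : ∃ l, c.Below l
  · obtain ⟨l₁, hl₁⟩ := hne
    -- One element of `A` is under all the germs over `c`. Otherwise each `a` misses the germ of
    -- some height `f a`; an element under the germ of the least such height is also under every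
    -- higher germ, including its own.
    obtain ⟨a₀, ha₀, h₀⟩ : ∃ a₀ ∈ A, ∀ l, c.Below l → a₀.Under (TildeTree.germ x l) := by
      by_contra! K
      have : Nonempty Λ := ⟨l₁⟩
      choose! f hf hf' using K
      obtain ⟨a₁, ha₁, -⟩ := H l₁ hl₁
      obtain ⟨a₂, ha₂, hmin⟩ := A.exists_min_image (fun a => (f a).1.1) ⟨a₁, ha₁⟩
      obtain ⟨a₃, ha₃, h₃⟩ := H (f a₂) (hf a₂ ha₂)
      refine hf' a₃ ha₃ ((under_germ_iff a₃.hasCenter_center x _).2 ?_)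
      obtain ⟨h4, h5⟩ := (under_germ_iff a₃.hasCenter_center x _).1 h₃
      exact ⟨h4.mono (hmin a₃ ha₃), h5.trans_le (hmin a₃ ha₃)⟩
    refine hc (hS.mem_of_below (hA a₀ ha₀) a₀.hasCenter_center ?_ fun m hm =>
      ((under_germ_iff a₀.hasCenter_center x m).1 (h₀ m hm)).1)
    exact hx.of_forall_dist_lt fun m hm =>
      ((under_germ_iff a₀.hasCenter_center x m).1 (h₀ m hm)).2
  -- Nothing branches above `c`, so `c` is reached from `∞`.
  · exact hc (hS.mem_of_below hS.top_mem (hasCenter_top x) hx fun m hm => absurd ⟨m, hm⟩ hne)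

end IsWoolly

/-! ### Approximation of partial isomorphisms by isometries. -/

namespace IsWoollyIso

variable {π : PartialBijection (TildeTree Λ (UrysohnSpace Λ))}

/-- Homogeneity: a partial isomorphism agrees with an isometry on every finite subset of its
domain. -/
theorem exists_isometry_extending (hπ : IsWoollyIso π)
    (A : Finset (TildeTree Λ (UrysohnSpace Λ))) (hA : ∀ a ∈ A, a ∈ π.dom) :
    ∃ g : UrysohnIsometryGroup Λ, ∀ a ∈ A, π.Sends a (TildeTree.map g a) := by
  classical
  induction A using Finset.induction_on with
  | empty => exact ⟨1, by simp⟩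
  | insert a A _ ih =>
    obtain ⟨g, hg⟩ := ih fun c hc => hA c (Finset.mem_insert_of_mem hc)
    obtain ⟨b, hb⟩ := hA a (Finset.mem_insert_self a A)
    obtain ⟨x, hx⟩ := a.exists_hasCenter
    obtain ⟨y, hy⟩ := b.exists_hasCenter
    have e1 : (map g a).isLeft = b.isLeft := (isLeft_map g a).trans (hπ.isLeft _ _ hb)
    have e2 : (map g a).height = b.height := (height_map g a).trans (hπ.height _ _ hb)
    rcases eq_or_exists_level (hx.map g) hy e1 e2 with h | ⟨m, hm, hbm⟩
    · refine ⟨g, fun c hc => ?_⟩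
      rcases Finset.mem_insert.1 hc with rfl | hc
      · rwa [h]
      · exact hg c hc
    -- The images `g(a)` and `b` first separate at level `m`. The correction exchanges the open
    -- balls of radius `m` around `g x` and `y`.
    have hau : a.Under (germ x m) := under_germ_of_below hx ((below_map g a m).1 hbm)
    have hgerm : π.Sends (germ x m) (germ y m) := by
      obtain ⟨e, he⟩ := hπ.dom_woolly.mem_of_under ⟨b, hb⟩ hau
      rwa [eq_of_hasCenter (hy.of_under ((hπ.under _ _ _ _ hb he).1 hau)) (hasCenter_germ y m)
        (hπ.isLeft _ _ he).symm (hπ.height _ _ he).symm] at he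
    have hτ : dist (g x) (UrysohnSpace.translate (g x) y (g x)) ≤ m.1.1 := by
      rw [UrysohnSpace.translate_apply_self, hm]
    refine ⟨ballSwap (UrysohnSpace.translate (g x) y) (g x) m.1.1
      (UrysohnSpace.level_pos m).le hτ * g, fun c hc => ?_⟩
    rw [TildeTree.map_mul]
    rcases Finset.mem_insert.1 hc with rfl | hc
    · rw [map_ballSwap_of_under _ _ _ _ (under_germ_of_below (hx.map g) hbm)]
      have hz := (hx.map g).map (UrysohnSpace.translate (g x) y)
      rw [UrysohnSpace.translate_apply_self] at hz
      rwa [eq_of_hasCenter hz hy ((isLeft_map _ _).trans e1) ((height_map _ _).trans e2)]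
    -- The earlier elements are in neither ball: since `π` preserves order and equals `g` on `A`,
    -- the element `g(c)` is under one of the two germs iff it is under the other, and the balls are
    -- disjoint.
    · have key : ¬ ((map g c).Under (germ (g x) m) ∧ (map g c).Under (germ y m)) := by
        rintro ⟨h1, h2⟩
        have h3 := ((under_germ_iff (map g c).hasCenter_center _ m).1 h1).2
        have h4 := ((under_germ_iff (map g c).hasCenter_center _ m).1 h2).2
        refine lt_irrefl m.1.1 ?_
        nth_rewrite 1 [hm]
        refine (dist_triangle_max _ (map g c).center _).trans_lt (max_lt ?_ h4)
        rwa [dist_comm]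
      have hiff : c.Under (germ x m) ↔ (map g c).Under (germ y m) :=
        hπ.under _ _ _ _ (hg c hc) hgerm
      rw [map_ballSwap_eq_self _ _ _ _ (fun h => key ⟨h, hiff.1 ((under_map_germ_iff g c x m).1 h)⟩)
        (fun h => ?_)]
      · exact hg c hc
      · rw [UrysohnSpace.translate_apply_self] at h
        exact key ⟨(under_map_germ_iff g c x m).2 (hiff.2 h), h⟩

/-- A partial isomorphism agrees on a finite subset of its domain with an isometry that moves
finitely many elements outside of the domain away from a finite set. -/
theorem exists_isometry_avoiding (hπ : IsWoollyIso π)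
    (A C D : Finset (TildeTree Λ (UrysohnSpace Λ))) (hA : ∀ a ∈ A, a ∈ π.dom)
    (hC : ∀ c ∈ C, c ∉ π.dom) :
    ∃ g : UrysohnIsometryGroup Λ, (∀ a ∈ A, π.Sends a (TildeTree.map g a)) ∧
      ∀ c ∈ C, TildeTree.map g c ∉ D := by
  classical
  induction C using Finset.induction_on with
  | empty =>
    obtain ⟨g, hg⟩ := hπ.exists_isometry_extending A hA
    exact ⟨g, hg, by simp⟩
  | insert c C _ ih =>
    obtain ⟨g, hg, hgC⟩ := ih fun c' hc' => hC c' (Finset.mem_insert_of_mem hc')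
    obtain ⟨x, hx⟩ := c.exists_hasCenter
    obtain ⟨l, hcl, hl⟩ := hπ.dom_woolly.exists_germ_avoiding
      (hC c (Finset.mem_insert_self c C)) hx A hA
    -- A fresh branch at level `l`. Transposing it with the branch of `g x` takes everything under
    -- that germ off `D`, fixes the images of `A` because they avoid the germ, and fixes those
    -- earlier elements of `C` that it does not move off `D`.
    obtain ⟨n, hn⟩ := Infinite.exists_notMem_finset
      ((D ∪ (A ∪ C).image (map g)).image fun a => a.center.toFun l)
    have hn : ∀ a ∈ D ∪ (A ∪ C).image (map g), a.center.toFun l ≠ n := fun a ha h =>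
      hn (Finset.mem_image.2 ⟨a, ha, h⟩)
    let κ := UrysohnSpace.perm (g x) l (Equiv.swap ((g x).toFun l) n)
    have hfix : ∀ (a : TildeTree Λ (UrysohnSpace Λ)) (z : UrysohnSpace Λ), a.HasCenter z →
        z.toFun l ≠ n → ¬ a.Under (germ (g x) l) → map κ a = a := by
      intro a z hz hzn hau
      by_cases hal : a.Below l
      · refine map_eq_self_of_apply_eq hz ?_
        by_cases hd : dist z (g x) ≤ l.1.1
        · refine UrysohnSpace.permFun_of_fixed (Equiv.swap_apply_of_ne_of_ne (fun he => ?_) hzn)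
          exact hau ((under_germ_iff hz _ l).2 ⟨hal, (UrysohnSpace.dist_lt_iff_apply_eq hd).2 he⟩)
        · exact UrysohnSpace.permFun_of_not_le _ hd
      · exact map_eq_self_of_dist_le hz hal (UrysohnSpace.dist_permFun_le _ _ _ z)
    have hmove : ∀ a : TildeTree Λ (UrysohnSpace Λ), a.Under (germ (g x) l) → map κ a ∉ D := by
      intro a ha haD
      obtain ⟨hal, had⟩ := (under_germ_iff a.hasCenter_center _ l).1 ha
      have h1 := under_germ_of_below (a.hasCenter_center.map κ) ((below_map κ a l).2 hal)
      have h2 := UrysohnSpace.apply_eq_of_dist_lt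
        ((under_germ_iff (map κ a).hasCenter_center _ l).1 h1).2
      refine hn _ (Finset.mem_union_left _ haD) (h2.trans ?_)
      refine (UrysohnSpace.permFun_apply_level _ had.le).trans ?_
      rw [UrysohnSpace.apply_eq_of_dist_lt had, Equiv.swap_apply_left]
    refine ⟨κ * g, fun a ha => ?_, fun c' hc' => ?_⟩
    · rw [TildeTree.map_mul, hfix _ _ (map g a).hasCenter_center]
      · exact hg a ha
      · exact hn _ (Finset.mem_union_right _ (Finset.mem_image_of_mem _
          (Finset.mem_union_left _ ha)))
      · rw [under_map_germ_iff]
        exact hl a ha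
    · rw [TildeTree.map_mul]
      by_cases hu : (map g c').Under (germ (g x) l)
      · exact hmove _ hu
      rcases Finset.mem_insert.1 hc' with rfl | hc'
      · exact absurd ((under_map_germ_iff g c' x l).2 (under_germ_of_below hx hcl)) hu
      · rw [hfix _ _ (map g c').hasCenter_center _ hu]
        · exact hgC c' hc'
        · exact hn _ (Finset.mem_union_right _ (Finset.mem_image_of_mem _
            (Finset.mem_union_right _ hc')))

end IsWoollyIso

namespace WoollySemigroup

/-- A neighborhood tests finitely many pairs: agree with `π` on the first entries in its domain, and
move the other first entries off all the second entries. The finite sets of pairs then index a net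
of isometries that tends to `π`. -/
theorem denseRange_ofIsometry :
    DenseRange (ofIsometry : UrysohnIsometryGroup Λ → WoollySemigroup Λ) := by
  classical
  intro π
  have key : ∀ P : Finset (TildeTree Λ (UrysohnSpace Λ) × TildeTree Λ (UrysohnSpace Λ)),
      ∃ g : UrysohnIsometryGroup Λ, ∀ p ∈ P,
        ((ofIsometry g).1.Sends p.1 p.2 ↔ π.1.Sends p.1 p.2) := by
    intro P
    obtain ⟨g, hg, hg'⟩ := π.2.exists_isometry_avoiding
      ((P.image Prod.fst).filter (· ∈ π.1.dom)) ((P.image Prod.fst).filter (· ∉ π.1.dom))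
      (P.image Prod.snd) (fun a ha => (Finset.mem_filter.1 ha).2)
      (fun a ha => (Finset.mem_filter.1 ha).2)
    refine ⟨g, fun p hp => (TildeTree.ofIsometry_sends g p.1 p.2).trans ?_⟩
    have hp1 := Finset.mem_image_of_mem Prod.fst hp
    have hp2 := Finset.mem_image_of_mem Prod.snd hp
    by_cases hd : p.1 ∈ π.1.dom
    · have h := hg p.1 (Finset.mem_filter.2 ⟨hp1, hd⟩)
      exact ⟨fun e => e ▸ h, fun h' => h.unique h'⟩
    · exact ⟨fun e => absurd (e ▸ hp2) (hg' p.1 (Finset.mem_filter.2 ⟨hp1, hd⟩)),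
        fun h => absurd ⟨_, h⟩ hd⟩
  choose g hg using key
  refine mem_closure_of_tendsto (f := fun P => ofIsometry (g P)) (b := atTop)
    (tendsto_nhds_iff.2 fun a b => ?_) (Eventually.of_forall fun P => ⟨g P, rfl⟩)
  filter_upwards [eventually_ge_atTop {(a, b)}] with P hP
  exact hg P (a, b) (hP (Finset.mem_singleton_self _))

end WoollySemigroup

end Density

/-! ### Fixed vectors of subgroups in unitary representations -/

section FixedVectors

open Filter Topology
open scoped InnerProductSpace

/-- A complete convex set has a unique element of minimal norm. -/
theorem Convex.exists_unique_min_norm {F : Type*} [NormedAddCommGroup F] [InnerProductSpace ℝ F]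
    {C : Set F} (ne : C.Nonempty) (hC : IsComplete C) (hconv : Convex ℝ C) :
    ∃ m ∈ C, ∀ m' ∈ C, ‖m'‖ = ‖m‖ → m' = m := by
  obtain ⟨m, hm, hmin⟩ := exists_norm_eq_iInf_of_complete_convex ne hC hconv (0 : F)
  refine ⟨m, hm, fun m' hm' hn => ?_⟩
  have h1 := (norm_eq_iInf_iff_real_inner_le_zero hconv hm).1 hmin m' hm'
  rw [zero_sub, inner_neg_left, inner_sub_right, real_inner_self_eq_norm_sq] at h1
  have h2 : ‖m' - m‖ ^ 2 ≤ 0 := by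
    rw [norm_sub_sq_real, real_inner_comm, hn]
    linarith
  exact sub_eq_zero.1 (norm_eq_zero.1 (pow_eq_zero_iff two_ne_zero |>.1
    (le_antisymm h2 (sq_nonneg _))))

variable {H : Type*} [NormedAddCommGroup H] [InnerProductSpace ℂ H]

theorem isLinearMap_inner_left (w : H) : IsLinearMap ℝ fun u : H => ⟪u, w⟫_ℂ :=
  ⟨fun u v => inner_add_left u v w, fun c u => by
    rw [RCLike.real_smul_eq_coe_smul (K := ℂ) c u, inner_smul_real_left]⟩

/-- A closed subspace that admits a projection is closed under weak limits. -/
theorem Submodule.mem_of_tendsto_inner {ι : Type*} {l : Filter ι} [l.NeBot] (M : Submodule ℂ H)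
    [M.HasOrthogonalProjection] {f : ι → H} {y : H} (hf : ∀ᶠ i in l, f i ∈ M)
    (h : ∀ v, Tendsto (fun i => ⟪v, f i⟫_ℂ) l (𝓝 ⟪v, y⟫_ℂ)) : y ∈ M := by
  rw [← M.orthogonal_orthogonal, Submodule.mem_orthogonal]
  intro v hv
  refine tendsto_nhds_unique (h v) (tendsto_const_nhds.congr' ?_)
  filter_upwards [hf] with i hi
  exact (inner_eq_zero_symm.1 (hv (f i) hi)).symm

variable [CompleteSpace H]
variable {G : Type*} [Group G] (ρ : G →* unitary (H →L[ℂ] H))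

theorem unitaryRep_mul_apply (g h : G) (v : H) :
    (ρ (g * h) : H →L[ℂ] H) v = (ρ g : H →L[ℂ] H) ((ρ h : H →L[ℂ] H) v) := by
  rw [map_mul]; rfl

theorem unitaryRep_one_apply (v : H) : (ρ 1 : H →L[ℂ] H) v = v := by
  rw [map_one]; rfl

theorem unitaryRep_inner (g : G) (v w : H) :
    ⟪(ρ g : H →L[ℂ] H) v, (ρ g : H →L[ℂ] H) w⟫_ℂ = ⟪v, w⟫_ℂ :=
  ContinuousLinearMap.inner_map_map_of_mem_unitary (ρ g).2 v w

theorem unitaryRep_norm (g : G) (v : H) : ‖(ρ g : H →L[ℂ] H) v‖ = ‖v‖ :=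
  ContinuousLinearMap.norm_map_of_mem_unitary (ρ g).2 v

theorem unitaryRep_inner_inv (g : G) (v w : H) :
    ⟪v, (ρ g⁻¹ : H →L[ℂ] H) w⟫_ℂ = ⟪(ρ g : H →L[ℂ] H) v, w⟫_ℂ := by
  rw [← unitaryRep_inner ρ g, ← unitaryRep_mul_apply, mul_inv_cancel, unitaryRep_one_apply]

/-- The subspace of all vectors fixed by a subgroup. -/
def fixedSpace (L : Subgroup G) : Submodule ℂ H where
  carrier := {v | ∀ g ∈ L, (ρ g : H →L[ℂ] H) v = v}
  add_mem' hv hw g hg := by rw [map_add, hv g hg, hw g hg]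
  zero_mem' g _ := map_zero _
  smul_mem' c v hv g hg := by rw [map_smul, hv g hg]

theorem mem_fixedSpace {L : Subgroup G} {v : H} :
    v ∈ fixedSpace ρ L ↔ ∀ g ∈ L, (ρ g : H →L[ℂ] H) v = v := Iff.rfl

theorem isClosed_fixedSpace (L : Subgroup G) : IsClosed (fixedSpace ρ L : Set H) := by
  have : (fixedSpace ρ L : Set H) = ⋂ g ∈ L, {v | (ρ g : H →L[ℂ] H) v = v} := by
    ext v; simp [mem_fixedSpace]
  rw [this]
  exact isClosed_biInter fun g _ => isClosed_eq (ρ g : H →L[ℂ] H).continuous continuous_id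

instance instHasOrthogonalProjectionFixedSpace (L : Subgroup G) :
    (fixedSpace ρ L).HasOrthogonalProjection :=
  haveI := (isClosed_fixedSpace ρ L).completeSpace_coe
  inferInstance

theorem fixedSpace_anti {L M : Subgroup G} (h : L ≤ M) : fixedSpace ρ M ≤ fixedSpace ρ L :=
  fun _ hv g hg => hv g (h hg)

/-- The projection of a vector to the fixed vectors of a subgroup belongs to the closed convex hull
of the orbit. -/
theorem starProjection_fixedSpace_mem_closure (L : Subgroup G) (v : H) :
    (fixedSpace ρ L).starProjection v ∈
      closure (convexHull ℝ ((fun g => (ρ g : H →L[ℂ] H) v) '' (L : Set G))) := by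
  set O := (fun g => (ρ g : H →L[ℂ] H) v) '' (L : Set G) with hO
  set C := closure (convexHull ℝ O) with hC
  have hconv : Convex ℝ C := (convex_convexHull ℝ O).closure
  have hvO : v ∈ O := ⟨1, L.one_mem, unitaryRep_one_apply ρ v⟩
  have hvC : v ∈ C := subset_closure (subset_convexHull ℝ O hvO)
  -- The hull is invariant under the unitary action of `L`, so uniqueness forces its shortest vector
  -- to be fixed by `L`.
  obtain ⟨m, hm, huniq⟩ : ∃ m ∈ C, ∀ m' ∈ C, ‖m'‖ = ‖m‖ → m' = m :=
    let := InnerProductSpace.rclikeToReal ℂ H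
    hconv.exists_unique_min_norm ⟨v, hvC⟩ (isClosed_closure (s := convexHull ℝ O)).isComplete
  have hinv : ∀ g ∈ L, ∀ u ∈ C, (ρ g : H →L[ℂ] H) u ∈ C := by
    intro g hg u hu
    refine map_mem_closure (ρ g : H →L[ℂ] H).continuous hu fun w hw => ?_
    have h1 : convexHull ℝ O ⊆ (ρ g : H →L[ℂ] H) ⁻¹' convexHull ℝ O := by
      refine convexHull_min ?_ ((convex_convexHull ℝ O).is_linear_preimage
        ⟨map_add _, fun c x => (ρ g : H →L[ℂ] H).map_smul_of_tower c x⟩)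
      rintro _ ⟨k, hk, rfl⟩
      refine subset_convexHull ℝ O ⟨g * k, L.mul_mem hg hk, ?_⟩
      exact unitaryRep_mul_apply ρ g k v
    exact h1 hw
  have hfix : m ∈ fixedSpace ρ L := fun g hg =>
    huniq _ (hinv g hg m hm) (unitaryRep_norm ρ g m)
  -- The inner product with a fixed vector is constant on the orbit, hence on the closed hull; this
  -- identifies `m` with the projection.
  have horth : ∀ w ∈ fixedSpace ρ L, ⟪v - m, w⟫_ℂ = 0 := by
    intro w hw
    have h1 : C ⊆ {u | ⟪u, w⟫_ℂ = ⟪v, w⟫_ℂ} := by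
      refine closure_minimal (convexHull_min ?_ ((convex_singleton _).is_linear_preimage
        (isLinearMap_inner_left w))) (isClosed_eq (by fun_prop) (by fun_prop))
      rintro _ ⟨g, hg, rfl⟩
      change ⟪(ρ g : H →L[ℂ] H) v, w⟫_ℂ = _
      rw [← unitaryRep_inner_inv, hw _ (L.inv_mem hg)]
    rw [inner_sub_left, show ⟪m, w⟫_ℂ = _ from h1 hm, sub_self]
  rw [Submodule.eq_starProjection_of_mem_of_inner_eq_zero hfix horth]
  exact hm

/-- A criterion for the projection to the fixed vectors of a subgroup to preserve an inner
product. -/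
theorem inner_starProjection_fixedSpace_eq (L : Subgroup G) (v w : H)
    (h : ∀ t : Finset G, (∀ g ∈ t, g ∈ L) → ∃ k ∈ L, ∀ g ∈ t,
      ⟪(ρ g : H →L[ℂ] H) v, (ρ k : H →L[ℂ] H) w⟫_ℂ = ⟪v, w⟫_ℂ) :
    ⟪(fixedSpace ρ L).starProjection v, w⟫_ℂ = ⟪v, w⟫_ℂ := by
  classical
  set m := (fixedSpace ρ L).starProjection v with hm
  have hmL : m ∈ fixedSpace ρ L := Submodule.starProjection_apply_mem _ v
  refine eq_of_forall_dist_le fun ε hε => ?_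
  -- Only finitely many orbit points enter `u`, so one `k` serves them all. The vector `m` is fixed
  -- by `k`, so `w` may be replaced by `ρ(k)w` against `m`. The `+ 1` covers `w = 0`.
  obtain ⟨u, hu, hmu⟩ := Metric.mem_closure_iff.1 (starProjection_fixedSpace_mem_closure ρ L v)
    (ε / (‖w‖ + 1)) (by positivity)
  rw [convexHull_eq_union_convexHull_finite_subsets] at hu
  obtain ⟨s, hs, hu⟩ := Set.mem_iUnion₂.1 hu
  have hs : ∀ x : H, x ∈ s → ∃ g ∈ L, (ρ g : H →L[ℂ] H) v = x := fun x hx => hs hx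
  choose! f hf hf' using hs
  obtain ⟨k, hk, hkt⟩ := h (s.image f) fun g hg => by
    obtain ⟨x, hx, rfl⟩ := Finset.mem_image.1 hg
    exact hf x hx
  have h1 : ⟪u, (ρ k : H →L[ℂ] H) w⟫_ℂ = ⟪v, w⟫_ℂ := by
    have : convexHull ℝ (s : Set H) ⊆ {u | ⟪u, (ρ k : H →L[ℂ] H) w⟫_ℂ = ⟪v, w⟫_ℂ} := by
      refine convexHull_min (fun x hx => ?_) ((convex_singleton _).is_linear_preimage
        (isLinearMap_inner_left _))
      have h2 := hkt (f x) (Finset.mem_image_of_mem f hx)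
      rwa [show (ρ (f x) : H →L[ℂ] H) v = x from hf' x hx] at h2
    exact this hu
  have h2 : ⟪m, w⟫_ℂ = ⟪m, (ρ k : H →L[ℂ] H) w⟫_ℂ := by
    rw [← unitaryRep_inner ρ k m w, hmL k hk]
  rw [dist_eq_norm, h2, ← h1, ← inner_sub_left]
  refine (norm_inner_le_norm _ _).trans ?_
  rw [unitaryRep_norm, ← dist_eq_norm]
  have h3 : (ε / (‖w‖ + 1)) * (‖w‖ + 1) = ε := by field_simp
  have h4 : dist m u * ‖w‖ ≤ (ε / (‖w‖ + 1)) * (‖w‖ + 1) := by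
    gcongr
    linarith
  linarith

/-- The orbit lies in a closed ball around `v`; by convexity so does the projection. Thus vectors
almost fixed by a subgroup are close to fixed ones. -/
theorem norm_sub_starProjection_fixedSpace_le (L : Subgroup G) (v : H) {ε : ℝ}
    (h : ∀ g ∈ L, ‖(ρ g : H →L[ℂ] H) v - v‖ ≤ ε) :
    ‖v - (fixedSpace ρ L).starProjection v‖ ≤ ε := by
  have h1 : closure (convexHull ℝ ((fun g => (ρ g : H →L[ℂ] H) v) '' (L : Set G))) ⊆
      Metric.closedBall v ε := by
    refine closure_minimal (convexHull_min ?_ (convex_closedBall v ε)) Metric.isClosed_closedBall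
    rintro _ ⟨g, hg, rfl⟩
    rw [mem_closedBall_iff_norm]
    exact h g hg
  have h2 := h1 (starProjection_fixedSpace_mem_closure ρ L v)
  rwa [mem_closedBall_iff_norm, norm_sub_rev] at h2

/-- Contractions have limits along ultrafilters in the weak operator topology. -/
theorem exists_wot_tendsto_ultrafilter {ι : Type*} (𝒰 : Ultrafilter ι) (f : ι → H →L[ℂ] H)
    (hf : ∀ i v, ‖f i v‖ ≤ ‖v‖) :
    ∃ T : H →L[ℂ] H, Tendsto (fun i => (ContinuousLinearMapWOT.ofCLM (f i) : H →WOT[ℂ] H)) 𝒰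
      (𝓝 (ContinuousLinearMapWOT.ofCLM T)) := by
  -- Matrix coefficients stay in a compact disc. Their limits form a bounded sesquilinear form,
  -- which is represented by the operator `T`.
  have key : ∀ v w : H, ∃ c : ℂ, ‖c‖ ≤ ‖v‖ * ‖w‖ ∧ Tendsto (fun i => ⟪f i v, w⟫_ℂ) 𝒰 (𝓝 c) := by
    intro v w
    obtain ⟨c, hc, hc'⟩ := isCompact_iff_ultrafilter_le_nhds'.1
      (isCompact_closedBall (0 : ℂ) (‖v‖ * ‖w‖)) (𝒰.map fun i => ⟪f i v, w⟫_ℂ)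
      (Ultrafilter.mem_map.2 (Filter.Eventually.of_forall fun i => by
        change ⟪f i v, w⟫_ℂ ∈ Metric.closedBall (0 : ℂ) _
        rw [mem_closedBall_zero_iff]
        exact (norm_inner_le_norm _ _).trans
          (mul_le_mul_of_nonneg_right (hf i v) (norm_nonneg w))))
    exact ⟨c, by simpa using hc, hc'⟩
  choose B hB hlim using key
  let B' : H →ₗ⋆[ℂ] H →ₗ[ℂ] ℂ := LinearMap.mk₂'ₛₗ (starRingEnd ℂ) (RingHom.id ℂ) B
    (fun v v' w => tendsto_nhds_unique (hlim (v + v') w) (by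
      simpa only [map_add, inner_add_left] using (hlim v w).add (hlim v' w)))
    (fun c v w => tendsto_nhds_unique (hlim (c • v) w) (by
      simpa only [map_smul, inner_smul_left, smul_eq_mul] using (hlim v w).const_mul _))
    (fun v w w' => tendsto_nhds_unique (hlim v (w + w')) (by
      simpa only [inner_add_right] using (hlim v w).add (hlim v w')))
    (fun c v w => tendsto_nhds_unique (hlim v (c • w)) (by
      simpa only [inner_smul_right, smul_eq_mul, RingHom.id_apply] using (hlim v w).const_mul c))
  let T := InnerProductSpace.continuousLinearMapOfBilin (𝕜 := ℂ)
    (B'.mkContinuous₂ 1 fun v w => by rw [one_mul]; exact hB v w)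
  refine ⟨T, ContinuousLinearMapWOT.tendsto_iff_forall_inner_apply_tendsto.2 fun v w => ?_⟩
  have h1 : ⟪T v, w⟫_ℂ = B v w := InnerProductSpace.continuousLinearMapOfBilin_apply _ v w
  have h2 := (RCLike.continuous_conj.tendsto _).comp (hlim v w)
  rw [← h1] at h2
  refine (h2.congr fun i => inner_conj_symm _ _).trans (le_of_eq ?_)
  rw [inner_conj_symm]
  rfl

end FixedVectors

/-! ### Unitary representations of the isometry group -/

section UrysohnRepresentation

open Filter Topology TildeTree
open scoped InnerProductSpace

variable {Λ : Set (Set.Ioi (0 : ℝ))}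

/-- Each offending value is transposed with a fresh integer. Applied to branch labels at one level,
this separates `K` from finitely many translates of a branch of `F`. -/
theorem Equiv.Perm.exists_fixing_and_avoiding (N s M : Finset ℤ) :
    ∃ σ : Equiv.Perm ℤ, (∀ n ∈ N, σ n = n) ∧ ∀ n ∈ s, n ∉ N → σ n ∉ M := by
  induction s using Finset.induction_on with
  | empty => exact ⟨1, fun _ _ => rfl, by simp⟩
  | insert a s _ ih =>
    obtain ⟨σ, h1, h2⟩ := ih
    by_cases ha : a ∈ N ∨ σ a ∉ M
    · refine ⟨σ, h1, fun n hn hnN => ?_⟩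
      rcases Finset.mem_insert.1 hn with rfl | hn
      · exact ha.resolve_left hnN
      · exact h2 n hn hnN
    push Not at ha
    obtain ⟨p, hp⟩ := Infinite.exists_notMem_finset (M ∪ N ∪ s.image σ)
    simp only [Finset.mem_union, Finset.mem_image, not_or, not_exists, not_and] at hp
    refine ⟨Equiv.swap (σ a) p * σ, fun n hn => ?_, fun n hn hnN => ?_⟩
    · rw [Equiv.Perm.mul_apply, h1 n hn, Equiv.swap_apply_of_ne_of_ne]
      · intro e
        have := σ.injective ((h1 n hn).trans e)
        exact ha.1 (this ▸ hn)
      · rintro rfl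
        exact hp.1.2 hn
    · rw [Equiv.Perm.mul_apply]
      by_cases hna : n = a
      · rw [hna, Equiv.swap_apply_left]
        exact hp.1.1
      · have hn := (Finset.mem_insert.1 hn).resolve_left hna
        rw [Equiv.swap_apply_of_ne_of_ne (fun e => hna (σ.injective e)) (hp.2 n hn)]
        exact h2 n hn hnN

namespace TildeTree

/-- The point of positive height `t` over `x`. -/
noncomputable def pointOver (t : ℝ≥0∞) (ht : 0 < t) (x : UrysohnSpace Λ) :
    TildeTree Λ (UrysohnSpace Λ) :=
  Sum.inl ⟨TreePoint.mk x t, Or.inl ht⟩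

theorem map_pointOver {t : ℝ≥0∞} (ht : 0 < t) (g : UrysohnIsometryGroup Λ) (x : UrysohnSpace Λ) :
    map g (pointOver t ht x) = pointOver t ht (g x) := rfl

theorem pointOver_eq_iff {t : ℝ≥0∞} (ht : 0 < t) {x y : UrysohnSpace Λ} :
    pointOver t ht x = pointOver t ht y ↔ edist x y ≤ t :=
  ⟨fun h => (TreePoint.mk_eq_mk.1 (congrArg Subtype.val (Sum.inl_injective h))).2,
    fun h => congrArg Sum.inl (Subtype.ext (TreePoint.mk_eq_mk.2 ⟨rfl, h⟩))⟩

theorem germ_eq_iff {x y : UrysohnSpace Λ} {m : Λ} :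
    (germ x m : TildeTree Λ (UrysohnSpace Λ)) = germ y m ↔ dist x y < m.1.1 :=
  ⟨fun h => (DownGerm.mk_eq_mk.1 (Sum.inr_injective h)).2,
    fun h => congrArg Sum.inr (DownGerm.mk_eq_mk.2 ⟨rfl, h⟩)⟩

theorem vertexOver_eq_iff {x y : UrysohnSpace Λ} {m : Λ} :
    (vertexOver x m : TildeTree Λ (UrysohnSpace Λ)) = vertexOver y m ↔ dist x y ≤ m.1.1 := by
  refine (pointOver_eq_iff (ENNReal.ofReal_pos.2 m.1.2)).trans ?_
  rw [edist_dist, ENNReal.ofReal_le_ofReal_iff (Set.mem_Ioi.1 m.1.2).le]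

open scoped Classical in
/-- The finite set obtained from `F` by removing everything under the germ of height `l` directed
towards `x`, and adding the vertex of this germ. -/
noncomputable def prune (F : Finset (TildeTree Λ (UrysohnSpace Λ))) (x : UrysohnSpace Λ) (l : Λ) :
    Finset (TildeTree Λ (UrysohnSpace Λ)) :=
  insert (vertexOver x l) (F.filter fun f => ¬ f.Under (germ x l))

theorem mem_prune {F : Finset (TildeTree Λ (UrysohnSpace Λ))} {x : UrysohnSpace Λ} {l : Λ}
    {a : TildeTree Λ (UrysohnSpace Λ)} :
    a ∈ prune F x l ↔ a = vertexOver x l ∨ a ∈ F ∧ ¬ a.Under (germ x l) := by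
  classical
  exact Finset.mem_insert.trans (or_congr_right Finset.mem_filter)

theorem under_germ_mono {a : TildeTree Λ (UrysohnSpace Λ)} {x : UrysohnSpace Λ} {l m : Λ}
    (h : a.Under (germ x l)) (hlm : l.1.1 ≤ m.1.1) : a.Under (germ x m) := by
  rw [under_germ_iff a.hasCenter_center] at h ⊢
  exact ⟨h.1.mono hlm, h.2.trans_le hlm⟩

/-- A higher cut keeps fewer elements of `F` and adds a larger ball, so it imposes weaker
conditions. -/
theorem stabilizer_prune_mono (F : Finset (TildeTree Λ (UrysohnSpace Λ))) (x : UrysohnSpace Λ)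
    {l m : Λ} (hlm : l.1.1 ≤ m.1.1) :
    stabilizer (prune F x l : Set (TildeTree Λ (UrysohnSpace Λ))) ≤
      stabilizer (prune F x m : Set (TildeTree Λ (UrysohnSpace Λ))) := by
  intro g hg a ha
  rcases mem_prune.1 ha with rfl | ⟨ha, ha'⟩
  · have h1 := hg (vertexOver x l) (mem_prune.2 (Or.inl rfl))
    rw [map_vertexOver, vertexOver_eq_iff] at h1 ⊢
    exact h1.trans hlm
  · exact hg a (mem_prune.2 (Or.inr ⟨ha, fun h => ha' (under_germ_mono h hlm)⟩))

/-- An isometry that fixes `c` moves its center by less than `l`, so the added vertex is already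
fixed. -/
theorem stabilizer_le_prune {F : Finset (TildeTree Λ (UrysohnSpace Λ))}
    {c : TildeTree Λ (UrysohnSpace Λ)} (hc : c ∈ F) {x : UrysohnSpace Λ} {l : Λ}
    (hx : c.HasCenter x) (hcl : c.Below l) :
    stabilizer (F : Set (TildeTree Λ (UrysohnSpace Λ))) ≤
      stabilizer (prune F x l : Set (TildeTree Λ (UrysohnSpace Λ))) := by
  intro g hg a ha
  rcases mem_prune.1 ha with rfl | ⟨ha, -⟩
  · rw [map_vertexOver, vertexOver_eq_iff]
    exact (dist_lt_of_map_eq_self hx hcl (hg c hc)).le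
  · exact hg a ha

/-- The point or germ at the supremum of a set `D ⊆ Λ` without a largest element, on the path that
ascends from `x`. -/
theorem exists_limit_element (D : Set Λ) (hne : D.Nonempty)
    (hD : ∀ m ∈ D, ∃ n ∈ D, m.1.1 < n.1.1) :
    ∃ q : UrysohnSpace Λ → TildeTree Λ (UrysohnSpace Λ),
      (∀ (g : UrysohnIsometryGroup Λ) (x : UrysohnSpace Λ), map g (q x) = q (g x)) ∧
      ∀ x y, q x = q y ↔ ∃ m ∈ D, dist x y ≤ m.1.1 := by
  set t : ℝ≥0∞ := ⨆ m ∈ D, ENNReal.ofReal m.1.1 with ht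
  have hle : ∀ m ∈ D, ENNReal.ofReal m.1.1 < t := fun m hm => by
    obtain ⟨n, hn, hmn⟩ := hD m hm
    exact ((ENNReal.ofReal_lt_ofReal_iff n.1.2).2 hmn).trans_le
      (le_iSup₂ (f := fun (m : Λ) (_ : m ∈ D) => ENNReal.ofReal m.1.1) n hn)
  have hpos : 0 < t := by
    obtain ⟨m, hm⟩ := hne
    exact (ofReal_level_pos m).trans (hle m hm)
  have hlt : ∀ x y : UrysohnSpace Λ, edist x y < t ↔ ∃ m ∈ D, dist x y ≤ m.1.1 := by
    intro x y
    constructor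
    · intro h
      obtain ⟨m, h'⟩ := lt_iSup_iff.1 h
      obtain ⟨hm, h'⟩ := lt_iSup_iff.1 h'
      rw [edist_dist] at h'
      exact ⟨m, hm, ((ENNReal.ofReal_lt_ofReal_iff m.1.2).1 h').le⟩
    · rintro ⟨m, hm, h⟩
      rw [edist_dist]
      exact (ENNReal.ofReal_le_ofReal h).trans_lt (hle m hm)
  -- Open balls of radius `t` are wanted. If `t` is a level they are germs; if not, no distance
  -- equals `t` and closed balls are the same.
  by_cases hl : ∃ l : Λ, ENNReal.ofReal l.1.1 = t
  · obtain ⟨l, hl⟩ := hl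
    refine ⟨fun x => germ x l, fun g x => rfl, fun x y => ?_⟩
    rw [← hlt, ← hl, edist_dist, ENNReal.ofReal_lt_ofReal_iff l.1.2]
    exact germ_eq_iff
  · refine ⟨pointOver t hpos, fun g x => rfl, fun x y => ?_⟩
    rw [← hlt]
    refine (pointOver_eq_iff hpos).trans ⟨fun h => lt_of_le_of_ne h fun he => ?_, le_of_lt⟩
    have hxy : x ≠ y := by
      rintro rfl
      rw [edist_self] at he
      exact hpos.ne he
    obtain ⟨m, hm, -⟩ := UrysohnSpace.exists_level_eq_dist hxy
    exact hl ⟨m, by rw [hm, ← edist_dist, he]⟩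

end TildeTree

/-! ### Vectors fixed by stabilizers of finite sets. -/

variable {H : Type*} [NormedAddCommGroup H] [InnerProductSpace ℂ H] [CompleteSpace H]
variable (ρ : UrysohnIsometryGroup Λ →* unitary (H →L[ℂ] H))

/-- The vectors fixed by the pointwise stabilizer of a finite subset of `T̃`. -/
noncomputable abbrev levelSpace (F : Finset (TildeTree Λ (UrysohnSpace Λ))) : Submodule ℂ H :=
  fixedSpace ρ (stabilizer (F : Set (TildeTree Λ (UrysohnSpace Λ))))

theorem levelSpace_mono : Monotone (levelSpace ρ) := fun _ _ h =>
  fixedSpace_anti ρ (stabilizer_anti (Finset.coe_subset.2 h))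

/-- On a vector of level `F`, an isometry acts through its restriction to `F`. -/
theorem apply_eq_of_mem_levelSpace {F : Finset (TildeTree Λ (UrysohnSpace Λ))} {v : H}
    (hv : v ∈ levelSpace ρ F) {g h : UrysohnIsometryGroup Λ} (hgh : ∀ f ∈ F, map g f = map h f) :
    (ρ g : H →L[ℂ] H) v = (ρ h : H →L[ℂ] H) v := by
  have h1 := hv (h⁻¹ * g) fun f hf => by
    rw [TildeTree.map_mul, map_inv_eq_iff]
    exact hgh f hf
  conv_rhs => rw [← h1]
  rw [← unitaryRep_mul_apply, mul_inv_cancel_left]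

open scoped Classical in
theorem apply_mem_levelSpace {F : Finset (TildeTree Λ (UrysohnSpace Λ))} {v : H}
    (hv : v ∈ levelSpace ρ F) (g : UrysohnIsometryGroup Λ) :
    (ρ g : H →L[ℂ] H) v ∈ levelSpace ρ (F.image (TildeTree.map g)) := by
  intro h hh
  rw [← unitaryRep_mul_apply]
  refine apply_eq_of_mem_levelSpace ρ hv fun f hf => ?_
  rw [TildeTree.map_mul]
  exact hh _ (Finset.mem_coe.2 (Finset.mem_image_of_mem _ hf))

/-- Independence: the part of `F` under a germ that leads to no element of `K` does not contribute
to inner products with vectors of level `K`. -/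
theorem inner_starProjection_prune (F K : Finset (TildeTree Λ (UrysohnSpace Λ)))
    (x : UrysohnSpace Λ) (l : Λ) (hK : ∀ k ∈ K, ¬ k.Under (germ x l)) {v w : H}
    (hv : v ∈ levelSpace ρ F) (hw : w ∈ levelSpace ρ K) :
    ⟪(levelSpace ρ (prune F x l)).starProjection v, w⟫_ℂ = ⟪v, w⟫_ℂ := by
  classical
  refine inner_starProjection_fixedSpace_eq ρ _ v w fun t ht => ?_
  -- The permutation `κ` will fix the branch of `x` and those of the kept part of `F`, and move the
  -- remaining branches of `K` off the branches of `g x`, `g ∈ t`. For each such `g`, the exchange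
  -- `s` then fixes `κK`, so `sκ` acts as `g` on `F` and as `κ` on `K`, and unitarity gives the
  -- equality.
  let F₀ := F.filter fun f => ¬ f.Under (germ x l) ∧ f.Below l ∧ dist f.center x ≤ l.1.1
  obtain ⟨σ, hσN, hσM⟩ := Equiv.Perm.exists_fixing_and_avoiding
    (insert (x.toFun l) (F₀.image fun f => f.center.toFun l)) (K.image fun k => k.center.toFun l)
    (t.image fun g => (g x).toFun l)
  have hσx : σ (x.toFun l) = x.toFun l := hσN _ (Finset.mem_insert_self _ _)
  let κ := UrysohnSpace.perm x l σ
  have hκd : ∀ z, dist (κ z) z ≤ l.1.1 := UrysohnSpace.dist_permFun_le x l σ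
  have hκF : ∀ f ∈ F, ¬ f.Under (germ x l) → map κ f = f := by
    intro f hf hfx
    by_cases hfl : f.Below l
    · refine map_eq_self_of_apply_eq f.hasCenter_center ?_
      by_cases hd : dist f.center x ≤ l.1.1
      · exact UrysohnSpace.permFun_of_fixed (hσN _ (Finset.mem_insert_of_mem
          (Finset.mem_image.2 ⟨f, Finset.mem_filter.2 ⟨hf, hfx, hfl, hd⟩, rfl⟩)))
      · exact UrysohnSpace.permFun_of_not_le _ hd
    · exact map_eq_self_of_dist_le f.hasCenter_center hfl (hκd _)
  refine ⟨κ, fun a ha => ?_, fun g hg => ?_⟩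
  · rcases mem_prune.1 ha with rfl | ⟨haF, hax⟩
    · rw [map_vertexOver, vertexOver_eq_iff]
      exact hκd x
    · exact hκF a haF hax
  have hgF : ∀ f ∈ F, ¬ f.Under (germ x l) → map g f = f := fun f hf hfx =>
    ht g hg f (mem_prune.2 (Or.inr ⟨hf, hfx⟩))
  have hgF' : ∀ f ∈ F, ¬ f.Under (germ x l) → ¬ f.Under (germ (g x) l) := fun f hf hfx h => by
    rw [← hgF f hf hfx, under_map_germ_iff] at h
    exact hfx h
  have hgx : dist x (g x) ≤ l.1.1 := by
    have := ht g hg (vertexOver x l) (mem_prune.2 (Or.inl rfl))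
    rwa [map_vertexOver, vertexOver_eq_iff, dist_comm] at this
  let s := ballSwap g x l.1.1 (UrysohnSpace.level_pos l).le hgx
  have key : ∀ k ∈ K, ∀ y, dist y x ≤ l.1.1 → (map κ k).Under (germ y l) →
      k.Below l ∧ dist k.center x ≤ l.1.1 ∧ σ (k.center.toFun l) = y.toFun l := by
    intro k _ y hy hky
    obtain ⟨h1, h2⟩ := (under_germ_iff (k.hasCenter_center.map κ) y l).1 hky
    have h3 : dist k.center x ≤ l.1.1 := by
      refine (dist_triangle_max _ (κ k.center) _).trans (max_le (by rw [dist_comm]; exact hκd _) ?_)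
      exact (dist_triangle_max _ y _).trans (max_le h2.le hy)
    refine ⟨(below_map κ k l).1 h1, h3, ?_⟩
    rw [← UrysohnSpace.apply_eq_of_dist_lt h2]
    exact (UrysohnSpace.permFun_apply_level σ h3).symm
  have hKx : ∀ k ∈ K, k.Below l → dist k.center x ≤ l.1.1 →
      k.center.toFun l ≠ x.toFun l := fun k hk hkl hd e =>
    hK k hk ((under_germ_iff k.hasCenter_center x l).2
      ⟨hkl, (UrysohnSpace.dist_lt_iff_apply_eq hd).2 e⟩)
  have hκK : ∀ k ∈ K, map s (map κ k) = map κ k := by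
    intro k hk
    refine map_ballSwap_eq_self g x l hgx (fun h => ?_) fun h => ?_
    · obtain ⟨h1, h2, h3⟩ := key k hk x (by rw [dist_self]; exact (UrysohnSpace.level_pos l).le) h
      exact hKx k hk h1 h2 (σ.injective (h3.trans hσx.symm))
    · obtain ⟨h1, h2, h3⟩ := key k hk (g x) (by rwa [dist_comm]) h
      -- If `κ` fixes the branch of `k`, that branch is the one of `x`, excluded by `hK`, or of some
      -- kept `f`. In the latter case `f` would be under the germ at `g x`, but `g` fixes `f`, which
      -- is not under the germ at `x`.
      by_cases hN : k.center.toFun l ∈ insert (x.toFun l) (F₀.image fun f => f.center.toFun l)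
      · rw [hσN _ hN] at h3
        rcases Finset.mem_insert.1 hN with e | e
        · exact hKx k hk h1 h2 e
        · obtain ⟨f, hf, hfk⟩ := Finset.mem_image.1 e
          obtain ⟨hfF, hfx, hfl, hfd⟩ := Finset.mem_filter.1 hf
          refine hgF' f hfF hfx ((under_germ_iff f.hasCenter_center _ l).2 ⟨hfl, ?_⟩)
          exact (UrysohnSpace.dist_lt_iff_apply_eq
            ((dist_triangle_max _ x _).trans (max_le hfd hgx))).2 (hfk.trans h3)
      · exact hσM _ (Finset.mem_image_of_mem _ hk) hN
          (h3 ▸ Finset.mem_image_of_mem (fun g => (g x).toFun l) hg)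
  have hv' : (ρ g : H →L[ℂ] H) v = (ρ (s * κ) : H →L[ℂ] H) v := by
    refine apply_eq_of_mem_levelSpace ρ hv fun f hf => ?_
    rw [TildeTree.map_mul]
    by_cases hfx : f.Under (germ x l)
    · have h1 := ((under_germ_iff f.hasCenter_center x l).1 hfx).2
      have h2 : map κ f = f := map_eq_self_of_apply_eq f.hasCenter_center
        (UrysohnSpace.permFun_of_fixed (by rw [UrysohnSpace.apply_eq_of_dist_lt h1, hσx]))
      rw [h2, map_ballSwap_of_under g x l hgx hfx]
    · rw [hκF f hf hfx, hgF f hf hfx, map_ballSwap_eq_self g x l hgx hfx (hgF' f hf hfx)]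
  have hw' : (ρ κ : H →L[ℂ] H) w = (ρ (s * κ) : H →L[ℂ] H) w := by
    refine apply_eq_of_mem_levelSpace ρ hw fun k hk => ?_
    rw [TildeTree.map_mul, hκK k hk]
  rw [hv', hw', unitaryRep_inner]

/-- By independence, the projections of `w` to the level of `F` and to the pruned level have the
same inner products with all vectors of level `F`, so they coincide. -/
theorem starProjection_mem_levelSpace_prune {F K : Finset (TildeTree Λ (UrysohnSpace Λ))}
    {c : TildeTree Λ (UrysohnSpace Λ)} (hc : c ∈ F) {x : UrysohnSpace Λ} (hx : c.HasCenter x)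
    {l : Λ} (hcl : c.Below l) (hK : ∀ k ∈ K, ¬ k.Under (germ x l)) {w : H}
    (hw : w ∈ levelSpace ρ K) :
    (levelSpace ρ F).starProjection w ∈ levelSpace ρ (prune F x l) := by
  have hle : levelSpace ρ (prune F x l) ≤ levelSpace ρ F :=
    fixedSpace_anti ρ (stabilizer_le_prune hc hx hcl)
  set u := (levelSpace ρ F).starProjection w with hu
  have huF : u ∈ levelSpace ρ F := Submodule.starProjection_apply_mem _ w
  set p := (levelSpace ρ (prune F x l)).starProjection w with hp
  have hpp : p ∈ levelSpace ρ (prune F x l) := Submodule.starProjection_apply_mem _ w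
  have hd : u - p ∈ levelSpace ρ F := Submodule.sub_mem _ huF (hle hpp)
  have h1 : ∀ v ∈ levelSpace ρ F, ⟪v, u - p⟫_ℂ = 0 := by
    intro v hv
    rw [inner_sub_right, hu, hp, ← Submodule.inner_starProjection_left_eq_right,
      ← Submodule.inner_starProjection_left_eq_right,
      inner_starProjection_prune ρ F K x l hK hv hw,
      Submodule.starProjection_eq_self_iff.2 hv, sub_self]
  rw [sub_eq_zero.1 (inner_self_eq_zero.1 (h1 _ hd))]
  exact hpp

/-- Every vector is approximated by vectors fixed by stabilizers of finite subsets of `T̃`. -/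
theorem top_le_closure_iSup_levelSpace
    (hρ : ∀ v : H, Continuous fun g : UrysohnIsometryGroup Λ => (ρ g : H →L[ℂ] H) v) :
    ⊤ ≤ (⨆ F, levelSpace ρ F).topologicalClosure := by
  classical
  intro v _
  change v ∈ closure _
  refine Metric.mem_closure_iff.2 fun ε hε => ?_
  have h1 : {g : UrysohnIsometryGroup Λ | dist ((ρ g : H →L[ℂ] H) v) v < ε / 2} ∈
      𝓝 (1 : UrysohnIsometryGroup Λ) := by
    have := (hρ v).tendsto 1
    rw [unitaryRep_one_apply] at this
    exact this (Metric.ball_mem_nhds v (half_pos hε))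
  obtain ⟨U, hU, hU'⟩ := (mem_nhds_induced _ _ _).1 h1
  rw [nhds_pi] at hU
  obtain ⟨I, hI, t, ht, hIt⟩ := Filter.mem_pi.1 hU
  choose δ hδ hδt using fun i => Metric.mem_nhds_iff.1 (ht i)
  -- Fixing the closed ball of radius `δ/2` bounds the displacement of `x` by `δ/2`, strictly less
  -- than `δ`.
  let q : UrysohnSpace Λ → TildeTree Λ (UrysohnSpace Λ) := fun x =>
    pointOver (ENNReal.ofReal (δ x / 2)) (ENNReal.ofReal_pos.2 (half_pos (hδ x))) x
  let F := hI.toFinset.image q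
  have h2 : ∀ g ∈ stabilizer (F : Set (TildeTree Λ (UrysohnSpace Λ))),
      ‖(ρ g : H →L[ℂ] H) v - v‖ ≤ ε / 2 := by
    intro g hg
    have h3 : g ∈ {g : UrysohnIsometryGroup Λ | dist ((ρ g : H →L[ℂ] H) v) v < ε / 2} := by
      refine hU' (hIt fun i hi => hδt i ?_)
      have h4 := hg (q i) (Finset.mem_coe.2 (Finset.mem_image_of_mem q (hI.mem_toFinset.2 hi)))
      rw [map_pointOver, pointOver_eq_iff, edist_dist,
        ENNReal.ofReal_le_ofReal_iff (half_pos (hδ i)).le] at h4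
      exact h4.trans_lt (half_lt_self (hδ i))
    rw [← dist_eq_norm]
    exact le_of_lt h3
  refine ⟨(levelSpace ρ F).starProjection v, Submodule.mem_iSup_of_mem F
    (Submodule.starProjection_apply_mem _ v), ?_⟩
  rw [dist_eq_norm]
  exact (norm_sub_starProjection_fixedSpace_le ρ _ v h2).trans_lt (half_lt_self hε)

end UrysohnRepresentation

/-! ### Limits of unitary operators along ultrafilters that converge in the semigroup -/

section UltrafilterLimits

open Filter Topology TildeTree
open scoped InnerProductSpace

variable {Λ : Set (Set.Ioi (0 : ℝ))}
variable {H : Type*} [NormedAddCommGroup H] [InnerProductSpace ℂ H] [CompleteSpace H]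
variable (ρ : UrysohnIsometryGroup Λ →* unitary (H →L[ℂ] H))

/-- The closure of the set of vectors fixed by stabilizers of finite subsets of `S`. -/
noncomputable def supportSpace (S : Set (TildeTree Λ (UrysohnSpace Λ))) : Submodule ℂ H :=
  (⨆ F : {F : Finset (TildeTree Λ (UrysohnSpace Λ)) // ∀ f ∈ F, f ∈ S},
    levelSpace ρ F.1).topologicalClosure

theorem isClosed_supportSpace (S : Set (TildeTree Λ (UrysohnSpace Λ))) :
    IsClosed (supportSpace ρ S : Set H) :=
  Submodule.isClosed_topologicalClosure _

instance instHasOrthogonalProjectionSupportSpace (S : Set (TildeTree Λ (UrysohnSpace Λ))) :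
    (supportSpace ρ S).HasOrthogonalProjection :=
  haveI : CompleteSpace (supportSpace ρ S) := (isClosed_supportSpace ρ S).completeSpace_coe
  inferInstance

theorem levelSpace_le_supportSpace {S : Set (TildeTree Λ (UrysohnSpace Λ))}
    {F : Finset (TildeTree Λ (UrysohnSpace Λ))} (hF : ∀ f ∈ F, f ∈ S) :
    levelSpace ρ F ≤ supportSpace ρ S :=
  (le_iSup (fun F : {F : Finset (TildeTree Λ (UrysohnSpace Λ)) // ∀ f ∈ F, f ∈ S} =>
    levelSpace ρ F.1) ⟨F, hF⟩).trans (Submodule.le_topologicalClosure _)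

theorem starProjection_eq_of_mem {E : Type*} [NormedAddCommGroup E] [InnerProductSpace ℂ E]
    {U V : Submodule ℂ E} [U.HasOrthogonalProjection] [V.HasOrthogonalProjection] (h : U ≤ V)
    {y : E} (hy : V.starProjection y ∈ U) : V.starProjection y = U.starProjection y := by
  rw [← Submodule.starProjection_eq_self_iff.2 hy]
  exact congrArg (fun T : E →L[ℂ] E => T y) (Submodule.starProjection_comp_starProjection_of_le h)

theorem tendsto_inner_starProjection {E ι : Type*} [NormedAddCommGroup E] [InnerProductSpace ℂ E]
    (V : Submodule ℂ E) [V.HasOrthogonalProjection] {l : Filter ι} {f : ι → E} {y : E}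
    (h : ∀ v, Tendsto (fun i => ⟪v, f i⟫_ℂ) l (𝓝 ⟪v, y⟫_ℂ)) (v : E) :
    Tendsto (fun i => ⟪v, V.starProjection (f i)⟫_ℂ) l (𝓝 ⟪v, V.starProjection y⟫_ℂ) := by
  simp only [← Submodule.inner_starProjection_left_eq_right]
  exact h _

open Classical in
/-- The weak limit of `ρ(g)⁻¹ w` along an ultrafilter that converges to `π` is approximated by
vectors fixed by stabilizers of finite subsets of the domain of `π`. -/
theorem starProjection_levelSpace_mem_supportSpace
    {𝒰 : Ultrafilter (UrysohnIsometryGroup Λ)} {S : Set (TildeTree Λ (UrysohnSpace Λ))}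
    (hS : ∀ a b, (∀ᶠ g : UrysohnIsometryGroup Λ in 𝒰, TildeTree.map g a = b) → a ∈ S)
    {K : Finset (TildeTree Λ (UrysohnSpace Λ))} (hKne : K.Nonempty) {w y : H}
    (hw : w ∈ levelSpace ρ K)
    (hy : ∀ v, Tendsto (fun g : UrysohnIsometryGroup Λ => ⟪v, (ρ g⁻¹ : H →L[ℂ] H) w⟫_ℂ) 𝒰
      (𝓝 ⟪v, y⟫_ℂ)) (n : ℕ) :
    ∀ F : Finset (TildeTree Λ (UrysohnSpace Λ)), (F.filter (· ∉ S)).card = n →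
      (levelSpace ρ F).starProjection y ∈ supportSpace ρ S := by
  induction n using Nat.strong_induction_on with | _ n ih => ?_
  intro F hn
  by_cases hFS : ∀ f ∈ F, f ∈ S
  · exact levelSpace_le_supportSpace ρ hFS (Submodule.starProjection_apply_mem _ y)
  push Not at hFS
  obtain ⟨c, hcF, hcS⟩ := hFS
  obtain ⟨x, hx⟩ := c.exists_hasCenter
  -- The induction step: dropping `c` and adding an element of `S` lowers the number of elements
  -- outside of `S`.
  have hcard : ∀ (q : TildeTree Λ (UrysohnSpace Λ)) (F' : Finset (TildeTree Λ (UrysohnSpace Λ))),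
      q ∈ S → (∀ f ∈ F', f = q ∨ f ∈ F ∧ f ≠ c) →
      (levelSpace ρ F').starProjection y ∈ supportSpace ρ S := by
    intro q F' hq hF'
    refine ih _ ?_ F' rfl
    rw [← hn]
    refine Finset.card_lt_card ⟨fun f hf => ?_, fun h => ?_⟩
    · obtain ⟨h1, h2⟩ := Finset.mem_filter.1 hf
      rcases hF' f h1 with rfl | ⟨h3, -⟩
      · exact absurd hq h2
      · exact Finset.mem_filter.2 ⟨h3, h2⟩
    · obtain ⟨h1, h2⟩ := Finset.mem_filter.1 (h (Finset.mem_filter.2 ⟨hcF, hcS⟩))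
      rcases hF' c h1 with rfl | ⟨-, h3⟩
      · exact h2 hq
      · exact h3 rfl
  -- The nearest center in the finite set `K` to `g x` is the same for most `g`.
  obtain ⟨k, -, hk⟩ : ∃ k ∈ (K : Set (TildeTree Λ (UrysohnSpace Λ))),
      ∀ᶠ g : UrysohnIsometryGroup Λ in 𝒰, ∀ k' ∈ K, dist (g x) k.center ≤ dist (g x) k'.center := by
    refine (Ultrafilter.eventually_exists_mem_iff K.finite_toSet).1 (Eventually.of_forall fun g => ?_)
    obtain ⟨k, hk, hmin⟩ := K.exists_min_image (fun k => dist (g x) k.center) hKne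
    exact ⟨k, hk, hmin⟩
  set z := k.center with hz
  -- The height of the cut is the distance from `g x` to `K`. If it did not exceed `c`, then `g(c)`
  -- would be the ball of the same kind and height around `z`, for most `g`, and `c` would be in
  -- `S`.
  obtain ⟨lev, hlev⟩ : ∃ lev : UrysohnIsometryGroup Λ → Λ, ∀ᶠ g : UrysohnIsometryGroup Λ in 𝒰,
      (lev g).1.1 = dist (g x) z ∧ c.Below (lev g) := by
    have h1 : ∀ᶠ g : UrysohnIsometryGroup Λ in 𝒰, ∃ l : Λ, l.1.1 = dist (g x) z ∧ c.Below l := by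
      by_contra h
      rw [← Ultrafilter.eventually_not] at h
      refine hcS (hS c (TildeTree.map (UrysohnSpace.translate x z) c) (h.mono fun g hg => ?_))
      have h2 := hx.map (UrysohnSpace.translate x z)
      rw [UrysohnSpace.translate_apply_self] at h2
      refine (eq_or_exists_level (hx.map g) h2 ?_ ?_).resolve_right ?_
      · simp only [isLeft_map]
      · simp only [height_map]
      · rintro ⟨m, hm, hb⟩
        exact hg ⟨m, hm, (below_map g c m).1 hb⟩
    obtain ⟨g₀, l₀, -⟩ := h1.exists
    have : Nonempty Λ := ⟨l₀⟩
    exact h1.choice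
  -- As `lev g` is the least distance, no element of `g⁻¹K` is under the germ of that height at `x`.
  have hmem : ∀ᶠ g : UrysohnIsometryGroup Λ in 𝒰,
      (levelSpace ρ F).starProjection ((ρ g⁻¹ : H →L[ℂ] H) w) ∈
        levelSpace ρ (prune F x (lev g)) := by
    filter_upwards [hk, hlev] with g hg hg'
    refine starProjection_mem_levelSpace_prune ρ hcF hx hg'.2 (fun k' hk' hu => ?_)
      (apply_mem_levelSpace ρ hw g⁻¹)
    obtain ⟨k'', hk'', rfl⟩ := Finset.mem_image.1 hk'
    rw [← under_map_germ_iff g, (map_inv_eq_iff g k'' _).1 rfl |>.symm,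
      under_germ_iff k''.hasCenter_center, dist_comm, hg'.1] at hu
    exact absurd (hg k'' hk'') (not_le.2 hu.2)
  have hweak := tendsto_inner_starProjection (levelSpace ρ F) hy
  have hprune : ∀ m, c.Below m → levelSpace ρ (prune F x m) ≤ levelSpace ρ F := fun m hm =>
    fixedSpace_anti ρ (stabilizer_le_prune hcF hx hm)
  have hcc : ∀ m, c.Below m → c.Under (germ x m) := fun m hm => under_germ_of_below hx hm
  by_cases hcase : ∀ᶠ g : UrysohnIsometryGroup Λ in 𝒰,
      ∀ᶠ g' : UrysohnIsometryGroup Λ in 𝒰, (lev g').1.1 ≤ (lev g).1.1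
  -- The levels `lev g` are constant or accumulate from above. For `m` in `E` the vertex over `x` is
  -- eventually sent to the vertex over `z`, so cuts at `m` fall under the induction.
  · let E : Set Λ := {m | ∀ᶠ g : UrysohnIsometryGroup Λ in 𝒰, (lev g).1.1 ≤ m.1.1}
    have hEbelow : ∀ m ∈ E, c.Below m := fun m hm => by
      obtain ⟨g, h1, h2⟩ := ((show ∀ᶠ g : UrysohnIsometryGroup Λ in 𝒰, _ from hm).and hlev).exists
      exact h2.2.mono h1
    have hES : ∀ m ∈ E, (levelSpace ρ (prune F x m)).starProjection y ∈ supportSpace ρ S := by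
      intro m hm
      refine hcard (vertexOver x m) _ (hS _ (vertexOver z m) ?_) fun f hf => ?_
      · filter_upwards [show ∀ᶠ g : UrysohnIsometryGroup Λ in 𝒰, _ from hm, hlev] with g h1 h2
        rw [map_vertexOver, vertexOver_eq_iff, ← h2.1]
        exact h1
      · rcases mem_prune.1 hf with h | ⟨h, h'⟩
        · exact Or.inl h
        · refine Or.inr ⟨h, ?_⟩
          rintro rfl
          exact h' (hcc m (hEbelow m hm))
    let V : (E)ᵒᵈ → Submodule ℂ H := fun m => levelSpace ρ (prune F x (OrderDual.ofDual m).1)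
    have hV : Monotone V := fun m m' h => fixedSpace_anti ρ (stabilizer_prune_mono F x h)
    have hEne : Nonempty (E)ᵒᵈ := by
      obtain ⟨g, hg⟩ := hcase.exists
      exact ⟨OrderDual.toDual ⟨lev g, hg⟩⟩
    have hVc : CompleteSpace (⨆ m, V m).topologicalClosure :=
      (Submodule.isClosed_topologicalClosure (⨆ m, V m)).completeSpace_coe
    -- The pruned spaces grow as the cut goes down, whence the order dual. The projection of `y` is
    -- a weak limit of vectors from their union, hence the norm limit of its own projections to
    -- them.
    have hyV : (levelSpace ρ F).starProjection y ∈ (⨆ m, V m).topologicalClosure := by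
      refine Submodule.mem_of_tendsto_inner _ ?_ hweak
      filter_upwards [hmem, hcase] with g h1 h2
      exact Submodule.le_topologicalClosure _
        (Submodule.mem_iSup_of_mem (OrderDual.toDual (⟨lev g, h2⟩ : E)) h1)
    have hlim := Submodule.starProjection_tendsto_closure_iSup V hV
      ((levelSpace ρ F).starProjection y)
    rw [Submodule.starProjection_eq_self_iff.2 hyV] at hlim
    refine (isClosed_supportSpace ρ S).mem_of_tendsto hlim (Eventually.of_forall fun m => ?_)
    have h1 := congrArg (fun T : H →L[ℂ] H => T y)
      (Submodule.starProjection_comp_starProjection_of_le (hprune _ (hEbelow _ (OrderDual.ofDual m).2)))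
    exact (show _ = _ from h1) ▸ hES _ (OrderDual.ofDual m).2
  · rw [← Ultrafilter.eventually_not] at hcase
    -- The levels `lev g` accumulate strictly from below. No single level is a correct cut, so the
    -- cut is made at the element `q x` of height `sup D`.
    let D : Set Λ := {m | ∀ᶠ g : UrysohnIsometryGroup Λ in 𝒰, m.1.1 < (lev g).1.1}
    have hlevD : ∀ᶠ g : UrysohnIsometryGroup Λ in 𝒰, lev g ∈ D := by
      filter_upwards [hcase] with g hg
      rw [← Ultrafilter.eventually_not] at hg
      exact hg.mono fun g' => not_le.1
    have hDmem : ∀ m ∈ D, ∀ᶠ g : UrysohnIsometryGroup Λ in 𝒰, m.1.1 < (lev g).1.1 :=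
      fun m hm => hm
    obtain ⟨q, hqmap, hq⟩ := exists_limit_element D
      (by obtain ⟨g, hg⟩ := hlevD.exists; exact ⟨_, hg⟩)
      (fun m hm => by
        obtain ⟨g, h1, h2⟩ := (hlevD.and (hDmem m hm)).exists
        exact ⟨lev g, h1, h2⟩)
    let F' : Finset (TildeTree Λ (UrysohnSpace Λ)) :=
      insert (q x) (F.filter fun f => ∀ᶠ g : UrysohnIsometryGroup Λ in 𝒰, ¬ f.Under (germ x (lev g)))
    have hqS : q x ∈ S := by
      refine hS _ (q z) ?_
      filter_upwards [hlev, hlevD] with g h1 h2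
      rw [hqmap, hq]
      exact ⟨lev g, h2, h1.1.ge⟩
    have hF'S : (levelSpace ρ F').starProjection y ∈ supportSpace ρ S := by
      refine hcard (q x) F' hqS fun f hf => ?_
      rcases Finset.mem_insert.1 hf with h | h
      · exact Or.inl h
      · obtain ⟨h1, h2⟩ := Finset.mem_filter.1 h
        refine Or.inr ⟨h1, ?_⟩
        rintro rfl
        obtain ⟨g, h3, h4⟩ := (h2.and hlev).exists
        exact h3 (hcc _ h4.2)
    have hle : levelSpace ρ F' ≤ levelSpace ρ F := by
      refine fixedSpace_anti ρ fun u hu a ha => ?_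
      rcases Finset.mem_insert.1 (Finset.mem_coe.1 ha) with rfl | h
      · obtain ⟨g, h1, h2⟩ := (hlev.and hlevD).exists
        rw [hqmap, hq]
        exact ⟨lev g, h2, (dist_lt_of_map_eq_self hx h1.2 (hu c hcF)).le⟩
      · exact hu a (Finset.mem_filter.1 h).1
    have hyD : ∀ m ∈ D, (levelSpace ρ F).starProjection y ∈ levelSpace ρ (prune F x m) := by
      intro m hm
      refine Submodule.mem_of_tendsto_inner _ ?_ hweak
      filter_upwards [hmem, hDmem m hm] with g h1 h2
      exact fixedSpace_anti ρ (stabilizer_prune_mono F x h2.le) h1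
    have hyF' : (levelSpace ρ F).starProjection y ∈ levelSpace ρ F' := by
      intro u hu
      have h1 := hu (q x) (Finset.mem_coe.2 (Finset.mem_insert_self _ _))
      rw [hqmap, hq] at h1
      obtain ⟨m, hm, hum⟩ := h1
      -- An isometry `u` that fixes `q x` moves `x` by at most some `m` in `D`. For a suitable `lev
      -- g > m` in `D`, it then fixes the whole of `F` pruned at `lev g`.
      have h2 : ∀ᶠ g : UrysohnIsometryGroup Λ in 𝒰, ∀ f ∈ F, ¬ f.Under (germ x (lev g)) →
          f ∈ F' := by
        refine (Finset.eventually_all F).2 fun f hf => ?_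
        by_cases hfu : ∀ᶠ g : UrysohnIsometryGroup Λ in 𝒰, ¬ f.Under (germ x (lev g))
        · exact Eventually.of_forall fun g _ =>
            Finset.mem_insert_of_mem (Finset.mem_filter.2 ⟨hf, hfu⟩)
        · rw [Ultrafilter.eventually_not, not_not] at hfu
          exact hfu.mono fun g h h' => absurd h h'
      obtain ⟨g, h3, h4, h5⟩ := (h2.and (hlevD.and (hDmem m hm))).exists
      refine hyD _ h4 u fun a ha => ?_
      rcases mem_prune.1 (Finset.mem_coe.1 ha) with rfl | ⟨h6, h7⟩
      · rw [map_vertexOver, vertexOver_eq_iff]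
        exact hum.trans h5.le
      · exact hu a (Finset.mem_coe.2 (h3 a h6 h7))
    rw [starProjection_eq_of_mem hle hyF']
    exact hF'S

theorem starProjection_levelSpace_tendsto
    (hρ : ∀ v : H, Continuous fun g : UrysohnIsometryGroup Λ => (ρ g : H →L[ℂ] H) v) (v : H) :
    Tendsto (fun F => (levelSpace ρ F).starProjection v) atTop (𝓝 v) :=
  Submodule.starProjection_tendsto_self _ (levelSpace_mono ρ) v
    (top_le_closure_iSup_levelSpace ρ hρ)

end UltrafilterLimits

/-! ### The extension of a unitary representation to the semigroup -/

section Extension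

open Filter Topology ContinuousLinearMapWOT
open scoped InnerProductSpace

/-- A map on a dense subset that has limits at all points extends to a continuous map. -/
theorem DenseRange.exists_continuous_extension {α β γ : Type*} [TopologicalSpace β]
    [TopologicalSpace γ] [T3Space γ] {i : α → β} (hi : DenseRange i) {f : α → γ}
    (hf : ∀ b, ∃ c, Tendsto f (comap i (𝓝 b)) (𝓝 c)) :
    ∃ F : β → γ, Continuous F ∧ ∀ b, Tendsto f (comap i (𝓝 b)) (𝓝 (F b)) := by
  let : TopologicalSpace α := TopologicalSpace.induced i inferInstance
  have hd : IsDenseInducing i := ⟨⟨rfl⟩, hi⟩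
  refine ⟨hd.extend f, hd.continuous_extend hf, fun b => ?_⟩
  obtain ⟨c, hc⟩ := hf b
  rwa [hd.extend_eq_of_tendsto hc]

/-- A limit exists if it exists and is the same along all ultrafilters. -/
theorem Filter.exists_tendsto_of_ultrafilter {α γ : Type*} [TopologicalSpace γ] {l : Filter α}
    [l.NeBot] {f : α → γ} (h : ∀ 𝒰 : Ultrafilter α, ↑𝒰 ≤ l → ∃ c, Tendsto f 𝒰 (𝓝 c))
    (huniq : ∀ 𝒰 𝒱 : Ultrafilter α, ↑𝒰 ≤ l → ↑𝒱 ≤ l → ∀ c d, Tendsto f 𝒰 (𝓝 c) →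
      Tendsto f 𝒱 (𝓝 d) → c = d) : ∃ c, Tendsto f l (𝓝 c) := by
  obtain ⟨c, hc⟩ := h (Ultrafilter.of l) (Ultrafilter.of_le l)
  refine ⟨c, (tendsto_iff_ultrafilter _ _ _).2 fun 𝒰 h𝒰 => ?_⟩
  obtain ⟨d, hd⟩ := h 𝒰 h𝒰
  rwa [huniq _ _ (Ultrafilter.of_le l) h𝒰 c d hc hd]

/-! ### Adjoints and one-sided products in the weak operator topology. -/

section WeakOperatorTopology

variable {H : Type*} [NormedAddCommGroup H] [InnerProductSpace ℂ H] [CompleteSpace H]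
variable {β : Type*} [TopologicalSpace β] {F : β → H →L[ℂ] H}

theorem ContinuousLinearMapWOT.continuous_ofCLM_iff :
    Continuous (fun b => (ofCLM (F b) : H →WOT[ℂ] H)) ↔
      ∀ v w, Continuous fun b => ⟪w, F b v⟫_ℂ := by
  simp only [continuous_iff_continuousAt, ContinuousAt, tendsto_iff_forall_inner_apply_tendsto]
  exact ⟨fun h v w b => h b v w, fun h b v w => h v w b⟩

theorem ContinuousLinearMapWOT.continuous_ofCLM_mul_const
    (hF : Continuous (fun b => (ofCLM (F b) : H →WOT[ℂ] H))) (T : H →L[ℂ] H) :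
    Continuous (fun b => (ofCLM (F b * T) : H →WOT[ℂ] H)) := by
  rw [continuous_ofCLM_iff] at hF ⊢
  exact fun v w => hF (T v) w

theorem ContinuousLinearMapWOT.continuous_ofCLM_star
    (hF : Continuous (fun b => (ofCLM (F b) : H →WOT[ℂ] H))) :
    Continuous (fun b => (ofCLM (star (F b)) : H →WOT[ℂ] H)) := by
  rw [continuous_ofCLM_iff] at hF ⊢
  intro v w
  simp only [ContinuousLinearMap.star_eq_adjoint, ContinuousLinearMap.adjoint_inner_right]
  exact (RCLike.continuous_conj.comp (hF w v)).congr fun b => inner_conj_symm _ _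

theorem ContinuousLinearMapWOT.continuous_ofCLM_const_mul
    (hF : Continuous (fun b => (ofCLM (F b) : H →WOT[ℂ] H))) (T : H →L[ℂ] H) :
    Continuous (fun b => (ofCLM (T * F b) : H →WOT[ℂ] H)) := by
  refine (continuous_ofCLM_star (continuous_ofCLM_mul_const (continuous_ofCLM_star hF)
    (star T))).congr fun b => ?_
  rw [star_mul, star_star, star_star]

end WeakOperatorTopology

variable {Λ : Set (Set.Ioi (0 : ℝ))}
variable {H : Type*} [NormedAddCommGroup H] [InnerProductSpace ℂ H] [CompleteSpace H]

theorem WoollySemigroup.ofIsometry_one :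
    ofIsometry (1 : UrysohnIsometryGroup Λ) = (1 : WoollySemigroup Λ) :=
  Subtype.ext TildeTree.ofIsometry_refl

theorem WoollySemigroup.ofIsometry_mul (g h : UrysohnIsometryGroup Λ) :
    ofIsometry (g * h) = (ofIsometry g * ofIsometry h : WoollySemigroup Λ) :=
  Subtype.ext (TildeTree.ofIsometry_mul g h)

theorem WoollySemigroup.ofIsometry_inv (g : UrysohnIsometryGroup Λ) :
    ofIsometry g⁻¹ = (star (ofIsometry g) : WoollySemigroup Λ) := rfl

variable (ρ : UrysohnIsometryGroup Λ →* unitary (H →L[ℂ] H))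

/-! ### Independence of the limit from the ultrafilter. -/

section Limits

variable {𝒰 𝒱 : Ultrafilter (UrysohnIsometryGroup Λ)} {π : WoollySemigroup Λ} {T T' : H →L[ℂ] H}

theorem sends_iff_of_tendsto (h : Tendsto WoollySemigroup.ofIsometry 𝒰 (𝓝 π))
    (a b : TildeTree Λ (UrysohnSpace Λ)) :
    π.1.Sends a b ↔ ∀ᶠ g : UrysohnIsometryGroup Λ in 𝒰, TildeTree.map g a = b := by
  rw [WoollySemigroup.tendsto_nhds_iff_ultrafilter.1 h]
  exact eventually_congr (Eventually.of_forall fun g => TildeTree.ofIsometry_sends g a b)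

/-- The adjoint applied to `w` is the weak limit of `ρ(g⁻¹)w`. Its projections to all the levels are
in the support space and converge to it; density of levels then removes the restriction on `w`. -/
theorem adjoint_apply_mem_supportSpace
    (hρ : ∀ v : H, Continuous fun g : UrysohnIsometryGroup Λ => (ρ g : H →L[ℂ] H) v)
    (h : Tendsto WoollySemigroup.ofIsometry 𝒰 (𝓝 π))
    (hT : Tendsto (fun g => (ofCLM (ρ g : H →L[ℂ] H) : H →WOT[ℂ] H)) 𝒰 (𝓝 (ofCLM T))) (w : H) :
    T.adjoint w ∈ supportSpace ρ π.1.dom := by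
  classical
  have hlevel : ∀ (K : Finset (TildeTree Λ (UrysohnSpace Λ))) (w : H), w ∈ levelSpace ρ K →
      T.adjoint w ∈ supportSpace ρ π.1.dom := by
    intro K w hw
    refine (isClosed_supportSpace ρ _).mem_of_tendsto
      (starProjection_levelSpace_tendsto ρ hρ (T.adjoint w)) (Eventually.of_forall fun F => ?_)
    -- Adding `∞` to `K` only makes it non-empty, so that a nearest center exists.
    refine starProjection_levelSpace_mem_supportSpace ρ (𝒰 := 𝒰) (w := w) (S := π.1.dom)
      (K := insert (Sum.inl (corePointTop Λ)) K)
      (fun a b hab => ⟨b, (sends_iff_of_tendsto h a b).2 hab⟩) (Finset.insert_nonempty _ _)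
      (levelSpace_mono ρ (Finset.subset_insert _ _) hw) (fun v => ?_) _ F rfl
    have h1 := (RCLike.continuous_conj.tendsto _).comp
      (tendsto_iff_forall_inner_apply_tendsto.1 hT v w)
    simp only [unitaryRep_inner_inv, ContinuousLinearMap.adjoint_inner_right]
    refine (h1.congr fun i => inner_conj_symm _ _).trans (le_of_eq ?_)
    rw [inner_conj_symm]
    rfl
  exact (isClosed_supportSpace ρ _).mem_of_tendsto
    ((T.adjoint.continuous.tendsto w).comp (starProjection_levelSpace_tendsto ρ hρ w))
    (Eventually.of_forall fun F => hlevel F _ (Submodule.starProjection_apply_mem _ w))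

theorem tendsto_apply_of_mem_levelSpace (h : Tendsto WoollySemigroup.ofIsometry 𝒰 (𝓝 π))
    (hT : Tendsto (fun g => (ofCLM (ρ g : H →L[ℂ] H) : H →WOT[ℂ] H)) 𝒰 (𝓝 (ofCLM T)))
    {A : Finset (TildeTree Λ (UrysohnSpace Λ))} {v : H}
    (hv : v ∈ levelSpace ρ A) {g₀ : UrysohnIsometryGroup Λ}
    (hg₀ : ∀ a ∈ A, π.1.Sends a (TildeTree.map g₀ a)) : T v = (ρ g₀ : H →L[ℂ] H) v := by
  have h1 : ∀ᶠ g : UrysohnIsometryGroup Λ in 𝒰, ∀ a ∈ A,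
      TildeTree.map g a = TildeTree.map g₀ a :=
    (Finset.eventually_all A).2 fun a ha => (sends_iff_of_tendsto h _ _).1 (hg₀ a ha)
  refine ext_inner_left ℂ fun w => tendsto_nhds_unique
    (tendsto_iff_forall_inner_apply_tendsto.1 hT v w) (tendsto_const_nhds.congr' ?_)
  filter_upwards [h1] with g hg
  exact congrArg _ (apply_eq_of_mem_levelSpace ρ hv hg).symm

/-- On the support space of the domain of `π` both limits act through `π`; on its orthogonal
complement both vanish, because their adjoints take values in the support space. -/
theorem eq_of_tendsto_ofIsometry
    (hρ : ∀ v : H, Continuous fun g : UrysohnIsometryGroup Λ => (ρ g : H →L[ℂ] H) v)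
    (h : Tendsto WoollySemigroup.ofIsometry 𝒰 (𝓝 π))
    (h' : Tendsto WoollySemigroup.ofIsometry 𝒱 (𝓝 π))
    (hT : Tendsto (fun g => (ofCLM (ρ g : H →L[ℂ] H) : H →WOT[ℂ] H)) 𝒰 (𝓝 (ofCLM T)))
    (hT' : Tendsto (fun g => (ofCLM (ρ g : H →L[ℂ] H) : H →WOT[ℂ] H)) 𝒱 (𝓝 (ofCLM T'))) :
    T = T' := by
  have hsupp : supportSpace ρ π.1.dom ≤ LinearMap.eqLocus T.toLinearMap T'.toLinearMap := by
    refine Submodule.topologicalClosure_minimal _ (iSup_le fun ⟨A, hA⟩ v hv => ?_)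
      (isClosed_eq T.continuous T'.continuous)
    have h1 : ∀ᶠ g : UrysohnIsometryGroup Λ in 𝒰, ∀ a ∈ A, π.1.Sends a (TildeTree.map g a) := by
      refine (Finset.eventually_all A).2 fun a ha => ?_
      obtain ⟨b, hb⟩ := hA a ha
      filter_upwards [(sends_iff_of_tendsto h a b).1 hb] with g hg
      rwa [hg]
    obtain ⟨g₀, hg₀⟩ := h1.exists
    exact (tendsto_apply_of_mem_levelSpace ρ h hT hv hg₀).trans
      (tendsto_apply_of_mem_levelSpace ρ h' hT' hv hg₀).symm
  have hperp : ∀ (𝒲 : Ultrafilter (UrysohnIsometryGroup Λ)) (R : H →L[ℂ] H),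
      Tendsto WoollySemigroup.ofIsometry 𝒲 (𝓝 π) →
      Tendsto (fun g => (ofCLM (ρ g : H →L[ℂ] H) : H →WOT[ℂ] H)) 𝒲 (𝓝 (ofCLM R)) →
      ∀ r ∈ (supportSpace ρ π.1.dom)ᗮ, R r = 0 := by
    intro 𝒲 R h hR r hr
    refine ext_inner_left ℂ fun w => ?_
    rw [inner_zero_right, ← ContinuousLinearMap.adjoint_inner_left]
    exact hr _ (adjoint_apply_mem_supportSpace ρ hρ h hR w)
  ext v
  rw [← (supportSpace ρ π.1.dom).starProjection_add_starProjection_orthogonal v, map_add, map_add,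
    hperp 𝒰 T h hT _ (Submodule.starProjection_apply_mem _ v),
    hperp 𝒱 T' h' hT' _ (Submodule.starProjection_apply_mem _ v)]
  exact congrArg (· + 0) (hsupp (Submodule.starProjection_apply_mem _ v))

end Limits

/-- A unitary representation extends to a continuous map of the semigroup to operators with the
weak operator topology. -/
theorem exists_continuous_extension_wot
    (hρ : ∀ v : H, Continuous fun g : UrysohnIsometryGroup Λ => (ρ g : H →L[ℂ] H) v) :
    ∃ R : WoollySemigroup Λ → H →L[ℂ] H, Continuous (fun π => (ofCLM (R π) : H →WOT[ℂ] H)) ∧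
      ∀ g, R (WoollySemigroup.ofIsometry g) = ρ g := by
  have hlim (𝒰 : Ultrafilter (UrysohnIsometryGroup Λ)) := exists_wot_tendsto_ultrafilter 𝒰
    (fun g => (ρ g : H →L[ℂ] H)) fun g v => (unitaryRep_norm ρ g v).le
  obtain ⟨F, hF, hF'⟩ := WoollySemigroup.denseRange_ofIsometry.exists_continuous_extension
    (f := fun g : UrysohnIsometryGroup Λ => (ofCLM (ρ g : H →L[ℂ] H) : H →WOT[ℂ] H)) fun π => by
      have : (comap WoollySemigroup.ofIsometry (𝓝 π)).NeBot :=
        comap_neBot_iff_frequently.2 (mem_closure_iff_frequently.1 (WoollySemigroup.denseRange_ofIsometry π))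
      refine Filter.exists_tendsto_of_ultrafilter (fun 𝒰 _ => (hlim 𝒰).imp' _ fun T => id)
        fun 𝒰 𝒱 h𝒰 h𝒱 c d hc hd => ?_
      obtain ⟨T, rfl⟩ := ofCLM_surjective c
      obtain ⟨T', rfl⟩ := ofCLM_surjective d
      rw [eq_of_tendsto_ofIsometry ρ hρ (tendsto_iff_comap.2 h𝒰) (tendsto_iff_comap.2 h𝒱) hc hd]
  choose R hR using fun π => ofCLM_surjective (F π)
  refine ⟨R, by simpa only [hR] using hF, fun g => ofCLM_injective ?_⟩
  rw [hR]
  -- The limit over all isometries near `g` is evaluated along the principal filter at `g`.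
  have h1 := (hF' (WoollySemigroup.ofIsometry g)).mono_left
    (show pure g ≤ _ from tendsto_iff_comap.1 (tendsto_pure_pure _ _ |>.mono_right (pure_le_nhds _)))
  exact tendsto_nhds_unique h1 (tendsto_pure_nhds _ g)

/-- Maps to operators that are continuous in the weak operator topology agree if they agree on
isometries. -/
theorem eq_of_eq_ofIsometry {E : Type*} [NormedAddCommGroup E]
    [InnerProductSpace ℂ E] {R R' : WoollySemigroup Λ → E →L[ℂ] E}
    (hR : Continuous (fun π => (ofCLM (R π) : E →WOT[ℂ] E)))
    (hR' : Continuous (fun π => (ofCLM (R' π) : E →WOT[ℂ] E)))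
    (h : ∀ g, R (WoollySemigroup.ofIsometry g) = R' (WoollySemigroup.ofIsometry g)) : R = R' := by
  have := WoollySemigroup.denseRange_ofIsometry.equalizer hR hR' (by funext g; simp [h])
  funext π
  exact ofCLM_injective (congrFun this π)

/-- Separate continuity extends multiplicativity one factor at a time: first with an isometry on the
left, then with an arbitrary left factor. -/
theorem exists_starMonoidHom_extension
    (hρ : ∀ v : H, Continuous fun g : UrysohnIsometryGroup Λ => (ρ g : H →L[ℂ] H) v) :
    ∃ R : WoollySemigroup Λ →⋆* (H →L[ℂ] H),
      Continuous (fun π => (ofCLM (R π) : H →WOT[ℂ] H)) ∧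
      ∀ g, R (WoollySemigroup.ofIsometry g) = ρ g := by
  obtain ⟨R, hR, hRρ⟩ := exists_continuous_extension_wot ρ hρ
  have hmul' : ∀ g ψ, R (WoollySemigroup.ofIsometry g * ψ) =
      R (WoollySemigroup.ofIsometry g) * R ψ := fun g => congrFun <| eq_of_eq_ofIsometry
    (hR.comp (WoollySemigroup.continuous_mul_left _)) (continuous_ofCLM_const_mul hR _) fun h => by
      rw [← WoollySemigroup.ofIsometry_mul, hRρ, hRρ, hRρ, map_mul]; rfl
  have hmul : ∀ π ψ, R (π * ψ) = R π * R ψ := fun π ψ => congrFun (eq_of_eq_ofIsometry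
    (R := fun π => R (π * ψ)) (R' := fun π => R π * R ψ)
    (hR.comp (WoollySemigroup.continuous_mul_right _)) (continuous_ofCLM_mul_const hR _)
    fun g => hmul' g ψ) π
  have hstar : ∀ π, R (star π) = star (R π) := congrFun <| eq_of_eq_ofIsometry
    (hR.comp WoollySemigroup.continuous_star) (continuous_ofCLM_star hR) fun g => by
      rw [← WoollySemigroup.ofIsometry_inv, hRρ, hRρ, map_inv]; rfl
  have hone : R 1 = 1 := by
    rw [← WoollySemigroup.ofIsometry_one, hRρ, map_one]; rfl
  exact ⟨⟨⟨⟨R, hone⟩, hmul⟩, hstar⟩, hR, hRρ⟩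

end Extension

theorem theorem6p1 (Λ : Set (Set.Ioi (0 : ℝ))) (hΛ : Λ.Countable)
    {H : Type*} [NormedAddCommGroup H] [InnerProductSpace ℂ H] [CompleteSpace H]
    [TopologicalSpace.SeparableSpace H]
    (ρ : UrysohnIsometryGroup Λ →* unitary (H →L[ℂ] H))
    (hρ : ∀ v : H, Continuous fun g : UrysohnIsometryGroup Λ => (ρ g : H →L[ℂ] H) v) :
    CompactSpace (WoollySemigroup Λ) ∧
    ∃ ρbar : WoollySemigroup Λ →⋆* (H →L[ℂ] H),
      (Continuous (fun π => (ContinuousLinearMapWOT.ofCLM (ρbar π) : H →WOT[ℂ] H)) ∧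
        ∀ g, ρbar (WoollySemigroup.ofIsometry g) = ρ g) ∧
      (∀ σ : WoollySemigroup Λ →⋆* (H →L[ℂ] H),
        Continuous (fun π => (ContinuousLinearMapWOT.ofCLM (σ π) : H →WOT[ℂ] H)) →
        (∀ g, σ (WoollySemigroup.ofIsometry g) = ρ g) → σ = ρbar) ∧
      closure (Set.range fun g => (ContinuousLinearMapWOT.ofCLM (ρ g : H →L[ℂ] H) : H →WOT[ℂ] H)) =
        Set.range fun π => (ContinuousLinearMapWOT.ofCLM (ρbar π) : H →WOT[ℂ] H) := by
  obtain ⟨R, hR, hRρ⟩ := exists_starMonoidHom_extension ρ hρ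
  refine ⟨WoollySemigroup.instCompactSpace, R, ⟨hR, hRρ⟩, fun σ hσ hσρ => ?_, ?_⟩
  · exact DFunLike.coe_injective (eq_of_eq_ofIsometry hσ hR fun g => (hσρ g).trans (hRρ g).symm)
  -- The image of the compact semigroup is closed, and the isometries are dense in it.
  · refine (closure_minimal ?_ (isCompact_range hR).isClosed).antisymm ?_
    · rintro _ ⟨g, rfl⟩
      exact ⟨WoollySemigroup.ofIsometry g, congrArg _ (hRρ g)⟩
    · refine (hR.range_subset_closure_image_dense WoollySemigroup.denseRange_ofIsometry).trans
        (closure_mono ?_)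
      rintro _ ⟨_, ⟨g, rfl⟩, rfl⟩
      exact ⟨g, congrArg _ (hRρ g).symm⟩
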